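/- For a matrix $A\in\mathbb{C}^{m\times n}$ let $\|A\|_F$ and $\|A\|$ be its Frobenius and spectral norms and, if $A\neq 0$, let $\kappa_2=\kappa_2(A)$ be the ratio of its largest to its smallest non-zero singular value. For $f\colon\mathbb{R}_{\ge 0}\to\mathbb{R}_{\ge 0}$ with $f(0)=0$ and a singular value decomposition $M=U\Sigma V^*$, let $\Phi_f(M)=U\Sigma_fV^*$, where $\Sigma_f$ is obtained from $\Sigma$ by applying $f$ to the diagonal entries. Put $$L=\left[\frac{\|A\|}{\sqrt2\,\kappa_2},\ \frac{\|A\|}{\sqrt2\,\kappa_2}\sqrt{2\kappa_2^2+1}\right],\qquad \Omega=\max_{\sigma\in L}|f(\sigma)|,\qquad \varphi=\sup_{\sigma\in L}|f'(\sigma)| .$$ A matrix $M$ with $m$ rows and $n$ columns is given by *sampling access* if the following operations are available: reading $\|M\|_F^2$ at cost $O(1)$; reading an entry, drawing a row index $i$ with probability $\|M_{(i,\cdot)}\|^2/\|M\|_F^2$, and, for given $i$, drawing a column index $j$ with probability $|M_{(i,j)}|^2/\|M_{(i,\cdot)}\|^2$, each at cost $O(\log^2(mn)+1)$; reading a row norm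 at cost $O(\log^2 m+1)$. A vector is treated as a one-column matrix. Algorithms are randomized random access machines with exact complex arithmetic, square roots, comparisons, uniformly random indices and evaluations of $f$ at unit cost, in which the singular value decomposition of a $p\times q$ matrix costs $O((p+q)^3)$ and finding $\lceil x\rceil$ for a real number $x\ge0$ costs $O(1+\lceil x\rceil)$. **Theorem.** There are one randomized algorithm and absolute constants $C,k$ such that the following holds for every $f\colon\mathbb{R}_{\ge 0}\to\mathbb{R}_{\ge 0}$ with $f(0)=0$, every $\eta\in(0,1)$, every non-zero $A\in\mathbb{C}^{m\times n}$, every non-zero $b\in\mathbb{C}^m$ and every $i\in\{1,\dots,n\}$ such that $f$ is differentiable on $L$ with bounded derivative, and every $\epsilon_1$ with $$0<\epsilon_1<\|A\|\,\|b\|\left\{\varphi+3\sqrt2\,\Omega\frac{\kappa_2}{\|A\|}\right\}.$$ Given sampling access to $A$ and $b$, evaluations of $f$, the index $i$, the dimensions $m,n$ and the numbers $\epsilon_1,\eta,\|A\|,\kappa_2,\Omega,\varphi$, the algorithm outputs with probability at least $1-\eta$ a value $\lambda$ such that $|(\Phi_f(A^*)b)_i-\lambda|\le\epsilon_1$, and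 in every run it uses at most $$C\,\frac{\|A\|_F^8\|b\|^4\kappa_2^4}{\epsilon_1^4\,\eta}\left(\frac{\kappa_2}{\|A\|}\right)^6\Omega^2\left\{\varphi+3\sqrt2\,\Omega\frac{\kappa_2}{\|A\|}\right\}^2\left(1+\log\frac{mn}{\eta}\right)^k$$ samples and time at most $$C\,\frac{\|A\|_F^{12}\|b\|^6\kappa_2^{12}}{\|A\|^6\,\epsilon_1^6\,\eta^3}\left\{\varphi+7\sqrt2\,\Omega\frac{\kappa_2}{\|A\|}\right\}^6\bigl(1+\log(mn)\bigr)^k .$$ -/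

import Mathlib

open scoped NNReal ENNReal Matrix

noncomputable section

namespace SVT

/-! ### Norms, singular values, singular value transformation -/

section
open scoped Matrix.Norms.L2Operator

/-- The spectral norm. -/
def specNorm {m n : ℕ} (M : Matrix (Fin m) (Fin n) ℂ) : ℝ := ‖M‖

end

section
open scoped Matrix.Norms.Frobenius

/-- The Frobenius norm. -/
def frobNorm {m n : ℕ} (M : Matrix (Fin m) (Fin n) ℂ) : ℝ := ‖M‖

end

/-- The Euclidean norm of the `i`-th row. -/
def rowNorm {m n : ℕ} (M : Matrix (Fin m) (Fin n) ℂ) (i : Fin m) : ℝ :=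
  ‖WithLp.toLp 2 (M i)‖

/-- The singular values in non-increasing order (counted from `0`, and `0` from the rank on). -/
def singularValue {m n : ℕ} (M : Matrix (Fin m) (Fin n) ℂ) (i : ℕ) : ℝ :=
  (Matrix.toEuclideanLin M).singularValues i

/-- The `ℓ²` condition number: largest singular value over smallest non-zero singular value
(junk if `M = 0`). -/
def condNumber {m n : ℕ} (M : Matrix (Fin m) (Fin n) ℂ) : ℝ :=
  singularValue M 0 / singularValue M (M.rank - 1)

/-- The `m × n` matrix with `s 0, s 1, …` down the diagonal. -/
def rectDiag (m n : ℕ) (s : ℕ → ℝ) : Matrix (Fin m) (Fin n) ℂ :=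
  Matrix.of fun i j => if (i : ℕ) = (j : ℕ) then (s i : ℂ) else 0

/-- `M = U Σ V*` is a singular value decomposition. -/
def IsSVD {m n : ℕ} (M : Matrix (Fin m) (Fin n) ℂ)
    (U : Matrix (Fin m) (Fin m) ℂ) (V : Matrix (Fin n) (Fin n) ℂ) : Prop :=
  U ∈ Matrix.unitaryGroup (Fin m) ℂ ∧ V ∈ Matrix.unitaryGroup (Fin n) ℂ ∧
    M = U * rectDiag m n (singularValue M) * Vᴴ

theorem basisMatrix_mem_unitaryGroup {n : ℕ}
    (v : OrthonormalBasis (Fin n) ℂ (EuclideanSpace ℂ (Fin n))) :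
    (Matrix.of fun i j => v j i) ∈ Matrix.unitaryGroup (Fin n) ℂ := by
  rw [Matrix.mem_unitaryGroup_iff']
  ext i j
  have h := orthonormal_iff_ite.1 v.orthonormal i j
  rw [PiLp.inner_apply] at h
  simp only [RCLike.inner_apply] at h
  rw [Matrix.mul_apply, Matrix.one_apply, ← h]
  refine Finset.sum_congr rfl fun k _ => ?_
  simp [Matrix.star_apply, mul_comm]

theorem exists_isSVD {m n : ℕ} (M : Matrix (Fin m) (Fin n) ℂ) :
    ∃ UV : Matrix (Fin m) (Fin m) ℂ × Matrix (Fin n) (Fin n) ℂ, IsSVD M UV.1 UV.2 := by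
  set T := Matrix.toEuclideanLin M with hT
  have hn : Module.finrank ℂ (EuclideanSpace ℂ (Fin n)) = n := by simp
  have hm : Module.finrank ℂ (EuclideanSpace ℂ (Fin m)) = Fintype.card (Fin m) := by simp
  set r := Module.finrank ℂ T.range
  have hrn : r ≤ n := (LinearMap.finrank_range_le T).trans hn.le
  have hrm : r ≤ m := (Submodule.finrank_le _).trans (by simp)
  let v := T.isSymmetric_adjoint_comp_self.eigenvectorBasis hn
  have hv : ∀ i j : Fin n, inner ℂ (T (v i)) (T (v j)) =
      if i = j then ((T.singularValues i : ℂ) ^ 2) else 0 := by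
    intro i j
    have h1 : (LinearMap.adjoint T ∘ₗ T) (v j) = ((T.singularValues j ^ 2 : ℝ) : ℂ) • v j := by
      rw [T.sq_singularValues_fin hn]
      exact T.isSymmetric_adjoint_comp_self.apply_eigenvectorBasis hn j
    rw [← LinearMap.adjoint_inner_right, ← LinearMap.comp_apply, h1, inner_smul_right,
      orthonormal_iff_ite.1 v.orthonormal]
    split_ifs with h
    · subst h; simp
    · simp
  have hpos : ∀ i, i < r → T.singularValues i ≠ 0 := fun i hi =>
    (T.singularValues_pos_iff_lt_finrank_range.2 hi).ne'
  let w : Fin m → EuclideanSpace ℂ (Fin m) := fun i =>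
    if h : (i : ℕ) < n then ((T.singularValues i : ℂ))⁻¹ • T (v ⟨i, h⟩) else 0
  let s : Set (Fin m) := {i | (i : ℕ) < r}
  have hw : Orthonormal ℂ (s.domRestrict w) := by
    rw [orthonormal_iff_ite]
    rintro ⟨i, hi⟩ ⟨j, hj⟩
    have hi' : (i : ℕ) < r := hi
    have hj' : (j : ℕ) < r := hj
    have hne : (T.singularValues i : ℂ) ≠ 0 := by exact_mod_cast hpos _ hi'
    simp only [Set.domRestrict_apply, w, dif_pos (hi'.trans_le hrn), dif_pos (hj'.trans_le hrn),
      inner_smul_left, inner_smul_right, hv, Subtype.mk.injEq, Fin.ext_iff]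
    split_ifs with h
    · rw [← h]
      simp only [map_inv₀, Complex.conj_ofReal]
      field_simp
    · simp
  obtain ⟨u, hu⟩ := hw.exists_orthonormalBasis_extension_of_card_eq hm
  refine ⟨(Matrix.of fun i j => u j i, Matrix.of fun i j => v j i),
    basisMatrix_mem_unitaryGroup u, basisMatrix_mem_unitaryGroup v, ?_⟩
  have hV := basisMatrix_mem_unitaryGroup v
  have key : M * (Matrix.of fun i j => v j i) =
      (Matrix.of fun i j => u j i) * rectDiag m n (singularValue M) := by
    ext i j
    have hL : (M * (Matrix.of fun i j => v j i)) i j = T (v j) i := by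
      simp [hT, Matrix.mul_apply, Matrix.toLpLin_apply, Matrix.mulVec, dotProduct]
    rw [hL, Matrix.mul_apply]
    by_cases hj : (j : ℕ) < r
    · have hjm : (j : ℕ) < m := hj.trans_le hrm
      have hne : (T.singularValues j : ℂ) ≠ 0 := by exact_mod_cast hpos _ hj
      rw [Finset.sum_eq_single ⟨j, hjm⟩]
      · have := hu ⟨j, hjm⟩ hj
        simp only [Matrix.of_apply, this, w, dif_pos j.2, rectDiag, singularValue, if_true, ← hT,
          PiLp.smul_apply, smul_eq_mul, Fin.eta]
        field_simp
      · intro k _ hk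
        have : (k : ℕ) ≠ j := fun h => hk (Fin.ext h)
        simp [rectDiag, this]
      · simp
    · have h0 : T.singularValues j = 0 :=
        T.singularValues_eq_zero_iff_le_finrank_range.2 (not_lt.1 hj)
      have hT0 : T (v j) = 0 := by
        rw [← inner_self_eq_zero (𝕜 := ℂ), hv]; simp [h0]
      rw [hT0, Finset.sum_eq_zero]
      · simp
      · intro k _
        by_cases hk : (k : ℕ) = j
        · simp [rectDiag, hk, singularValue, ← hT, h0]
        · simp [rectDiag, hk]
  show M = _
  rw [← key, Matrix.mul_assoc, ← Matrix.star_eq_conjTranspose, Matrix.mem_unitaryGroup_iff.1 hV,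
    Matrix.mul_one]

/-- A singular value decomposition: the pair `(U, V)`. -/
def svd {m n : ℕ} (M : Matrix (Fin m) (Fin n) ℂ) :
    Matrix (Fin m) (Fin m) ℂ × Matrix (Fin n) (Fin n) ℂ :=
  Classical.choose (exists_isSVD M)

/-- The singular value transformation `Φ_f(M) = U Σ_f V*`. -/
def svTransform (f : ℝ≥0 → ℝ≥0) {m n : ℕ} (M : Matrix (Fin m) (Fin n) ℂ) :
    Matrix (Fin m) (Fin n) ℂ :=
  (svd M).1 * rectDiag m n (fun i => f (singularValue M i).toNNReal) * (svd M).2ᴴ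

/-- `f` as a function of a real variable (only its values on the non-negative reals matter). -/
def realExt (f : ℝ≥0 → ℝ≥0) (x : ℝ) : ℝ := f x.toNNReal

/-- The interval `L` determined by `A`. -/
def intervalL {m n : ℕ} (A : Matrix (Fin m) (Fin n) ℂ) : Set ℝ :=
  Set.Icc (specNorm A / (√2 * condNumber A))
    (specNorm A / (√2 * condNumber A) * √(2 * condNumber A ^ 2 + 1))

/-- `Ω`, the maximum of `|f|` on `L`. -/
def maxAbs (f : ℝ≥0 → ℝ≥0) (L : Set ℝ) : ℝ :=
  sSup ((fun x => |realExt f x|) '' L)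

/-- `φ`, the maximum of `|f'|` on `L`. -/
def maxAbsDeriv (f : ℝ≥0 → ℝ≥0) (L : Set ℝ) : ℝ :=
  sSup ((fun x => |derivWithin (realExt f) L x|) '' L)

/-! ### Sampling access -/

/-- The distribution `𝒫_v` on indices, `𝒫_v(i) = |v i|² / ‖v‖²` (the index `0` if `v = 0`). -/
def l2Sample {k : ℕ} (v : Fin k → ℂ) : PMF ℕ := by
  classical
  exact if h : (∑' i, (‖v i‖ₑ ^ 2 : ℝ≥0∞)) ≠ 0 then
    (PMF.normalize (fun i => ‖v i‖ₑ ^ 2) h (by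
      rw [tsum_fintype]
      exact ENNReal.sum_ne_top.2 fun i _ => ENNReal.pow_ne_top enorm_ne_top)).map Fin.val
  else PMF.pure 0

/-- A matrix held in the data structure. -/
structure Stored where
  rows : ℕ
  cols : ℕ
  mat : Matrix (Fin rows) (Fin cols) ℂ

namespace Stored

/-- The cost `log² (rows * cols)` of reading an entry or drawing a sample. -/
def opCost (D : Stored) : ℕ := (Nat.clog 2 (D.rows * D.cols) + 1) ^ 2

/-- The cost `log² rows` of reading a row norm. -/
def rowNormCost (D : Stored) : ℕ := (Nat.clog 2 D.rows + 1) ^ 2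

/-- An entry (`0` out of range). -/
def entry (D : Stored) (i j : ℕ) : ℂ :=
  if h : i < D.rows ∧ j < D.cols then D.mat ⟨i, h.1⟩ ⟨j, h.2⟩ else 0

/-- A row norm (`0` out of range). -/
def rowNorm (D : Stored) (i : ℕ) : ℝ :=
  if h : i < D.rows then SVT.rowNorm D.mat ⟨i, h⟩ else 0

/-- A row index, with probability proportional to the squared row norm. -/
def sampleRow (D : Stored) : PMF ℕ := l2Sample fun i => (SVT.rowNorm D.mat i : ℂ)

/-- A column index, with probability proportional to `|D i j|²`. -/
def sampleCol (D : Stored) (i : ℕ) : PMF ℕ :=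
  if h : i < D.rows then l2Sample (D.mat ⟨i, h⟩) else PMF.pure 0

end Stored

/-! ### The machine: a randomized random access machine over `ℕ` (indices) and `ℂ` (values)

Exact arithmetic operations, comparisons, square roots and evaluations of `f` have unit cost. -/

/-- What a program has access to: the stored matrix `A`, the stored vector `b` (as a one-column
matrix), and evaluations of `f`. -/
structure Env where
  f : ℝ≥0 → ℝ≥0
  A : Stored
  b : Stored

/-- The names of the two stored objects. -/
inductive Src where
  | A
  | b

/-- The stored object with a given name. -/
def Env.get (E : Env) : Src → Stored
  | .A => E.A
  | .b => E.b

/-- The memory (countably many two-dimensional arrays of natural numbers and of complex numbers)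
with the time and the number of samples used so far. -/
structure State where
  nat : ℕ → ℕ → ℕ → ℕ
  val : ℕ → ℕ → ℕ → ℂ
  time : ℕ
  samples : ℕ

namespace State

def setNat (s : State) (a i j x : ℕ) : State :=
  { s with nat := fun a' i' j' => if a' = a ∧ i' = i ∧ j' = j then x else s.nat a' i' j' }

def setVal (s : State) (a i j : ℕ) (z : ℂ) : State :=
  { s with val := fun a' i' j' => if a' = a ∧ i' = i ∧ j' = j then z else s.val a' i' j' }

/-- Overwrite the upper left `p × q` block of the array `a`. -/
def setBlock (s : State) (a : ℕ) {p q : ℕ} (M : Matrix (Fin p) (Fin q) ℂ) : State :=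
  { s with val := fun a' i j =>
      if h : a' = a ∧ i < p ∧ j < q then M ⟨i, h.2.1⟩ ⟨j, h.2.2⟩ else s.val a' i j }

/-- The upper left `p × q` block of the array `a`. -/
def block (s : State) (a p q : ℕ) : Matrix (Fin p) (Fin q) ℂ :=
  Matrix.of fun i j => s.val a i j

def addTime (s : State) (t : ℕ) : State := { s with time := s.time + t }

def addSample (s : State) : State := { s with samples := s.samples + 1 }

end State

/-- Expressions with natural number values; `cell a i j` reads the array `a` at `(i, j)`. -/
inductive NExp where
  | lit (k : ℕ)
  | cell (a : ℕ) (i j : NExp)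
  | add (e₁ e₂ : NExp)

namespace NExp

def eval (s : State) : NExp → ℕ
  | lit k => k
  | cell a i j => s.nat a (i.eval s) (j.eval s)
  | add e₁ e₂ => e₁.eval s + e₂.eval s

def cost : NExp → ℕ
  | lit _ => 1
  | cell _ i j => i.cost + j.cost + 1
  | add e₁ e₂ => e₁.cost + e₂.cost + 1

end NExp

/-- Expressions with complex values. -/
inductive ZExp where
  | lit (k : ℕ)
  | imagUnit
  | ofNat (e : NExp)
  | cell (a : ℕ) (i j : NExp)
  | add (z w : ZExp)
  | mul (z w : ZExp)
  | neg (z : ZExp)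
  | inv (z : ZExp)
  | conj (z : ZExp)
  | re (z : ZExp)
  | sqrt (z : ZExp)
  | app (z : ZExp)

namespace ZExp

/-- `sqrt` and `app` (the evaluation of `f`) act on the real part; `0⁻¹ = 0`. -/
def eval (E : Env) (s : State) : ZExp → ℂ
  | lit k => (k : ℂ)
  | imagUnit => Complex.I
  | ofNat e => (e.eval s : ℂ)
  | cell a i j => s.val a (i.eval s) (j.eval s)
  | add z w => z.eval E s + w.eval E s
  | mul z w => z.eval E s * w.eval E s
  | neg z => -z.eval E s
  | inv z => (z.eval E s)⁻¹
  | conj z => star (z.eval E s)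
  | re z => ((z.eval E s).re : ℂ)
  | sqrt z => (√(z.eval E s).re : ℂ)
  | app z => ((realExt E.f (z.eval E s).re : ℝ) : ℂ)

def cost : ZExp → ℕ
  | lit _ => 1
  | imagUnit => 1
  | ofNat e => e.cost + 1
  | cell _ i j => i.cost + j.cost + 1
  | add z w => z.cost + w.cost + 1
  | mul z w => z.cost + w.cost + 1
  | neg z => z.cost + 1
  | inv z => z.cost + 1
  | conj z => z.cost + 1
  | re z => z.cost + 1
  | sqrt z => z.cost + 1
  | app z => z.cost + 1

end ZExp

/-- Tests: comparison of natural numbers, and of real parts. -/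
inductive Test where
  | natLt (e₁ e₂ : NExp)
  | reLe (z w : ZExp)

namespace Test

def holds (E : Env) (s : State) : Test → Prop
  | natLt e₁ e₂ => e₁.eval s < e₂.eval s
  | reLe z w => (z.eval E s).re ≤ (w.eval E s).re

def cost : Test → ℕ
  | natLt e₁ e₂ => e₁.cost + e₂.cost + 1
  | reLe z w => z.cost + w.cost + 1

end Test

/-- A memory location: an array and two index expressions. -/
structure Loc where
  arr : ℕ
  i : NExp
  j : NExp

namespace Loc

def cost (l : Loc) : ℕ := l.i.cost + l.j.cost + 1

def putNat (l : Loc) (s : State) (x : ℕ) : State := s.setNat l.arr (l.i.eval s) (l.j.eval s) x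

def putVal (l : Loc) (s : State) (z : ℂ) : State := s.setVal l.arr (l.i.eval s) (l.j.eval s) z

end Loc

/-- Programs. -/
inductive Cmd where
  | skip
  | setNat (l : Loc) (e : NExp)
  | setVal (l : Loc) (z : ZExp)
  | seq (c d : Cmd)
  | ite (t : Test) (c d : Cmd)
  /-- run `c` with `0, 1, …, e - 1` in the cell `(0, 0)` of the array `v` -/
  | loop (v : ℕ) (e : NExp) (c : Cmd)
  /-- the ceiling of a real number, found by counting up to it -/
  | ceil (l : Loc) (z : ZExp)
  /-- a uniformly random natural number below `e` -/
  | uniform (l : Loc) (e : NExp)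
  /-- the squared Frobenius norm -/
  | frobSq (D : Src) (l : Loc)
  | entry (D : Src) (l : Loc) (i j : NExp)
  | rowNorm (D : Src) (l : Loc) (i : NExp)
  | sampleRow (D : Src) (l : Loc)
  | sampleCol (D : Src) (l : Loc) (i : NExp)
  /-- singular value decomposition of the upper left `p × q` block of the array `x`; the arrays
  `u`, `d` and `v` receive the three factors (`d` as a column of singular values) -/
  | svd (x u d v : ℕ) (p q : NExp)

/-- Run `body 0`, `body 1`, …, `body (k - 1)` one after the other. -/
def iterate (body : ℕ → State → PMF State) : ℕ → State → PMF State
  | 0, s => PMF.pure s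
  | k + 1, s => (iterate body k s).bind (body k)

open Classical in
/-- The distribution of the final state of a program. -/
def Cmd.exec (E : Env) : Cmd → State → PMF State
  | skip, s => PMF.pure s
  | setNat l e, s => PMF.pure ((l.putNat s (e.eval s)).addTime (l.cost + e.cost + 1))
  | setVal l z, s => PMF.pure ((l.putVal s (z.eval E s)).addTime (l.cost + z.cost + 1))
  | seq c d, s => (c.exec E s).bind (d.exec E)
  | ite t c d, s =>
      if t.holds E s then c.exec E (s.addTime (t.cost + 1)) else d.exec E (s.addTime (t.cost + 1))
  | loop v e c, s =>
      iterate (fun k s' => c.exec E ((s'.setNat v 0 0 k).addTime 1)) (e.eval s)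
        (s.addTime (e.cost + 1))
  | ceil l z, s =>
      PMF.pure ((l.putNat s ⌈(z.eval E s).re⌉₊).addTime
        (l.cost + z.cost + ⌈(z.eval E s).re⌉₊ + 1))
  | uniform l e, s =>
      (if h : (Finset.range (e.eval s)).Nonempty then PMF.uniformOfFinset _ h else PMF.pure 0).map
        fun x => (l.putNat s x).addTime (l.cost + e.cost + 1)
  | frobSq D l, s =>
      PMF.pure ((l.putVal s ((frobNorm (E.get D).mat ^ 2 : ℝ) : ℂ)).addTime (l.cost + 1))
  | entry D l i j, s =>
      PMF.pure ((l.putVal s ((E.get D).entry (i.eval s) (j.eval s))).addTime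
        (l.cost + i.cost + j.cost + (E.get D).opCost))
  | rowNorm D l i, s =>
      PMF.pure ((l.putVal s ((E.get D).rowNorm (i.eval s) : ℂ)).addTime
        (l.cost + i.cost + (E.get D).rowNormCost))
  | sampleRow D l, s =>
      (E.get D).sampleRow.map fun x =>
        ((l.putNat s x).addTime (l.cost + (E.get D).opCost)).addSample
  | sampleCol D l i, s =>
      ((E.get D).sampleCol (i.eval s)).map fun x =>
        ((l.putNat s x).addTime (l.cost + i.cost + (E.get D).opCost)).addSample
  | svd x u d v p q, s =>
      let M := s.block x (p.eval s) (q.eval s)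
      PMF.pure ((((s.setBlock u (SVT.svd M).1).setBlock d
        (Matrix.of fun (i : Fin (min (p.eval s) (q.eval s))) (_ : Fin 1) =>
          (singularValue M i : ℂ))).setBlock v (SVT.svd M).2).addTime
            (p.cost + q.cost + (p.eval s + q.eval s) ^ 3 + 1))

/-- The initial state: the natural number inputs and the real inputs are in the first column of
the respective array `0`, everything else is `0`. -/
def initial (ks : List ℕ) (xs : List ℝ) : State where
  nat := fun a i j => if a = 0 ∧ j = 0 then ks.getD i 0 else 0
  val := fun a i j => if a = 0 ∧ j = 0 then ((xs.getD i 0 : ℝ) : ℂ) else 0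
  time := 0
  samples := 0

/-- The output is the first cell of the complex array `0`. -/
def State.output (s : State) : ℂ := s.val 0 0 0

/-- The distribution of the final state of the program `P` on the input `i`, for the accuracy `ε`,
the failure probability `η` and the parameters `‖A‖`, `κ₂`, `Ω`, `φ`, with access to `A`, to `b`
and to evaluations of `f`. -/
def run (P : Cmd) (f : ℝ≥0 → ℝ≥0) {m n : ℕ} (A : Matrix (Fin m) (Fin n) ℂ)
    (b : EuclideanSpace ℂ (Fin m)) (ε η : ℝ) (i : Fin n) : PMF State :=
  P.exec ⟨f, ⟨m, n, A⟩, ⟨m, 1, Matrix.of fun j _ => b j⟩⟩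
    (initial [i, m, n] [ε, η, specNorm A, condNumber A, maxAbs f (intervalL A),
      maxAbsDeriv f (intervalL A)])

end SVT

end

noncomputable section

namespace SVT

/-- The Euclidean norm of a coordinate vector. -/
def vecNorm {n : ℕ} (v : Fin n → ℂ) : ℝ := ‖WithLp.toLp 2 v‖

theorem vecNorm_nonneg {n : ℕ} (v : Fin n → ℂ) : 0 ≤ vecNorm v := norm_nonneg _

theorem vecNorm_sq {n : ℕ} (v : Fin n → ℂ) : vecNorm v ^ 2 = ∑ i, ‖v i‖ ^ 2 := by
  simp [vecNorm, EuclideanSpace.norm_sq_eq]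

theorem vecNorm_le_of_sq_le {m n : ℕ} {v : Fin m → ℂ} {w : Fin n → ℂ} {K : ℝ} (hK : 0 ≤ K)
    (h : ∑ i, ‖v i‖ ^ 2 ≤ K ^ 2 * ∑ i, ‖w i‖ ^ 2) : vecNorm v ≤ K * vecNorm w := by
  refine le_of_sq_le_sq ?_ (mul_nonneg hK (vecNorm_nonneg w))
  rw [mul_pow, vecNorm_sq, vecNorm_sq]; exact h

theorem norm_apply_le_vecNorm {n : ℕ} (v : Fin n → ℂ) (i : Fin n) : ‖v i‖ ≤ vecNorm v :=
  PiLp.norm_apply_le (WithLp.toLp 2 v) i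

theorem vecNorm_eq_zero {n : ℕ} {v : Fin n → ℂ} : vecNorm v = 0 ↔ v = 0 := by
  simp [vecNorm]

theorem star_dotProduct_self {n : ℕ} (v : Fin n → ℂ) : star v ⬝ᵥ v = ((vecNorm v ^ 2 : ℝ) : ℂ) := by
  rw [vecNorm_sq, dotProduct]
  push_cast
  refine Finset.sum_congr rfl fun i _ => ?_
  simp [← Complex.conj_mul']

theorem norm_dotProduct_le {n : ℕ} (v w : Fin n → ℂ) : ‖v ⬝ᵥ w‖ ≤ vecNorm v * vecNorm w := by
  have h := norm_inner_le_norm (𝕜 := ℂ) (WithLp.toLp 2 (star v)) (WithLp.toLp 2 w)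
  have h1 : inner ℂ (WithLp.toLp 2 (star v)) (WithLp.toLp 2 w) = v ⬝ᵥ w := by
    simp [PiLp.inner_apply, dotProduct, mul_comm]
  have h2 : ‖WithLp.toLp 2 (star v)‖ = vecNorm v := by
    simp [vecNorm, EuclideanSpace.norm_eq]
  rwa [h1, h2] at h

/-! ### Spectral and Frobenius norm -/

section
open scoped Matrix.Norms.L2Operator

theorem specNorm_nonneg {m n : ℕ} (M : Matrix (Fin m) (Fin n) ℂ) : 0 ≤ specNorm M :=
  norm_nonneg M

theorem specNorm_eq_zero {m n : ℕ} {M : Matrix (Fin m) (Fin n) ℂ} : specNorm M = 0 ↔ M = 0 :=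
  norm_eq_zero

theorem specNorm_mul {l m n : ℕ} (M : Matrix (Fin l) (Fin m) ℂ) (N : Matrix (Fin m) (Fin n) ℂ) :
    specNorm (M * N) ≤ specNorm M * specNorm N := Matrix.l2_opNorm_mul M N

theorem specNorm_add {m n : ℕ} (M N : Matrix (Fin m) (Fin n) ℂ) :
    specNorm (M + N) ≤ specNorm M + specNorm N := norm_add_le M N

theorem specNorm_sub_comm {m n : ℕ} (M N : Matrix (Fin m) (Fin n) ℂ) :
    specNorm (M - N) = specNorm (N - M) := norm_sub_rev M N

theorem specNorm_conjTranspose {m n : ℕ} (M : Matrix (Fin m) (Fin n) ℂ) :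
    specNorm Mᴴ = specNorm M := Matrix.l2_opNorm_conjTranspose M

theorem specNorm_conjTranspose_mul_self {m n : ℕ} (M : Matrix (Fin m) (Fin n) ℂ) :
    specNorm (Mᴴ * M) = specNorm M ^ 2 := by
  rw [sq]; exact Matrix.l2_opNorm_conjTranspose_mul_self M

theorem specNorm_diagonal_le {n : ℕ} {d : Fin n → ℂ} {K : ℝ} (hK : 0 ≤ K)
    (h : ∀ i, ‖d i‖ ≤ K) : specNorm (Matrix.diagonal d) ≤ K := by
  rw [specNorm, Matrix.l2_opNorm_diagonal]
  exact (pi_norm_le_iff_of_nonneg hK).2 h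

theorem vecNorm_mulVec_le {m n : ℕ} (M : Matrix (Fin m) (Fin n) ℂ) (v : Fin n → ℂ) :
    vecNorm (M *ᵥ v) ≤ specNorm M * vecNorm v :=
  Matrix.l2_opNorm_mulVec M (WithLp.toLp 2 v)

theorem specNorm_le {m n : ℕ} {M : Matrix (Fin m) (Fin n) ℂ} {K : ℝ} (hK : 0 ≤ K)
    (h : ∀ v, vecNorm (M *ᵥ v) ≤ K * vecNorm v) : specNorm M ≤ K := by
  rw [specNorm, Matrix.l2_opNorm_def]
  exact ContinuousLinearMap.opNorm_le_bound _ hK fun v => h v.ofLp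

end

theorem specNorm_sub_le {m n : ℕ} (M N : Matrix (Fin m) (Fin n) ℂ) :
    specNorm M ≤ specNorm N + specNorm (M - N) := by
  simpa using specNorm_add N (M - N)

section
open scoped Matrix.Norms.Frobenius

theorem frobNorm_nonneg {m n : ℕ} (M : Matrix (Fin m) (Fin n) ℂ) : 0 ≤ frobNorm M :=
  norm_nonneg M

theorem frobNorm_sub_comm {m n : ℕ} (M N : Matrix (Fin m) (Fin n) ℂ) :
    frobNorm (M - N) = frobNorm (N - M) := norm_sub_rev M N

theorem frobNorm_sq {m n : ℕ} (M : Matrix (Fin m) (Fin n) ℂ) :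
    frobNorm M ^ 2 = ∑ i, ∑ j, ‖M i j‖ ^ 2 := by
  rw [frobNorm, Matrix.frobenius_norm_def, ← Real.sqrt_eq_rpow, Real.sq_sqrt]
  · simp
  · positivity

end

theorem frobNorm_sq_eq_rows {m n : ℕ} (M : Matrix (Fin m) (Fin n) ℂ) :
    frobNorm M ^ 2 = ∑ i, rowNorm M i ^ 2 := by
  rw [frobNorm_sq]
  exact Finset.sum_congr rfl fun i _ => (vecNorm_sq (M i)).symm

theorem frobNorm_conjTranspose {m n : ℕ} (M : Matrix (Fin m) (Fin n) ℂ) :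
    frobNorm Mᴴ = frobNorm M := by
  rw [← sq_eq_sq₀ (frobNorm_nonneg _) (frobNorm_nonneg _), frobNorm_sq, frobNorm_sq,
    Finset.sum_comm]
  simp

theorem frobNorm_sq_eq_cols {m n : ℕ} (M : Matrix (Fin m) (Fin n) ℂ) :
    frobNorm M ^ 2 = ∑ j, vecNorm (fun i => M i j) ^ 2 := by
  rw [frobNorm_sq, Finset.sum_comm]
  exact Finset.sum_congr rfl fun i _ => (vecNorm_sq _).symm

theorem specNorm_le_frobNorm {m n : ℕ} (M : Matrix (Fin m) (Fin n) ℂ) :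
    specNorm M ≤ frobNorm M := by
  refine specNorm_le (frobNorm_nonneg M) fun v => ?_
  refine vecNorm_le_of_sq_le (frobNorm_nonneg M) ?_
  rw [frobNorm_sq, Finset.sum_mul]
  refine Finset.sum_le_sum fun i _ => ?_
  rw [← vecNorm_sq, ← vecNorm_sq, ← mul_pow]
  exact pow_le_pow_left₀ (norm_nonneg _) (norm_dotProduct_le _ _) 2

theorem frobNorm_mul_le {l m n : ℕ} (M : Matrix (Fin l) (Fin m) ℂ) (N : Matrix (Fin m) (Fin n) ℂ) :
    frobNorm (M * N) ≤ specNorm M * frobNorm N := by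
  refine le_of_sq_le_sq ?_ (mul_nonneg (specNorm_nonneg _) (frobNorm_nonneg _))
  rw [frobNorm_sq_eq_cols, mul_pow, frobNorm_sq_eq_cols, Finset.mul_sum]
  refine Finset.sum_le_sum fun j _ => ?_
  rw [← mul_pow]
  exact pow_le_pow_left₀ (vecNorm_nonneg _) (vecNorm_mulVec_le M fun i => N i j) 2

theorem frobNorm_mul_le' {l m n : ℕ} (M : Matrix (Fin l) (Fin m) ℂ)
    (N : Matrix (Fin m) (Fin n) ℂ) : frobNorm (M * N) ≤ frobNorm M * specNorm N := by
  rw [← frobNorm_conjTranspose, Matrix.conjTranspose_mul, mul_comm,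
    ← frobNorm_conjTranspose M, ← specNorm_conjTranspose N]
  exact frobNorm_mul_le _ _

theorem frobNorm_le_mul {m n : ℕ} {M N : Matrix (Fin m) (Fin n) ℂ} {K : ℝ} (hK : 0 ≤ K)
    (h : ∀ i j, ‖M i j‖ ≤ K * ‖N i j‖) : frobNorm M ≤ K * frobNorm N := by
  refine le_of_sq_le_sq ?_ (mul_nonneg hK (frobNorm_nonneg _))
  rw [mul_pow, frobNorm_sq, frobNorm_sq, Finset.mul_sum]
  refine Finset.sum_le_sum fun i _ => ?_
  rw [Finset.mul_sum]
  refine Finset.sum_le_sum fun j _ => ?_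
  rw [← mul_pow]
  exact pow_le_pow_left₀ (norm_nonneg _) (h i j) 2

theorem specNorm_unitary_le {n : ℕ} {U : Matrix (Fin n) (Fin n) ℂ}
    (hU : U ∈ Matrix.unitaryGroup (Fin n) ℂ) : specNorm U ≤ 1 := by
  have h := specNorm_conjTranspose_mul_self U
  rw [← Matrix.star_eq_conjTranspose, Matrix.mem_unitaryGroup_iff'.1 hU] at h
  have h1 : specNorm (1 : Matrix (Fin n) (Fin n) ℂ) ≤ 1 := by
    rw [← Matrix.diagonal_one]
    exact specNorm_diagonal_le zero_le_one fun _ => by simp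
  nlinarith [specNorm_nonneg U]

theorem conjTranspose_mem_unitaryGroup {n : ℕ} {U : Matrix (Fin n) (Fin n) ℂ}
    (hU : U ∈ Matrix.unitaryGroup (Fin n) ℂ) : Uᴴ ∈ Matrix.unitaryGroup (Fin n) ℂ :=
  Unitary.star_mem hU

theorem unitary_mul_conjTranspose {n : ℕ} {U : Matrix (Fin n) (Fin n) ℂ}
    (hU : U ∈ Matrix.unitaryGroup (Fin n) ℂ) : U * Uᴴ = 1 := Matrix.mem_unitaryGroup_iff.1 hU

theorem unitary_conjTranspose_mul {n : ℕ} {U : Matrix (Fin n) (Fin n) ℂ}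
    (hU : U ∈ Matrix.unitaryGroup (Fin n) ℂ) : Uᴴ * U = 1 := Matrix.mem_unitaryGroup_iff'.1 hU

theorem specNorm_unitary_mul_le {n p : ℕ} {U : Matrix (Fin n) (Fin n) ℂ}
    (hU : U ∈ Matrix.unitaryGroup (Fin n) ℂ) (M : Matrix (Fin n) (Fin p) ℂ) :
    specNorm (U * M) ≤ specNorm M :=
  (specNorm_mul _ _).trans
    (mul_le_of_le_one_left (specNorm_nonneg _) (specNorm_unitary_le hU))

theorem specNorm_mul_unitary_le {n p : ℕ} {U : Matrix (Fin n) (Fin n) ℂ}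
    (hU : U ∈ Matrix.unitaryGroup (Fin n) ℂ) (M : Matrix (Fin p) (Fin n) ℂ) :
    specNorm (M * U) ≤ specNorm M :=
  (specNorm_mul _ _).trans
    (mul_le_of_le_one_right (specNorm_nonneg _) (specNorm_unitary_le hU))

theorem vecNorm_mulVec_sq {m n : ℕ} (M : Matrix (Fin m) (Fin n) ℂ) (v : Fin n → ℂ) :
    ((vecNorm (M *ᵥ v) ^ 2 : ℝ) : ℂ) = star v ⬝ᵥ ((Mᴴ * M) *ᵥ v) := by
  rw [← star_dotProduct_self, Matrix.star_mulVec, ← Matrix.dotProduct_mulVec, Matrix.mulVec_mulVec]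

theorem vecNorm_mulVec_sq_le {l m n : ℕ} (M : Matrix (Fin m) (Fin n) ℂ)
    (N : Matrix (Fin l) (Fin n) ℂ) {θ : ℝ} (h : specNorm (Mᴴ * M - Nᴴ * N) ≤ θ) (v : Fin n → ℂ) :
    vecNorm (M *ᵥ v) ^ 2 ≤ vecNorm (N *ᵥ v) ^ 2 + θ * vecNorm v ^ 2 := by
  have h1 : ((vecNorm (M *ᵥ v) ^ 2 - vecNorm (N *ᵥ v) ^ 2 : ℝ) : ℂ) =
      star v ⬝ᵥ ((Mᴴ * M - Nᴴ * N) *ᵥ v) := by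
    rw [Matrix.sub_mulVec, dotProduct_sub, ← vecNorm_mulVec_sq, ← vecNorm_mulVec_sq]
    push_cast; rfl
  have h2 := norm_dotProduct_le (star v) ((Mᴴ * M - Nᴴ * N) *ᵥ v)
  have h3 : vecNorm (star v) = vecNorm v := by
    rw [← sq_eq_sq₀ (vecNorm_nonneg _) (vecNorm_nonneg _), vecNorm_sq, vecNorm_sq]; simp
  rw [← h1, Complex.norm_real, h3] at h2
  have h4 := (le_abs_self _).trans h2
  have h5 := (vecNorm_mulVec_le (Mᴴ * M - Nᴴ * N) v).trans
    (mul_le_mul_of_nonneg_right h (vecNorm_nonneg v))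
  nlinarith [vecNorm_nonneg v]

theorem vecNorm_unitary_mulVec {n : ℕ} {U : Matrix (Fin n) (Fin n) ℂ}
    (hU : U ∈ Matrix.unitaryGroup (Fin n) ℂ) (v : Fin n → ℂ) : vecNorm (U *ᵥ v) = vecNorm v := by
  have h := vecNorm_mulVec_sq U v
  rw [unitary_conjTranspose_mul hU, Matrix.one_mulVec, star_dotProduct_self] at h
  rw [← sq_eq_sq₀ (vecNorm_nonneg _) (vecNorm_nonneg _)]
  exact_mod_cast h

/-! ### Two divided difference bounds -/

theorem abs_div_sub_div_le {F : ℝ → ℝ} {l Ω φ s r : ℝ} (hl : 0 < l) (hs : l ≤ s) (hr : l ≤ r)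
    (hΩ : |F r| ≤ Ω) (hφ : |F s - F r| ≤ φ * |s - r|) (hφ0 : 0 ≤ φ) :
    |F s / s - F r / r| ≤ (φ + 3 * Ω / l) / (2 * l ^ 2) * |s ^ 2 - r ^ 2| := by
  have hs0 : 0 < s := hl.trans_le hs
  have hr0 : 0 < r := hl.trans_le hr
  have hΩ0 : 0 ≤ Ω := (abs_nonneg _).trans hΩ
  have e : F s / s - F r / r = (F s - F r) / s + F r * ((r - s) / (s * r)) := by
    field_simp; ring
  have h1 : |F s / s - F r / r| ≤ φ * |s - r| / s + Ω * (|s - r| / (s * r)) := by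
    rw [e]
    refine (abs_add_le _ _).trans (add_le_add ?_ ?_)
    · rw [abs_div, abs_of_pos hs0]; gcongr
    · rw [abs_mul, abs_div, abs_of_pos (mul_pos hs0 hr0), abs_sub_comm r s]; gcongr
  have e2 : |s ^ 2 - r ^ 2| = |s - r| * (s + r) := by
    rw [show s ^ 2 - r ^ 2 = (s - r) * (s + r) by ring, abs_mul, abs_of_pos (add_pos hs0 hr0)]
  rw [e2]
  refine h1.trans ?_
  have h2 : 1 / s ≤ (s + r) / (2 * l ^ 2) := by
    rw [div_le_div_iff₀ hs0 (by positivity)]; nlinarith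
  have h3 : 1 / (s * r) ≤ 3 * (s + r) / (2 * l ^ 3) := by
    rw [div_le_div_iff₀ (by positivity) (by positivity)]
    have : l * l ≤ s * r := mul_le_mul hs hr hl.le hs0.le
    have : l * l * l ≤ s * r * (s + r) := by
      apply mul_le_mul this (by linarith) hl.le (by positivity)
    nlinarith [pow_pos hl 3]
  have e3 : (φ + 3 * Ω / l) / (2 * l ^ 2) * (|s - r| * (s + r)) =
      φ * |s - r| * ((s + r) / (2 * l ^ 2)) + Ω * |s - r| * (3 * (s + r) / (2 * l ^ 3)) := by
    field_simp
  rw [e3]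
  have := mul_le_mul_of_nonneg_left h2 (mul_nonneg hφ0 (abs_nonneg (s - r)))
  have := mul_le_mul_of_nonneg_left h3 (mul_nonneg hΩ0 (abs_nonneg (s - r)))
  calc _ = φ * |s - r| * (1 / s) + Ω * |s - r| * (1 / (s * r)) := by ring
    _ ≤ _ := by linarith

theorem abs_div_le_of_le {F : ℝ → ℝ} {l Ω φ s : ℝ} (hl : 0 < l) (hs : l ≤ s)
    (hΩ : |F s| ≤ Ω) (hφ0 : 0 ≤ φ) :
    |F s / s| ≤ (φ + 3 * Ω / l) / (2 * l ^ 2) * |s ^ 2| := by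
  have hs0 : 0 < s := hl.trans_le hs
  have hΩ0 : 0 ≤ Ω := (abs_nonneg _).trans hΩ
  rw [abs_div, abs_of_pos hs0, abs_of_pos (pow_pos hs0 2)]
  have h1 : |F s| / s ≤ Ω / s := by gcongr
  refine h1.trans ?_
  have h2 : 3 * Ω / (2 * l ^ 3) * s ^ 2 ≤ (φ + 3 * Ω / l) / (2 * l ^ 2) * s ^ 2 := by
    have : (φ + 3 * Ω / l) / (2 * l ^ 2) = φ / (2 * l ^ 2) + 3 * Ω / (2 * l ^ 3) := by field_simp
    rw [this]
    have : 0 ≤ φ / (2 * l ^ 2) := by positivity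
    nlinarith [sq_nonneg s]
  refine le_trans ?_ h2
  rw [div_mul_eq_mul_div, div_le_div_iff₀ hs0 (by positivity)]
  have : l ^ 3 ≤ s ^ 3 := pow_le_pow_left₀ hl.le hs 3
  nlinarith [mul_le_mul_of_nonneg_left this hΩ0, mul_nonneg hΩ0 (pow_pos hs0 3).le]

theorem abs_mul_div_cube_sub_le_of_le {F : ℝ → ℝ} {l Ω φ s r : ℝ} (hl : 0 < l) (hr : l ≤ r)
    (hrs : r ≤ s) (hΩ : |F r| ≤ Ω) (hφ : |F s - F r| ≤ φ * |s - r|) (hφ0 : 0 ≤ φ) :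
    |s * r * (F s / s ^ 3 - F r / r ^ 3)| ≤ (φ + 3 * Ω / l) / l ^ 2 * |s ^ 2 - r ^ 2| := by
  have hr0 : 0 < r := hl.trans_le hr
  have hs0 : 0 < s := hr0.trans_le hrs
  have hΩ0 : 0 ≤ Ω := (abs_nonneg _).trans hΩ
  have e : s * r * (F s / s ^ 3 - F r / r ^ 3) =
      (F s - F r) * (r / s ^ 2) + F r * ((r - s) * ((r ^ 2 + r * s + s ^ 2) / (s ^ 2 * r ^ 2))) := by
    field_simp; ring
  have h1 : |s * r * (F s / s ^ 3 - F r / r ^ 3)| ≤ φ * |s - r| * (r / s ^ 2) +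
      Ω * (|s - r| * ((r ^ 2 + r * s + s ^ 2) / (s ^ 2 * r ^ 2))) := by
    rw [e]
    refine (abs_add_le _ _).trans (add_le_add ?_ ?_)
    · rw [abs_mul, abs_of_pos (div_pos hr0 (pow_pos hs0 2))]; gcongr
    · rw [abs_mul, abs_mul, abs_sub_comm r s, abs_of_pos (a := (r ^ 2 + r * s + s ^ 2) / _)
        (by positivity)]
      gcongr
  have e2 : |s ^ 2 - r ^ 2| = |s - r| * (s + r) := by
    rw [show s ^ 2 - r ^ 2 = (s - r) * (s + r) by ring, abs_mul, abs_of_pos (add_pos hs0 hr0)]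
  rw [e2]
  refine h1.trans ?_
  have h2 : r / s ^ 2 ≤ (s + r) / l ^ 2 := by
    rw [div_le_div_iff₀ (by positivity) (by positivity)]
    have : l ^ 2 ≤ s ^ 2 := pow_le_pow_left₀ hl.le (hr.trans hrs) 2
    nlinarith [mul_le_mul_of_nonneg_left this hr0.le, pow_pos hs0 3]
  have h3 : (r ^ 2 + r * s + s ^ 2) / (s ^ 2 * r ^ 2) ≤ 3 * (s + r) / l ^ 3 := by
    have h4 : (r ^ 2 + r * s + s ^ 2) / (s ^ 2 * r ^ 2) ≤
        (s + r) * (1 / (s * r * r) + 1 / (s * s * r)) := by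
      rw [show (s + r) * (1 / (s * r * r) + 1 / (s * s * r)) = (s + r) ^ 2 / (s ^ 2 * r ^ 2) by
        field_simp]
      gcongr
      nlinarith [mul_pos hs0 hr0]
    have hls : l ≤ s := hr.trans hrs
    have h5 : 1 / (s * r * r) ≤ 1 / l ^ 3 := by
      rw [show l ^ 3 = l * l * l by ring]; gcongr
    have h6 : 1 / (s * s * r) ≤ 1 / l ^ 3 := by
      rw [show l ^ 3 = l * l * l by ring]; gcongr
    refine h4.trans ?_
    have : 3 * (s + r) / l ^ 3 = (s + r) * (3 * (1 / l ^ 3)) := by ring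
    rw [this]
    have : 0 < 1 / l ^ 3 := by positivity
    apply mul_le_mul_of_nonneg_left _ (by positivity)
    linarith
  have e3 : (φ + 3 * Ω / l) / l ^ 2 * (|s - r| * (s + r)) =
      φ * |s - r| * ((s + r) / l ^ 2) + Ω * |s - r| * (3 * (s + r) / l ^ 3) := by
    field_simp
  rw [e3, ← mul_assoc Ω]
  gcongr

/-- The class of functions to which the perturbation bounds apply. -/
structure Tame (F : ℝ → ℝ) (l u Ω φ : ℝ) : Prop where
  pos : 0 < l
  zero : F 0 = 0
  Ω_nonneg : 0 ≤ Ω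
  φ_nonneg : 0 ≤ φ
  bound : ∀ s, l ≤ s → s ≤ u → |F s| ≤ Ω
  lipschitz : ∀ s r, l ≤ s → s ≤ u → l ≤ r → r ≤ u → |F s - F r| ≤ φ * |s - r|

theorem Tame.kernel_one {F : ℝ → ℝ} {l u Ω φ : ℝ} (h : Tame F l u Ω φ) {s r : ℝ}
    (hs : s = 0 ∨ l ≤ s ∧ s ≤ u) (hr : r = 0 ∨ l ≤ r ∧ r ≤ u) :
    |F s / s - F r / r| ≤ (φ + 3 * Ω / l) / (2 * l ^ 2) * |s ^ 2 - r ^ 2| := by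
  rcases hs with rfl | hs <;> rcases hr with rfl | hr
  · simp
  · have := abs_div_le_of_le h.pos hr.1 (h.bound r hr.1 hr.2) h.φ_nonneg
    simpa using this
  · have := abs_div_le_of_le h.pos hs.1 (h.bound s hs.1 hs.2) h.φ_nonneg
    simpa using this
  · exact abs_div_sub_div_le h.pos hs.1 hr.1 (h.bound r hr.1 hr.2)
      (h.lipschitz s r hs.1 hs.2 hr.1 hr.2) h.φ_nonneg

theorem Tame.kernel_two {F : ℝ → ℝ} {l u Ω φ : ℝ} (h : Tame F l u Ω φ) {s r : ℝ}
    (hs : s = 0 ∨ l ≤ s ∧ s ≤ u) (hr : r = 0 ∨ l ≤ r ∧ r ≤ u) :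
    |s * r * (F s / s ^ 3 - F r / r ^ 3)| ≤ (φ + 3 * Ω / l) / l ^ 2 * |s ^ 2 - r ^ 2| := by
  have h0 : ∀ x : ℝ, 0 ≤ (φ + 3 * Ω / l) / l ^ 2 * |x| := fun x => by
    have := h.pos; have := h.Ω_nonneg; have := h.φ_nonneg; positivity
  rcases hs with rfl | hs
  · simp only [zero_mul, abs_zero]; exact h0 _
  rcases hr with rfl | hr
  · simp only [mul_zero, zero_mul, abs_zero]; exact h0 _
  rcases le_total r s with hrs | hrs
  · exact abs_mul_div_cube_sub_le_of_le h.pos hr.1 hrs (h.bound r hr.1 hr.2)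
      (h.lipschitz s r hs.1 hs.2 hr.1 hr.2) h.φ_nonneg
  · have := abs_mul_div_cube_sub_le_of_le h.pos hs.1 hrs (h.bound s hs.1 hs.2)
      (h.lipschitz r s hr.1 hr.2 hs.1 hs.2) h.φ_nonneg
    rw [abs_sub_comm (s ^ 2), show s * r * (F s / s ^ 3 - F r / r ^ 3) =
      -(r * s * (F r / r ^ 3 - F s / s ^ 3)) by ring, abs_neg]
    exact this

/-! ### Functions of Hermitian matrices in an eigenbasis -/

/-- `U diag(d) U*`. -/
def conjDiag {n : ℕ} (U : Matrix (Fin n) (Fin n) ℂ) (d : Fin n → ℝ) : Matrix (Fin n) (Fin n) ℂ :=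
  U * Matrix.diagonal (fun i => (d i : ℂ)) * Uᴴ

theorem conjDiag_mul {n : ℕ} {U : Matrix (Fin n) (Fin n) ℂ}
    (hU : U ∈ Matrix.unitaryGroup (Fin n) ℂ) (d e : Fin n → ℝ) :
    conjDiag U d * conjDiag U e = conjDiag U (fun i => d i * e i) := by
  unfold conjDiag
  rw [show U * Matrix.diagonal (fun i => (d i : ℂ)) * Uᴴ *
      (U * Matrix.diagonal (fun i => (e i : ℂ)) * Uᴴ) =
      U * (Matrix.diagonal (fun i => (d i : ℂ)) * (Uᴴ * U) *
        Matrix.diagonal (fun i => (e i : ℂ))) * Uᴴ by simp only [Matrix.mul_assoc],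
    unitary_conjTranspose_mul hU, Matrix.mul_one, Matrix.diagonal_mul_diagonal]
  simp

theorem conjDiag_conjTranspose {n : ℕ} (U : Matrix (Fin n) (Fin n) ℂ) (d : Fin n → ℝ) :
    (conjDiag U d)ᴴ = conjDiag U d := by
  unfold conjDiag
  rw [Matrix.conjTranspose_mul, Matrix.conjTranspose_mul, Matrix.conjTranspose_conjTranspose,
    Matrix.diagonal_conjTranspose, Matrix.mul_assoc]
  congr 3
  ext i
  simp

theorem specNorm_conjDiag_le {n : ℕ} {U : Matrix (Fin n) (Fin n) ℂ}
    (hU : U ∈ Matrix.unitaryGroup (Fin n) ℂ) {d : Fin n → ℝ} {K : ℝ} (hK : 0 ≤ K)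
    (h : ∀ i, |d i| ≤ K) : specNorm (conjDiag U d) ≤ K := by
  refine (specNorm_mul_unitary_le (conjTranspose_mem_unitaryGroup hU) _).trans
    ((specNorm_unitary_mul_le hU _).trans (specNorm_diagonal_le hK fun i => ?_))
  rw [Complex.norm_real]; exact h i

theorem dotProduct_conjDiag_mulVec {n : ℕ} (U : Matrix (Fin n) (Fin n) ℂ) (d : Fin n → ℝ)
    (w : Fin n → ℂ) :
    star w ⬝ᵥ (conjDiag U d *ᵥ w) = ((∑ i, d i * ‖(Uᴴ *ᵥ w) i‖ ^ 2 : ℝ) : ℂ) := by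
  unfold conjDiag
  rw [← Matrix.mulVec_mulVec, ← Matrix.mulVec_mulVec, Matrix.dotProduct_mulVec,
    ← Matrix.conjTranspose_conjTranspose U, ← Matrix.star_mulVec,
    Matrix.conjTranspose_conjTranspose, dotProduct]
  push_cast
  refine Finset.sum_congr rfl fun i _ => ?_
  rw [Matrix.mulVec_diagonal, Pi.star_apply, ← Complex.conj_mul']
  simp only [RCLike.star_def]
  ring

/-- `|g(X) - g(Y)|` type bounds: comparison entry by entry in a mixed eigenbasis. -/
theorem frobNorm_mixed_le {n : ℕ} {U W : Matrix (Fin n) (Fin n) ℂ}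
    (hU : U ∈ Matrix.unitaryGroup (Fin n) ℂ) (hW : W ∈ Matrix.unitaryGroup (Fin n) ℂ)
    (d e : Fin n → ℝ) (k : Fin n → Fin n → ℝ) {K : ℝ} (hK : 0 ≤ K)
    (h : ∀ i j, |k i j| ≤ K * |d i - e j|) :
    frobNorm (Matrix.of fun i j => (k i j : ℂ) * (Uᴴ * W) i j) ≤
      K * frobNorm (conjDiag U d - conjDiag W e) := by
  have h1 : Uᴴ * (conjDiag U d - conjDiag W e) * W =
      Matrix.of fun i j => ((d i - e j : ℝ) : ℂ) * (Uᴴ * W) i j := by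
    have : Uᴴ * (conjDiag U d - conjDiag W e) * W =
        Matrix.diagonal (fun i => (d i : ℂ)) * (Uᴴ * W) -
          (Uᴴ * W) * Matrix.diagonal (fun i => (e i : ℂ)) := by
      unfold conjDiag
      rw [Matrix.mul_sub, Matrix.sub_mul]
      congr 1
      · rw [show Uᴴ * (U * Matrix.diagonal (fun i => (d i : ℂ)) * Uᴴ) * W =
          (Uᴴ * U) * (Matrix.diagonal (fun i => (d i : ℂ)) * (Uᴴ * W)) by
            simp only [Matrix.mul_assoc], unitary_conjTranspose_mul hU, Matrix.one_mul]
      · rw [show Uᴴ * (W * Matrix.diagonal (fun i => (e i : ℂ)) * Wᴴ) * W =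
          Uᴴ * W * Matrix.diagonal (fun i => (e i : ℂ)) * (Wᴴ * W) by
            simp only [Matrix.mul_assoc], unitary_conjTranspose_mul hW, Matrix.mul_one]
    rw [this]
    ext i j
    simp only [Matrix.sub_apply, Matrix.diagonal_mul, Matrix.mul_diagonal, Matrix.of_apply]
    push_cast; ring
  have h2 : frobNorm (Uᴴ * (conjDiag U d - conjDiag W e) * W) ≤
      frobNorm (conjDiag U d - conjDiag W e) := by
    refine (frobNorm_mul_le' _ _).trans ?_
    refine (mul_le_of_le_one_right (frobNorm_nonneg _) (specNorm_unitary_le hW)).trans ?_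
    refine (frobNorm_mul_le _ _).trans ?_
    exact mul_le_of_le_one_left (frobNorm_nonneg _)
      (specNorm_unitary_le (conjTranspose_mem_unitaryGroup hU))
  refine le_trans ?_ (mul_le_mul_of_nonneg_left h2 hK)
  rw [h1]
  refine frobNorm_le_mul hK fun i j => ?_
  simp only [Matrix.of_apply, norm_mul, Complex.norm_real, Real.norm_eq_abs]
  rw [← mul_assoc]
  exact mul_le_mul_of_nonneg_right (h i j) (norm_nonneg _)

theorem mul_conjDiag_sub_mul {n : ℕ} {U W : Matrix (Fin n) (Fin n) ℂ}
    (hU : U ∈ Matrix.unitaryGroup (Fin n) ℂ) (hW : W ∈ Matrix.unitaryGroup (Fin n) ℂ)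
    (a b g h : Fin n → ℝ) :
    conjDiag U a * (conjDiag U g - conjDiag W h) * conjDiag W b =
      U * (Matrix.of fun i j => ((a i * b j * (g i - h j) : ℝ) : ℂ) * (Uᴴ * W) i j) * Wᴴ := by
  have : conjDiag U a * (conjDiag U g - conjDiag W h) * conjDiag W b =
      U * (Matrix.diagonal (fun i => ((a i * g i : ℝ) : ℂ)) * (Uᴴ * W) *
        Matrix.diagonal (fun i => (b i : ℂ)) - Matrix.diagonal (fun i => (a i : ℂ)) * (Uᴴ * W) *
          Matrix.diagonal (fun i => ((h i * b i : ℝ) : ℂ))) * Wᴴ := by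
    rw [Matrix.mul_sub, Matrix.sub_mul, conjDiag_mul hU, Matrix.mul_assoc (conjDiag U a),
      conjDiag_mul hW, Matrix.mul_sub, Matrix.sub_mul]
    unfold conjDiag
    simp only [Matrix.mul_assoc]
  rw [this]
  congr 2
  ext i j
  simp only [Matrix.sub_apply, Matrix.diagonal_mul, Matrix.mul_diagonal, Matrix.of_apply]
  push_cast; ring

/-! ### Singular values -/

theorem singularValue_nonneg {m n : ℕ} (M : Matrix (Fin m) (Fin n) ℂ) (i : ℕ) :
    0 ≤ singularValue M i := LinearMap.singularValues_nonneg _ i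

theorem singularValue_antitone {m n : ℕ} (M : Matrix (Fin m) (Fin n) ℂ) :
    Antitone (singularValue M) := LinearMap.singularValues_antitone _

theorem singularValue_eq_zero_of_right_le {m n : ℕ} (M : Matrix (Fin m) (Fin n) ℂ) {i : ℕ}
    (h : n ≤ i) : singularValue M i = 0 :=
  LinearMap.singularValues_of_finrank_le _ (by simpa using h)

theorem singularValue_eq_zero_iff {m n : ℕ} (M : Matrix (Fin m) (Fin n) ℂ) {i : ℕ} :
    singularValue M i = 0 ↔ M.rank ≤ i := by
  rw [Matrix.rank_eq_finrank_range_toLin M (EuclideanSpace.basisFun (Fin m) ℂ).toBasis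
    (EuclideanSpace.basisFun (Fin n) ℂ).toBasis]
  have := (Matrix.toEuclideanLin M).singularValues_eq_zero_iff_le_finrank_range (n := i)
  rw [Matrix.toEuclideanLin_eq_toLin_orthonormal] at this
  rw [← this, singularValue, Matrix.toEuclideanLin_eq_toLin_orthonormal]

theorem singularValue_eq_zero_of_left_le {m n : ℕ} (M : Matrix (Fin m) (Fin n) ℂ) {i : ℕ}
    (h : m ≤ i) : singularValue M i = 0 :=
  (singularValue_eq_zero_iff M).2 ((M.rank_le_height).trans h)

theorem rectDiag_conjTranspose (m n : ℕ) (s : ℕ → ℝ) : (rectDiag m n s)ᴴ = rectDiag n m s := by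
  ext i j
  simp only [rectDiag, Matrix.conjTranspose_apply, Matrix.of_apply]
  by_cases h : (i : ℕ) = j
  · simp [h]
  · simp [h, Ne.symm h]

theorem rectDiag_mul_diagonal_mul_rectDiag {m n : ℕ} {s : ℕ → ℝ} (hs : ∀ i, n ≤ i → s i = 0)
    (g : ℕ → ℝ) :
    rectDiag m n s * Matrix.diagonal (fun k : Fin n => (g k : ℂ)) * rectDiag n m s =
      Matrix.diagonal fun i : Fin m => ((s i ^ 2 * g i : ℝ) : ℂ) := by
  ext i j
  rw [Matrix.mul_apply, Matrix.diagonal_apply]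
  simp only [Matrix.mul_diagonal, rectDiag, Matrix.of_apply]
  by_cases hi : (i : ℕ) < n
  · rw [Finset.sum_eq_single ⟨i, hi⟩]
    · simp only [if_true, Fin.ext_iff]
      split_ifs
      · push_cast; ring
      · simp
    · intro k _ hk
      have : (i : ℕ) ≠ k := fun h => hk (Fin.ext h.symm)
      simp [this]
    · simp
  · rw [Finset.sum_eq_zero, hs i (not_lt.1 hi)]
    · simp
    · intro k _
      have : (i : ℕ) ≠ k := fun h => hi (h ▸ k.2)
      simp [this]

theorem IsSVD.mul_conjDiag_mul {m n : ℕ} {M : Matrix (Fin m) (Fin n) ℂ}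
    {U : Matrix (Fin m) (Fin m) ℂ} {V : Matrix (Fin n) (Fin n) ℂ} (h : IsSVD M U V) (g : ℕ → ℝ) :
    M * conjDiag V (fun i => g i) * Mᴴ = conjDiag U fun i => singularValue M i ^ 2 * g i := by
  obtain ⟨_, hV, hM⟩ := h
  have h1 := rectDiag_mul_diagonal_mul_rectDiag (m := m)
    (fun i => singularValue_eq_zero_of_right_le M (i := i)) g
  unfold conjDiag
  rw [← h1]
  generalize singularValue M = s at *
  rw [hM, Matrix.conjTranspose_mul, Matrix.conjTranspose_mul, Matrix.conjTranspose_conjTranspose,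
    rectDiag_conjTranspose]
  rw [show U * rectDiag m n s * Vᴴ * (V * Matrix.diagonal (fun i : Fin n => (g i : ℂ)) * Vᴴ) *
      (V * (rectDiag n m s * Uᴴ)) = U * (rectDiag m n s * (Vᴴ * V) *
        Matrix.diagonal (fun i : Fin n => (g i : ℂ)) * (Vᴴ * V) * rectDiag n m s) * Uᴴ by
      simp only [Matrix.mul_assoc], unitary_conjTranspose_mul hV, Matrix.mul_one, Matrix.mul_one]

theorem conjDiag_one {n : ℕ} {U : Matrix (Fin n) (Fin n) ℂ}
    (hU : U ∈ Matrix.unitaryGroup (Fin n) ℂ) : conjDiag U (fun _ => 1) = 1 := by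
  simp [conjDiag, unitary_mul_conjTranspose hU]

theorem IsSVD.mul_conjTranspose {m n : ℕ} {M : Matrix (Fin m) (Fin n) ℂ}
    {U : Matrix (Fin m) (Fin m) ℂ} {V : Matrix (Fin n) (Fin n) ℂ} (h : IsSVD M U V) :
    M * Mᴴ = conjDiag U fun i => singularValue M i ^ 2 := by
  have := h.mul_conjDiag_mul fun _ => 1
  simpa [conjDiag_one h.2.1] using this

theorem IsSVD.conjTranspose_mul {m n : ℕ} {M : Matrix (Fin m) (Fin n) ℂ}
    {U : Matrix (Fin m) (Fin m) ℂ} {V : Matrix (Fin n) (Fin n) ℂ} (h : IsSVD M U V) :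
    Mᴴ * M = conjDiag V fun i => singularValue M i ^ 2 := by
  obtain ⟨hU, _, hM⟩ := h
  have h1 := rectDiag_mul_diagonal_mul_rectDiag (m := n)
    (fun i => singularValue_eq_zero_of_left_le M (i := i)) fun _ => 1
  simp only [Complex.ofReal_one, Matrix.diagonal_one, Matrix.mul_one, mul_one] at h1
  unfold conjDiag
  rw [← h1]
  generalize singularValue M = s at *
  rw [hM, Matrix.conjTranspose_mul, Matrix.conjTranspose_mul, Matrix.conjTranspose_conjTranspose,
    rectDiag_conjTranspose]
  rw [show V * (rectDiag n m s * Uᴴ) * (U * rectDiag m n s * Vᴴ) =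
      V * (rectDiag n m s * (Uᴴ * U) * rectDiag m n s) * Vᴴ by
      simp only [Matrix.mul_assoc], unitary_conjTranspose_mul hU, Matrix.mul_one]

theorem svd_isSVD {m n : ℕ} (M : Matrix (Fin m) (Fin n) ℂ) : IsSVD M (svd M).1 (svd M).2 :=
  Classical.choose_spec (exists_isSVD M)

/-- The function `t ↦ F(√t)/√t` of `M M*`. -/
def leftFactor (F : ℝ → ℝ) {m n : ℕ} (M : Matrix (Fin m) (Fin n) ℂ) :
    Matrix (Fin m) (Fin m) ℂ :=
  conjDiag (svd M).1 fun i => F (singularValue M i) / singularValue M i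

theorem svTransform_eq {f : ℝ≥0 → ℝ≥0} (hf : f 0 = 0) {m n : ℕ}
    (M : Matrix (Fin m) (Fin n) ℂ) : svTransform f M = leftFactor (realExt f) M * M := by
  obtain ⟨hU, hV, hM⟩ := svd_isSVD M
  unfold leftFactor conjDiag svTransform
  generalize (svd M).1 = U at *
  generalize (svd M).2 = V at *
  generalize singularValue M = s at *
  simp only
  rw [hM, show U * Matrix.diagonal (fun i : Fin m => ((realExt f (s i) / s i : ℝ) : ℂ)) * Uᴴ *
      (U * rectDiag m n s * Vᴴ) =
      U * (Matrix.diagonal (fun i : Fin m => ((realExt f (s i) / s i : ℝ) : ℂ)) * (Uᴴ * U) *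
          rectDiag m n s) * Vᴴ by simp only [Matrix.mul_assoc],
      unitary_conjTranspose_mul hU, Matrix.mul_one]
  congr 2
  ext i j
  simp only [rectDiag, Matrix.diagonal_mul, Matrix.of_apply]
  split_ifs with h
  · by_cases h0 : s i = 0
    · simp [h0, hf]
    · have : (s i : ℂ) ≠ 0 := by exact_mod_cast h0
      simp only [realExt, Complex.ofReal_div]
      field_simp
  · simp

theorem conjDiag_mulVec_col {n : ℕ} {V : Matrix (Fin n) (Fin n) ℂ}
    (hV : V ∈ Matrix.unitaryGroup (Fin n) ℂ) (d : Fin n → ℝ) (i : Fin n) :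
    conjDiag V d *ᵥ (V *ᵥ Pi.single i 1) = (d i : ℂ) • (V *ᵥ Pi.single i 1) := by
  unfold conjDiag
  rw [Matrix.mulVec_mulVec, Matrix.mul_assoc, unitary_conjTranspose_mul hV, Matrix.mul_one,
    ← Matrix.mulVec_mulVec, Matrix.diagonal_mulVec_single, ← Matrix.mulVec_smul]
  congr 1
  ext j
  by_cases h : j = i
  · subst h; simp
  · simp [h]

theorem vecNorm_single {n : ℕ} (i : Fin n) : vecNorm (Pi.single i (1 : ℂ)) = 1 := by
  rw [← sq_eq_sq₀ (vecNorm_nonneg _) zero_le_one, vecNorm_sq, Finset.sum_eq_single i]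
  · simp
  · intro j _ h; simp [h]
  · simp

theorem vecNorm_smul {n : ℕ} (a : ℂ) (v : Fin n → ℂ) : vecNorm (a • v) = ‖a‖ * vecNorm v := by
  rw [vecNorm, WithLp.toLp_smul, norm_smul]; rfl

theorem exists_singular_vector {m n : ℕ} (M : Matrix (Fin m) (Fin n) ℂ) {i : ℕ} (hi : i < n) :
    ∃ w, vecNorm w = 1 ∧ vecNorm (M *ᵥ w) = singularValue M i ∧
      vecNorm ((Mᴴ * M) *ᵥ w) = singularValue M i ^ 2 := by
  obtain ⟨hU, hV, hM⟩ := svd_isSVD M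
  have h1 := (svd_isSVD M).conjTranspose_mul
  have h2 : (Mᴴ * M) *ᵥ ((svd M).2 *ᵥ Pi.single ⟨i, hi⟩ 1) =
      ((singularValue M i ^ 2 : ℝ) : ℂ) • ((svd M).2 *ᵥ Pi.single ⟨i, hi⟩ 1) := by
    rw [h1]
    exact conjDiag_mulVec_col hV _ ⟨i, hi⟩
  have h3 : vecNorm ((svd M).2 *ᵥ Pi.single ⟨i, hi⟩ 1) = 1 := by
    rw [vecNorm_unitary_mulVec hV, vecNorm_single]
  refine ⟨_, h3, ?_, ?_⟩
  · have h4 := vecNorm_mulVec_sq M ((svd M).2 *ᵥ Pi.single ⟨i, hi⟩ 1)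
    rw [h2, dotProduct_smul, star_dotProduct_self, h3] at h4
    rw [← sq_eq_sq₀ (vecNorm_nonneg _) (singularValue_nonneg _ _)]
    have h5 : ((vecNorm (M *ᵥ ((svd M).2 *ᵥ Pi.single ⟨i, hi⟩ 1)) ^ 2 : ℝ) : ℂ) =
      ((singularValue M i ^ 2 : ℝ) : ℂ) := by rw [h4]; simp
    exact_mod_cast h5
  · rw [h2, vecNorm_smul, h3, mul_one, Complex.norm_real, Real.norm_eq_abs, abs_of_nonneg]
    positivity

theorem singularValue_le_specNorm {m n : ℕ} (M : Matrix (Fin m) (Fin n) ℂ) (i : ℕ) :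
    singularValue M i ≤ specNorm M := by
  rcases lt_or_ge i n with hi | hi
  · obtain ⟨w, hw, h1, _⟩ := exists_singular_vector M hi
    have := vecNorm_mulVec_le M w
    rwa [h1, hw, mul_one] at this
  · rw [singularValue_eq_zero_of_right_le M hi]; exact specNorm_nonneg M

theorem specNorm_eq_of_gram_eq {l m n : ℕ} {M : Matrix (Fin m) (Fin n) ℂ}
    {N : Matrix (Fin l) (Fin n) ℂ} (h : Mᴴ * M = Nᴴ * N) : specNorm M = specNorm N := by
  rw [← sq_eq_sq₀ (specNorm_nonneg _) (specNorm_nonneg _), ← specNorm_conjTranspose_mul_self,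
    ← specNorm_conjTranspose_mul_self, h]

theorem specNorm_eq_singularValue_zero {m n : ℕ} (M : Matrix (Fin m) (Fin n) ℂ) :
    specNorm M = singularValue M 0 := by
  refine le_antisymm ?_ (singularValue_le_specNorm M 0)
  obtain ⟨hU, hV, hM⟩ := svd_isSVD M
  have h1 := (svd_isSVD M).conjTranspose_mul
  have h2 := specNorm_conjTranspose_mul_self M
  rw [h1] at h2
  have h3 := specNorm_conjDiag_le hV (d := fun i => singularValue M i ^ 2)
    (K := singularValue M 0 ^ 2) (sq_nonneg _) fun i => by
      rw [abs_of_nonneg (sq_nonneg _)]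
      exact pow_le_pow_left₀ (singularValue_nonneg _ _) (singularValue_antitone M (Nat.zero_le _)) 2
  rw [h2] at h3
  exact le_of_sq_le_sq h3 (singularValue_nonneg _ _)

/-! ### Spectral gaps -/

theorem gap_of_gram_eq {m n : ℕ} {N : Matrix (Fin m) (Fin n) ℂ} {V : Matrix (Fin n) (Fin n) ℂ}
    (hV : V ∈ Matrix.unitaryGroup (Fin n) ℂ) {d : Fin n → ℝ} (h : Nᴴ * N = conjDiag V d)
    {τ : ℝ} (hd : ∀ i, d i = 0 ∨ 0 ≤ d i ∧ τ ≤ d i) (w : Fin n → ℂ) :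
    τ * vecNorm (N *ᵥ w) ^ 2 ≤ vecNorm (Nᴴ *ᵥ (N *ᵥ w)) ^ 2 := by
  have h1 := vecNorm_mulVec_sq N w
  have h2 := vecNorm_mulVec_sq (Nᴴ * N) w
  rw [h, conjDiag_conjTranspose, conjDiag_mul hV, ← h] at h2
  rw [h, dotProduct_conjDiag_mulVec] at h1
  rw [dotProduct_conjDiag_mulVec] at h2
  rw [Matrix.mulVec_mulVec, Complex.ofReal_injective h1, Complex.ofReal_injective h2,
    Finset.mul_sum]
  refine Finset.sum_le_sum fun i _ => ?_
  rw [← mul_assoc]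
  refine mul_le_mul_of_nonneg_right ?_ (sq_nonneg _)
  rcases hd i with hi | ⟨hi, hi'⟩
  · simp [hi]
  · exact mul_le_mul_of_nonneg_right hi' hi

theorem singularValue_gap {m n : ℕ} {N : Matrix (Fin m) (Fin n) ℂ} {τ : ℝ}
    (h : ∀ w, τ * vecNorm (N *ᵥ w) ^ 2 ≤ vecNorm (Nᴴ *ᵥ (N *ᵥ w)) ^ 2) (i : ℕ) :
    singularValue N i = 0 ∨ τ ≤ singularValue N i ^ 2 := by
  rcases lt_or_ge i n with hi | hi
  · obtain ⟨w, _, h1, h2⟩ := exists_singular_vector N hi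
    have h3 := h w
    rw [Matrix.mulVec_mulVec, h1, h2] at h3
    by_cases h0 : singularValue N i = 0
    · exact Or.inl h0
    · right
      have : 0 < singularValue N i ^ 2 := by positivity
      nlinarith
  · exact Or.inl (singularValue_eq_zero_of_right_le N hi)

theorem singularValue_conjTranspose_gap {m n : ℕ} {M : Matrix (Fin m) (Fin n) ℂ} {τ : ℝ}
    (h : ∀ i, singularValue M i = 0 ∨ τ ≤ singularValue M i ^ 2) (i : ℕ) :
    singularValue Mᴴ i = 0 ∨ τ ≤ singularValue Mᴴ i ^ 2 := by
  refine singularValue_gap (fun w => ?_) i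
  refine gap_of_gram_eq (N := Mᴴ) (V := (svd M).1)
    (d := fun i : Fin m => singularValue M i ^ 2) (svd_isSVD M).1 ?_ (fun j => ?_) w
  · rw [Matrix.conjTranspose_conjTranspose, (svd_isSVD M).mul_conjTranspose]
  · rcases h j with h | h
    · left; simp [h]
    · exact Or.inr ⟨sq_nonneg _, h⟩

/-! ### Perturbation of the singular value transformation -/

theorem specNorm_sub_of_conjDiag {n : ℕ} {U W : Matrix (Fin n) (Fin n) ℂ}
    (hU : U ∈ Matrix.unitaryGroup (Fin n) ℂ) (hW : W ∈ Matrix.unitaryGroup (Fin n) ℂ)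
    (a b g h d e : Fin n → ℝ) {K : ℝ} (hK : 0 ≤ K)
    (hk : ∀ i j, |a i * b j * (g i - h j)| ≤ K * |d i - e j|) :
    specNorm (conjDiag U a * (conjDiag U g - conjDiag W h) * conjDiag W b) ≤
      K * frobNorm (conjDiag U d - conjDiag W e) := by
  rw [mul_conjDiag_sub_mul hU hW]
  refine (specNorm_mul_unitary_le (conjTranspose_mem_unitaryGroup hW) _).trans
    ((specNorm_unitary_mul_le hU _).trans ((specNorm_le_frobNorm _).trans ?_))
  exact frobNorm_mixed_le hU hW d e _ hK hk

/-- If the range of `B*` is that of a compression of `A*`, a gap of `A` passes to `B`. -/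
theorem gap_of_specNorm_sub_le {l m n : ℕ} {A : Matrix (Fin m) (Fin n) ℂ}
    {B : Matrix (Fin l) (Fin n) ℂ} {S : Matrix (Fin l) (Fin m) ℂ} (hB : B = S * A) {τ θ : ℝ}
    (hA : ∀ w, τ * vecNorm (Aᴴ *ᵥ w) ^ 2 ≤ vecNorm (A *ᵥ (Aᴴ *ᵥ w)) ^ 2)
    (h : specNorm (Aᴴ * A - Bᴴ * B) ≤ θ) (w : Fin l → ℂ) :
    (τ - θ) * vecNorm (Bᴴ *ᵥ w) ^ 2 ≤ vecNorm (B *ᵥ (Bᴴ *ᵥ w)) ^ 2 := by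
  have h1 : Bᴴ *ᵥ w = Aᴴ *ᵥ (Sᴴ *ᵥ w) := by
    rw [hB, Matrix.conjTranspose_mul, Matrix.mulVec_mulVec]
  have h2 := hA (Sᴴ *ᵥ w)
  rw [← h1] at h2
  have h3 := vecNorm_mulVec_sq_le A B h (Bᴴ *ᵥ w)
  linarith

theorem mulVec_eq_zero_of_gram {m n : ℕ} {M : Matrix (Fin m) (Fin n) ℂ} {v : Fin n → ℂ}
    (h : (Mᴴ * M) *ᵥ v = 0) : M *ᵥ v = 0 := by
  have h1 := vecNorm_mulVec_sq M v
  rw [h, dotProduct_zero] at h1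
  have h2 : vecNorm (M *ᵥ v) ^ 2 = 0 := by exact_mod_cast h1
  exact vecNorm_eq_zero.1 (pow_eq_zero_iff two_ne_zero |>.1 h2)

theorem singularValue_mem_of_gap {m n : ℕ} {M : Matrix (Fin m) (Fin n) ℂ} {l u τ : ℝ}
    (hτ : l ^ 2 ≤ τ) (hu : specNorm M ≤ u) {i : ℕ}
    (h : singularValue M i = 0 ∨ τ ≤ singularValue M i ^ 2) :
    singularValue M i = 0 ∨ l ≤ singularValue M i ∧ singularValue M i ≤ u :=
  h.imp_right fun h =>
    ⟨le_of_sq_le_sq (hτ.trans h) (singularValue_nonneg _ _),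
      (singularValue_le_specNorm M i).trans hu⟩

theorem specNorm_leftFactor_le {F : ℝ → ℝ} {l u Ω φ : ℝ} (hF : Tame F l u Ω φ) {m n : ℕ}
    {M : Matrix (Fin m) (Fin n) ℂ} {σ : ℝ} (hσ : l ≤ σ)
    (h : ∀ i, singularValue M i = 0 ∨ σ ≤ singularValue M i) (hu : specNorm M ≤ u) :
    specNorm (leftFactor F M) ≤ Ω / σ := by
  have hσ0 : 0 < σ := hF.pos.trans_le hσ
  refine specNorm_conjDiag_le (svd_isSVD M).1 (div_nonneg hF.Ω_nonneg hσ0.le) fun i => ?_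
  rcases h i with h | h
  · rw [h, hF.zero]; simpa using div_nonneg hF.Ω_nonneg hσ0.le
  · rw [abs_div, abs_of_pos (hσ0.trans_le h)]
    exact div_le_div₀ hF.Ω_nonneg
      (hF.bound _ (hσ.trans h) ((singularValue_le_specNorm M i).trans hu)) hσ0 h

theorem specNorm_svTransform_le {f : ℝ≥0 → ℝ≥0} {l u Ω φ : ℝ} (hF : Tame (realExt f) l u Ω φ)
    (hf : f 0 = 0) {m n : ℕ} {M : Matrix (Fin m) (Fin n) ℂ}
    (h : ∀ i, singularValue M i = 0 ∨ l ≤ singularValue M i) (hu : specNorm M ≤ u) :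
    specNorm (svTransform f M) ≤ Ω := by
  have hU := (svd_isSVD M).1
  have e : svTransform f M * (svTransform f M)ᴴ =
      conjDiag (svd M).1 fun i => (realExt f (singularValue M i)) ^ 2 := by
    rw [svTransform_eq hf, Matrix.conjTranspose_mul, leftFactor, conjDiag_conjTranspose,
      Matrix.mul_assoc, ← Matrix.mul_assoc M, (svd_isSVD M).mul_conjTranspose, conjDiag_mul hU,
      conjDiag_mul hU]
    congr 1
    ext i
    by_cases h0 : singularValue M i = 0
    · simp [h0, hF.zero]
    · field_simp
  have h1 := specNorm_conjTranspose_mul_self (svTransform f M)ᴴ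
  rw [Matrix.conjTranspose_conjTranspose, e, specNorm_conjTranspose] at h1
  refine le_of_sq_le_sq ?_ hF.Ω_nonneg
  rw [← h1]
  refine specNorm_conjDiag_le hU (sq_nonneg _) fun i => ?_
  rw [abs_pow]
  refine pow_le_pow_left₀ (abs_nonneg _) ?_ 2
  rcases h i with h | h
  · rw [h, hF.zero, abs_zero]; exact hF.Ω_nonneg
  · exact hF.bound _ h ((singularValue_le_specNorm M i).trans hu)

/-- The function `t ↦ F(√t)/√t³` of `M M*`. -/
def coreFactor (F : ℝ → ℝ) {m n : ℕ} (M : Matrix (Fin m) (Fin n) ℂ) :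
    Matrix (Fin m) (Fin m) ℂ :=
  conjDiag (svd M).1 fun i => F (singularValue M i) / singularValue M i ^ 3

set_option maxHeartbeats 1000000 in
theorem specNorm_leftFactor_sub_le {F : ℝ → ℝ} {l u Ω φ θ : ℝ} (hF : Tame F l u Ω φ)
    {c m n p : ℕ} {A : Matrix (Fin m) (Fin n) ℂ} {R : Matrix (Fin c) (Fin n) ℂ}
    {C : Matrix (Fin c) (Fin p) ℂ} {S : Matrix (Fin c) (Fin m) ℂ} {T : Matrix (Fin n) (Fin p) ℂ}
    (hR : R = S * A) (hC : C = R * T)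
    (hgap : ∀ i, singularValue Aᴴ i = 0 ∨ 2 * l ^ 2 ≤ singularValue Aᴴ i ^ 2)
    (hu0 : 0 ≤ u) (hu : specNorm A ^ 2 + l ^ 2 ≤ u ^ 2) (hθ : 4 * θ ≤ l ^ 2)
    (h1 : frobNorm (Aᴴ * A - Rᴴ * R) ≤ θ) (h2 : frobNorm (R * Rᴴ - C * Cᴴ) ≤ θ) :
    specNorm (leftFactor F Aᴴ - Rᴴ * coreFactor F C * R) ≤
      7 / 2 * ((φ + 3 * Ω / l) / (2 * l ^ 2)) * θ := by
  have hl := hF.pos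
  have hθ0 : 0 ≤ θ := (frobNorm_nonneg _).trans h1
  have h1' := (specNorm_le_frobNorm _).trans h1
  have h2' := (specNorm_le_frobNorm _).trans h2
  set K := (φ + 3 * Ω / l) / (2 * l ^ 2) with hK
  have hK0 : 0 ≤ K := by
    have := hF.Ω_nonneg; have := hF.φ_nonneg; positivity
  obtain ⟨hUA, hVA, _⟩ := svd_isSVD Aᴴ
  obtain ⟨hUR, hVR, _⟩ := svd_isSVD Rᴴ
  obtain ⟨hUC, hVC, _⟩ := svd_isSVD C
  have eA := (svd_isSVD Aᴴ).mul_conjTranspose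
  have eA' := (svd_isSVD Aᴴ).conjTranspose_mul
  have eR := (svd_isSVD Rᴴ).mul_conjTranspose
  have eR' := (svd_isSVD Rᴴ).conjTranspose_mul
  have eC := (svd_isSVD C).mul_conjTranspose
  rw [Matrix.conjTranspose_conjTranspose] at eA eA' eR eR'
  have gA : ∀ w, 2 * l ^ 2 * vecNorm (Aᴴ *ᵥ w) ^ 2 ≤ vecNorm (A *ᵥ (Aᴴ *ᵥ w)) ^ 2 := by
    intro w
    have := gap_of_gram_eq (N := Aᴴ) hVA (by rw [Matrix.conjTranspose_conjTranspose]; exact eA')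
      (τ := 2 * l ^ 2) (fun i => (hgap i).imp (fun h => by simp [h]) fun h => ⟨sq_nonneg _, h⟩) w
    rwa [Matrix.conjTranspose_conjTranspose] at this
  have gR := gap_of_specNorm_sub_le hR gA h1'
  have sR : ∀ i, singularValue Rᴴ i = 0 ∨ 2 * l ^ 2 - θ ≤ singularValue Rᴴ i ^ 2 :=
    singularValue_gap fun w => by rw [Matrix.conjTranspose_conjTranspose]; exact gR w
  have gR' : ∀ w, (2 * l ^ 2 - θ) * vecNorm (R *ᵥ w) ^ 2 ≤ vecNorm (Rᴴ *ᵥ (R *ᵥ w)) ^ 2 :=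
    fun w => gap_of_gram_eq hUR eR
      (fun i => (sR i).imp (fun h => by simp [h]) fun h => ⟨sq_nonneg _, h⟩) w
  have hCH : Cᴴ = Tᴴ * Rᴴ := by rw [hC, Matrix.conjTranspose_mul]
  have gC : ∀ w, (2 * l ^ 2 - θ - θ) * vecNorm (C *ᵥ w) ^ 2 ≤
      vecNorm (Cᴴ *ᵥ (C *ᵥ w)) ^ 2 := by
    intro w
    have := gap_of_specNorm_sub_le (A := Rᴴ) (B := Cᴴ) hCH (τ := 2 * l ^ 2 - θ) (θ := θ)
      (by simpa only [Matrix.conjTranspose_conjTranspose] using gR')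
      (by simpa only [Matrix.conjTranspose_conjTranspose] using h2') w
    simpa only [Matrix.conjTranspose_conjTranspose] using this
  have sC := singularValue_gap gC
  have nR : specNorm R ^ 2 ≤ specNorm A ^ 2 + θ := by
    rw [← specNorm_conjTranspose_mul_self, ← specNorm_conjTranspose_mul_self]
    refine (specNorm_sub_le _ (Aᴴ * A)).trans (add_le_add le_rfl ?_)
    rwa [specNorm_sub_comm]
  have nC : specNorm C ^ 2 ≤ specNorm R ^ 2 + θ := by
    have e1 := specNorm_conjTranspose_mul_self Cᴴ
    have e2 := specNorm_conjTranspose_mul_self Rᴴ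
    rw [Matrix.conjTranspose_conjTranspose, specNorm_conjTranspose] at e1 e2
    rw [← e1, ← e2]
    refine (specNorm_sub_le _ (R * Rᴴ)).trans (add_le_add le_rfl ?_)
    rwa [specNorm_sub_comm]
  have uA : specNorm Aᴴ ≤ u := by
    rw [specNorm_conjTranspose]
    exact le_of_sq_le_sq (by linarith [sq_nonneg l]) hu0
  have uR : specNorm Rᴴ ≤ u := by
    rw [specNorm_conjTranspose]
    exact le_of_sq_le_sq (by linarith [sq_nonneg l]) hu0
  have uC : specNorm C ≤ u := le_of_sq_le_sq (by linarith [sq_nonneg l]) hu0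
  have mA := fun i => singularValue_mem_of_gap (l := l) (by linarith [sq_nonneg l]) uA (hgap i)
  have mR := fun i => singularValue_mem_of_gap (l := l) (by linarith [sq_nonneg l]) uR (sR i)
  have mC := fun i => singularValue_mem_of_gap (l := l) (by linarith [sq_nonneg l]) uC (sC i)
  have step1 : specNorm (leftFactor F Aᴴ - leftFactor F Rᴴ) ≤ K * θ := by
    have := specNorm_sub_of_conjDiag hUA hUR (fun _ => 1) (fun _ => 1)
      (fun i => F (singularValue Aᴴ i) / singularValue Aᴴ i)
      (fun i => F (singularValue Rᴴ i) / singularValue Rᴴ i)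
      (fun i => singularValue Aᴴ i ^ 2) (fun i => singularValue Rᴴ i ^ 2) hK0
      (fun i j => by simpa using hF.kernel_one (mA i) (mR j))
    rw [conjDiag_one hUA, conjDiag_one hUR, Matrix.one_mul, Matrix.mul_one, ← eA, ← eR] at this
    exact this.trans (mul_le_mul_of_nonneg_left h1 hK0)
  set g : Fin c → ℝ := fun i => F (singularValue Rᴴ i) / singularValue Rᴴ i ^ 3 with hg
  set G := conjDiag (svd Rᴴ).2 g with hG
  have e1 : leftFactor F Rᴴ = Rᴴ * G * R := by
    have := (svd_isSVD Rᴴ).mul_conjDiag_mul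
      fun i => F (singularValue Rᴴ i) / singularValue Rᴴ i ^ 3
    rw [Matrix.conjTranspose_conjTranspose] at this
    rw [hG, this, leftFactor]
    congr 1
    ext i
    by_cases h0 : singularValue Rᴴ i = 0
    · simp [h0]
    · field_simp
  set D := conjDiag (svd C).1 fun i : Fin c => singularValue C i with hD
  set E := conjDiag (svd C).1 fun i : Fin c => (singularValue C i)⁻¹ with hE
  have hDE : D * E = conjDiag (svd C).1 fun i : Fin c =>
      singularValue C i * (singularValue C i)⁻¹ := conjDiag_mul hUC _ _
  have ker : ∀ v, Cᴴ *ᵥ v = 0 → Rᴴ *ᵥ v = 0 := by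
    intro v hv
    set P := conjDiag (svd Rᴴ).2 fun i : Fin c => (singularValue Rᴴ i ^ 2)⁻¹ with hP
    have hv' : Rᴴ *ᵥ (v - R *ᵥ (Rᴴ *ᵥ (P *ᵥ v))) = 0 := by
      apply mulVec_eq_zero_of_gram
      rw [Matrix.conjTranspose_conjTranspose, Matrix.mulVec_sub, Matrix.mulVec_mulVec _ R,
        Matrix.mulVec_mulVec, Matrix.mulVec_mulVec, eR', conjDiag_mul hVR, conjDiag_mul hVR,
        sub_eq_zero]
      congr 2
      ext i
      by_cases h0 : singularValue Rᴴ i = 0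
      · simp [h0]
      · field_simp
    have h3 : Cᴴ *ᵥ (R *ᵥ (Rᴴ *ᵥ (P *ᵥ v))) = 0 := by
      have : Cᴴ *ᵥ (v - R *ᵥ (Rᴴ *ᵥ (P *ᵥ v))) = 0 := by
        rw [hCH, ← Matrix.mulVec_mulVec, hv', Matrix.mulVec_zero]
      rw [Matrix.mulVec_sub, hv, zero_sub, neg_eq_zero] at this
      exact this
    have h4 := vecNorm_mulVec_sq_le Rᴴ Cᴴ (θ := θ)
      (by simpa only [Matrix.conjTranspose_conjTranspose] using h2') (R *ᵥ (Rᴴ *ᵥ (P *ᵥ v)))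
    have h5 := gR' (Rᴴ *ᵥ (P *ᵥ v))
    rw [h3, vecNorm_eq_zero.2 rfl] at h4
    have h6 : vecNorm (R *ᵥ (Rᴴ *ᵥ (P *ᵥ v))) ^ 2 = 0 := by
      have : 0 < 2 * l ^ 2 - θ - θ := by linarith [pow_pos hl 2]
      refine le_antisymm (nonpos_of_mul_nonpos_right ?_ this) (sq_nonneg _)
      linarith
    have h7 := vecNorm_eq_zero.1 (pow_eq_zero_iff two_ne_zero |>.1 h6)
    rw [h7, sub_zero] at hv'
    exact hv'
  have eQ : R = D * (E * R) := by
    have h3 : Rᴴ * (1 - D * E) = 0 := by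
      rw [Matrix.ext_iff_mulVec]
      intro v
      rw [Matrix.zero_mulVec, ← Matrix.mulVec_mulVec]
      apply ker
      apply mulVec_eq_zero_of_gram
      rw [Matrix.conjTranspose_conjTranspose, Matrix.sub_mulVec, Matrix.mulVec_sub,
        Matrix.one_mulVec, Matrix.mulVec_mulVec, eC, hDE, conjDiag_mul hUC, sub_eq_zero]
      congr 2
      ext i
      by_cases h0 : singularValue C i = 0
      · simp [h0]
      · field_simp
    have h4 := congrArg Matrix.conjTranspose h3
    rw [Matrix.conjTranspose_mul, Matrix.conjTranspose_conjTranspose, Matrix.conjTranspose_sub,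
      Matrix.conjTranspose_one, Matrix.conjTranspose_zero, hDE, conjDiag_conjTranspose, ← hDE,
      Matrix.sub_mul, Matrix.one_mul, sub_eq_zero, Matrix.mul_assoc] at h4
    exact h4
  have nE : specNorm E ≤ 1 / l := by
    refine specNorm_conjDiag_le hUC (by positivity) fun i => ?_
    rcases mC i with h | h
    · rw [h]; simp [hl.le]
    · rw [abs_inv, abs_of_nonneg (singularValue_nonneg _ _), inv_eq_one_div]
      exact one_div_le_one_div_of_le hl h.1
  have nQ : specNorm (E * R) ≤ 5 / 4 := by
    rw [← specNorm_conjTranspose, Matrix.conjTranspose_mul, hE, conjDiag_conjTranspose, ← hE]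
    refine specNorm_le (by norm_num) fun v => ?_
    have h3 := vecNorm_mulVec_sq_le Rᴴ Cᴴ (θ := θ)
      (by simpa only [Matrix.conjTranspose_conjTranspose] using h2') (E *ᵥ v)
    have h4 : vecNorm (Cᴴ *ᵥ (E *ᵥ v)) ≤ vecNorm v := by
      have h5 : specNorm (Cᴴ * E) ≤ 1 := by
        have h6 := specNorm_conjTranspose_mul_self (Cᴴ * E)
        rw [Matrix.conjTranspose_mul, Matrix.conjTranspose_conjTranspose, Matrix.mul_assoc,
          ← Matrix.mul_assoc C, eC, hE, conjDiag_conjTranspose, conjDiag_mul hUC,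
          conjDiag_mul hUC, ← hE] at h6
        have h7 := specNorm_conjDiag_le hUC (d := fun i : Fin c => (singularValue C i)⁻¹ *
          (singularValue C i ^ 2 * (singularValue C i)⁻¹)) zero_le_one fun i => by
            by_cases h0 : singularValue C i = 0
            · simp [h0]
            · rw [show (singularValue C i)⁻¹ * (singularValue C i ^ 2 * (singularValue C i)⁻¹) = 1
                by field_simp]
              simp
        rw [h6] at h7
        nlinarith [specNorm_nonneg (Cᴴ * E)]
      rw [Matrix.mulVec_mulVec]
      exact (vecNorm_mulVec_le _ _).trans (mul_le_of_le_one_left (vecNorm_nonneg _) h5)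
    have h5 : vecNorm (E *ᵥ v) ≤ 1 / l * vecNorm v :=
      (vecNorm_mulVec_le _ _).trans (mul_le_mul_of_nonneg_right nE (vecNorm_nonneg _))
    rw [← Matrix.mulVec_mulVec]
    have h6 : vecNorm (E *ᵥ v) ^ 2 ≤ 1 / l ^ 2 * vecNorm v ^ 2 := by
      refine (pow_le_pow_left₀ (vecNorm_nonneg _) h5 2).trans (le_of_eq ?_)
      rw [mul_pow]; simp
    have h7 := pow_le_pow_left₀ (vecNorm_nonneg _) h4 2
    have h8 : θ * vecNorm (E *ᵥ v) ^ 2 ≤ 1 / 4 * vecNorm v ^ 2 := by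
      calc θ * vecNorm (E *ᵥ v) ^ 2 ≤ (l ^ 2 / 4) * (1 / l ^ 2 * vecNorm v ^ 2) := by
            apply mul_le_mul (by linarith) h6 (sq_nonneg _) (by positivity)
        _ = 1 / 4 * vecNorm v ^ 2 := by field_simp
    refine le_of_sq_le_sq ?_ (mul_nonneg (by norm_num) (vecNorm_nonneg v))
    rw [mul_pow]
    linarith [sq_nonneg (vecNorm v)]
  have step2 : specNorm (Rᴴ * G * R - Rᴴ * coreFactor F C * R) ≤ 5 / 4 * (2 * K) * θ := by
    rw [← Matrix.sub_mul, ← Matrix.mul_sub, Matrix.mul_assoc]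
    set X := conjDiag (svd Rᴴ).2 fun i : Fin c => singularValue Rᴴ i with hX
    have h3 : specNorm (Rᴴ * ((G - coreFactor F C) * R)) =
        specNorm (X * ((G - coreFactor F C) * R)) := by
      apply specNorm_eq_of_gram_eq
      rw [Matrix.conjTranspose_mul, Matrix.conjTranspose_mul X, Matrix.conjTranspose_conjTranspose,
        Matrix.mul_assoc, ← Matrix.mul_assoc R, eR', Matrix.mul_assoc _ Xᴴ, ← Matrix.mul_assoc Xᴴ,
        hX, conjDiag_conjTranspose, conjDiag_mul hVR]
      simp only [sq]
    have h4 := specNorm_sub_of_conjDiag hVR hUC (fun i : Fin c => singularValue Rᴴ i)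
      (fun i : Fin c => singularValue C i) g
      (fun i : Fin c => F (singularValue C i) / singularValue C i ^ 3)
      (fun i => singularValue Rᴴ i ^ 2) (fun i => singularValue C i ^ 2) (K := 2 * K)
      (by positivity)
      (fun i j => by
        have := hF.kernel_two (mR i) (mC j)
        rwa [show (φ + 3 * Ω / l) / l ^ 2 = 2 * K by rw [hK]; field_simp] at this)
    rw [← eR', ← eC] at h4
    have h5 : X * ((G - coreFactor F C) * R) = X * (G - coreFactor F C) * D * (E * R) := by
      conv_lhs => rw [eQ]
      simp only [Matrix.mul_assoc]
    rw [h3, h5]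
    refine (specNorm_mul _ _).trans ?_
    have h6 : specNorm (X * (G - coreFactor F C) * D) ≤ 2 * K * θ :=
      h4.trans (mul_le_mul_of_nonneg_left h2 (by positivity))
    calc _ ≤ 2 * K * θ * (5 / 4) := mul_le_mul h6 nQ (specNorm_nonneg _) (by positivity)
      _ = _ := by ring
  rw [← e1] at step2
  have h3 := specNorm_add (leftFactor F Aᴴ - leftFactor F Rᴴ)
    (leftFactor F Rᴴ - Rᴴ * coreFactor F C * R)
  rw [sub_add_sub_cancel] at h3
  linarith

/-! ### Expectations -/

/-- The expectation of a non-negative function. -/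
def expect {α : Type*} (μ : PMF α) (F : α → ℝ≥0∞) : ℝ≥0∞ := ∑' a, μ a * F a

theorem expect_pure {α : Type*} (a : α) (F : α → ℝ≥0∞) : expect (PMF.pure a) F = F a := by
  rw [expect, tsum_eq_single a]
  · simp
  · intro b hb; simp [hb]

theorem expect_bind {α β : Type*} (μ : PMF α) (k : α → PMF β) (F : β → ℝ≥0∞) :
    expect (μ.bind k) F = expect μ fun a => expect (k a) F := by
  simp only [expect, PMF.bind_apply]
  simp_rw [← ENNReal.tsum_mul_right, ← ENNReal.tsum_mul_left]
  rw [ENNReal.tsum_comm]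
  simp_rw [mul_assoc]

theorem expect_map {α β : Type*} (μ : PMF α) (g : α → β) (F : β → ℝ≥0∞) :
    expect (μ.map g) F = expect μ fun a => F (g a) := by
  rw [PMF.map, expect_bind]
  simp [expect_pure]

theorem expect_mono {α : Type*} (μ : PMF α) {F G : α → ℝ≥0∞} (h : ∀ a ∈ μ.support, F a ≤ G a) :
    expect μ F ≤ expect μ G := by
  refine ENNReal.tsum_le_tsum fun a => ?_
  by_cases ha : a ∈ μ.support
  · gcongr; exact h a ha
  · rw [← PMF.apply_eq_zero_iff] at ha; simp [ha]

theorem expect_add_const {α : Type*} (μ : PMF α) (F : α → ℝ≥0∞) (c : ℝ≥0∞) :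
    expect μ (fun a => F a + c) = expect μ F + c := by
  simp only [expect, mul_add]
  rw [ENNReal.tsum_add, ENNReal.tsum_mul_right, PMF.tsum_coe, one_mul]

theorem toOuterMeasure_mul_le_expect {α : Type*} (μ : PMF α) (F : α → ℝ≥0∞) (ε : ℝ≥0∞) :
    ε * μ.toOuterMeasure {a | ε ≤ F a} ≤ expect μ F := by
  rw [PMF.toOuterMeasure_apply, ← ENNReal.tsum_mul_left]
  refine ENNReal.tsum_le_tsum fun a => ?_
  by_cases h : ε ≤ F a
  · rw [Set.indicator_of_mem (show a ∈ {a | ε ≤ F a} from h), mul_comm]; gcongr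
  · rw [Set.indicator_of_notMem (show a ∉ {a | ε ≤ F a} from h)]; simp

theorem expect_iterate_le {body : ℕ → State → PMF State} {Inv : ℕ → State → Prop}
    {Φ : ℕ → State → ℝ≥0∞} {V : ℝ≥0∞} {N : ℕ}
    (hInv : ∀ k < N, ∀ s, Inv k s → ∀ s' ∈ (body k s).support, Inv (k + 1) s')
    (hΦ : ∀ k < N, ∀ s, Inv k s → expect (body k s) (Φ (k + 1)) ≤ Φ k s + V)
    {s : State} (hs : Inv 0 s) :
    (∀ s' ∈ (iterate body N s).support, Inv N s') ∧
      expect (iterate body N s) (Φ N) ≤ Φ 0 s + N * V := by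
  suffices ∀ k ≤ N, (∀ s' ∈ (iterate body k s).support, Inv k s') ∧
      expect (iterate body k s) (Φ k) ≤ Φ 0 s + k * V from this N le_rfl
  intro k
  induction k with
  | zero => intro _; simp [iterate, expect_pure, hs]
  | succ k ih =>
    intro hk
    obtain ⟨h1, h2⟩ := ih (by omega)
    constructor
    · intro s' hs'
      rw [iterate, PMF.mem_support_bind_iff] at hs'
      obtain ⟨t, ht, hs'⟩ := hs'
      exact hInv k hk t (h1 t ht) s' hs'
    · rw [iterate, expect_bind]
      calc _ ≤ expect (iterate body k s) fun t => Φ k t + V :=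
            expect_mono _ fun t ht => hΦ k hk t (h1 t ht)
        _ = expect (iterate body k s) (Φ k) + V := expect_add_const _ _ _
        _ ≤ Φ 0 s + k * V + V := by gcongr
        _ = _ := by push_cast; ring

/-- Chebyshev's inequality for a loop that draws `N` samples one after the other: `Q` is a square
norm, `G x` the contribution of the sample `x`. -/
theorem sampling_loop {X H : Type*} [AddCommGroup H] (Q : H → ℝ) (hQ : Q 0 = 0)
    {body : ℕ → State → PMF State} {Inv : ℕ → State → Prop} (idx : State → ℕ → X) (G : X → H)
    (mean : H) {V δ : ℝ} {N : ℕ} (hN : 0 < N) (hδ : 0 < δ)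
    (hInv : ∀ k < N, ∀ s, Inv k s → ∀ s' ∈ (body k s).support,
      Inv (k + 1) s' ∧ ∀ t < k, idx s' t = idx s t)
    (hstep : ∀ k < N, ∀ s, Inv k s → ∀ M : H,
      expect (body k s) (fun s' => ENNReal.ofReal (Q (M + (G (idx s' k) - mean)))) ≤
        ENNReal.ofReal (Q M) + ENNReal.ofReal V)
    {s : State} (hs : Inv 0 s) :
    (∀ s' ∈ (iterate body N s).support, Inv N s') ∧
      (iterate body N s).toOuterMeasure
        {s' | ¬ Q (∑ t ∈ Finset.range N, (G (idx s' t) - mean)) ≤ N ^ 2 * δ} ≤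
          ENNReal.ofReal (V / (N * δ)) := by
  obtain ⟨h1, h2⟩ := expect_iterate_le (body := body) (Inv := Inv) (N := N)
    (Φ := fun k s' => ENNReal.ofReal (Q (∑ t ∈ Finset.range k, (G (idx s' t) - mean))))
    (V := ENNReal.ofReal V) (fun k hk s hs s' hs' => (hInv k hk s hs s' hs').1) (by
      intro k hk s hs
      refine le_trans (expect_mono _ fun s' hs' => ?_)
        (hstep k hk s hs (∑ t ∈ Finset.range k, (G (idx s t) - mean)))
      rw [Finset.sum_range_succ, Finset.sum_congr rfl fun t ht => by
        rw [(hInv k hk s hs s' hs').2 t (Finset.mem_range.1 ht)]]) hs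
  refine ⟨h1, ?_⟩
  have hN' : (0 : ℝ) < N := by exact_mod_cast hN
  simp only [Finset.range_zero, Finset.sum_empty, hQ, ENNReal.ofReal_zero, zero_add] at h2
  have h3 := (toOuterMeasure_mul_le_expect (iterate body N s)
    (fun s' => ENNReal.ofReal (Q (∑ t ∈ Finset.range N, (G (idx s' t) - mean))))
    (ENNReal.ofReal (N ^ 2 * δ))).trans h2
  have h4 : (iterate body N s).toOuterMeasure
      {s' | ¬ Q (∑ t ∈ Finset.range N, (G (idx s' t) - mean)) ≤ N ^ 2 * δ} ≤
      (iterate body N s).toOuterMeasure {s' | ENNReal.ofReal (N ^ 2 * δ) ≤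
        ENNReal.ofReal (Q (∑ t ∈ Finset.range N, (G (idx s' t) - mean)))} := by
    refine MeasureTheory.OuterMeasure.mono _ fun s' hs' => ?_
    exact ENNReal.ofReal_le_ofReal (not_le.1 hs').le
  refine h4.trans ?_
  have h5 : ENNReal.ofReal (N ^ 2 * δ) ≠ 0 := by
    rw [Ne, ENNReal.ofReal_eq_zero, not_le]; positivity
  rw [show V / (N * δ) = (N * V) / (N ^ 2 * δ) by field_simp,
    ENNReal.ofReal_div_of_pos (by positivity), ENNReal.le_div_iff_mul_le (Or.inl h5)
      (Or.inl ENNReal.ofReal_ne_top), mul_comm, ENNReal.ofReal_mul hN'.le, ENNReal.ofReal_natCast]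
  exact h3

/-! ### Sampling from a vector -/

theorem enorm_sq_eq_ofReal (z : ℂ) : ‖z‖ₑ ^ 2 = ENNReal.ofReal (‖z‖ ^ 2) := by
  rw [← ofReal_norm, ENNReal.ofReal_pow (norm_nonneg _)]

theorem tsum_enorm_sq {k : ℕ} (v : Fin k → ℂ) :
    ∑' i, (‖v i‖ₑ ^ 2 : ℝ≥0∞) = ENNReal.ofReal (vecNorm v ^ 2) := by
  rw [tsum_fintype, vecNorm_sq, ENNReal.ofReal_sum_of_nonneg fun i _ => sq_nonneg _]
  simp_rw [enorm_sq_eq_ofReal]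

theorem expect_l2Sample {k : ℕ} {v : Fin k → ℂ} (hv : vecNorm v ≠ 0) {F : ℕ → ℝ}
    (hF : ∀ i, 0 ≤ F i) : expect (l2Sample v) (fun i => ENNReal.ofReal (F i)) =
      ENNReal.ofReal (∑ i, ‖v i‖ ^ 2 / vecNorm v ^ 2 * F i) := by
  have hpos : 0 < vecNorm v ^ 2 := by have := vecNorm_nonneg v; positivity
  have h : (∑' i, (‖v i‖ₑ ^ 2 : ℝ≥0∞)) ≠ 0 := by
    rw [tsum_enorm_sq, Ne, ENNReal.ofReal_eq_zero, not_le]; exact hpos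
  have h0 : ∀ i ∈ (Finset.univ : Finset (Fin k)), 0 ≤ ‖v i‖ ^ 2 / vecNorm v ^ 2 * F i :=
    fun i _ => mul_nonneg (by positivity) (hF i)
  rw [l2Sample, dif_pos h, expect_map, expect, tsum_fintype, ENNReal.ofReal_sum_of_nonneg h0]
  refine Finset.sum_congr rfl fun i _ => ?_
  rw [PMF.normalize_apply, tsum_enorm_sq, enorm_sq_eq_ofReal, ENNReal.ofReal_mul (by positivity),
    ENNReal.ofReal_div_of_pos hpos, div_eq_mul_inv]

theorem mem_support_l2Sample {k : ℕ} {v : Fin k → ℂ} (hv : vecNorm v ≠ 0) {x : ℕ}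
    (hx : x ∈ (l2Sample v).support) : ∃ i : Fin k, x = i ∧ v i ≠ 0 := by
  have h : (∑' i, (‖v i‖ₑ ^ 2 : ℝ≥0∞)) ≠ 0 := by
    rw [tsum_enorm_sq, Ne, ENNReal.ofReal_eq_zero, not_le]
    have := vecNorm_nonneg v; positivity
  rw [l2Sample, dif_pos h, PMF.mem_support_map_iff] at hx
  obtain ⟨i, hi, rfl⟩ := hx
  rw [PMF.mem_support_normalize_iff] at hi
  exact ⟨i, rfl, fun h0 => hi (by simp [h0])⟩

theorem expect_uniform {N : ℕ} (h : (Finset.range N).Nonempty) {F : ℕ → ℝ}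
    (hF : ∀ i, 0 ≤ F i) : expect (PMF.uniformOfFinset (Finset.range N) h)
      (fun i => ENNReal.ofReal (F i)) = ENNReal.ofReal (∑ i : Fin N, 1 / N * F i) := by
  have hN : (0 : ℝ) < N := by
    have := Finset.nonempty_range_iff.1 h; exact_mod_cast Nat.pos_of_ne_zero this
  have h0 : ∀ i ∈ (Finset.univ : Finset (Fin N)), 0 ≤ 1 / (N : ℝ) * F i :=
    fun i _ => mul_nonneg (by positivity) (hF i)
  rw [expect, tsum_eq_sum (s := Finset.range N), Finset.sum_range,
    ENNReal.ofReal_sum_of_nonneg h0]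
  · refine Finset.sum_congr rfl fun i _ => ?_
    rw [PMF.uniformOfFinset_apply_of_mem _ (Finset.mem_range.2 i.2),
      ENNReal.ofReal_mul (by positivity), ENNReal.ofReal_div_of_pos hN]
    simp
  · intro i hi
    rw [PMF.uniformOfFinset_apply_of_notMem _ hi, zero_mul]

/-! ### Second moments -/

theorem sum_mul_sq_norm_add_sub_le {ι : Type*} [Fintype ι] {w : ι → ℝ} (hw : ∑ i, w i = 1)
    (G : ι → ℂ) {mean : ℂ} (hm : ∑ i, (w i : ℂ) * G i = mean) (v : ℂ) :
    ∑ i, w i * ‖v + (G i - mean)‖ ^ 2 ≤ ‖v‖ ^ 2 + ∑ i, w i * ‖G i‖ ^ 2 := by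
  have h1 : ∀ i, w i * ‖v + (G i - mean)‖ ^ 2 = w i * ‖v - mean‖ ^ 2 + w i * ‖G i‖ ^ 2 +
      2 * ((w i : ℂ) * G i * (starRingEnd ℂ) (v - mean)).re := by
    intro i
    rw [show v + (G i - mean) = G i + (v - mean) by ring, ← Complex.normSq_eq_norm_sq,
      ← Complex.normSq_eq_norm_sq, ← Complex.normSq_eq_norm_sq, Complex.normSq_add, mul_assoc,
      Complex.re_ofReal_mul]
    ring
  simp_rw [h1]
  rw [Finset.sum_add_distrib, Finset.sum_add_distrib, ← Finset.sum_mul, hw, ← Finset.mul_sum,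
    ← Complex.re_sum, ← Finset.sum_mul, hm]
  have h2 : ‖v‖ ^ 2 = ‖v - mean‖ ^ 2 + ‖mean‖ ^ 2 +
      2 * (mean * (starRingEnd ℂ) (v - mean)).re := by
    conv_lhs => rw [show v = mean + (v - mean) by ring]
    rw [← Complex.normSq_eq_norm_sq, ← Complex.normSq_eq_norm_sq, ← Complex.normSq_eq_norm_sq,
      Complex.normSq_add]
    ring
  rw [h2]
  linarith [sq_nonneg ‖mean‖]

theorem sum_mul_frobNorm_sq_le {ι : Type*} [Fintype ι] {w : ι → ℝ} (hw : ∑ i, w i = 1) {p q : ℕ}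
    (G : ι → Matrix (Fin p) (Fin q) ℂ) {mean : Matrix (Fin p) (Fin q) ℂ}
    (hm : ∀ a b, ∑ i, (w i : ℂ) * G i a b = mean a b) (M : Matrix (Fin p) (Fin q) ℂ) :
    ∑ i, w i * frobNorm (M + (G i - mean)) ^ 2 ≤
      frobNorm M ^ 2 + ∑ i, w i * frobNorm (G i) ^ 2 := by
  simp only [frobNorm_sq, Finset.mul_sum]
  rw [Finset.sum_comm, Finset.sum_comm (s := Finset.univ (α := ι)), ← Finset.sum_add_distrib]
  refine Finset.sum_le_sum fun a _ => ?_
  rw [Finset.sum_comm, Finset.sum_comm (s := Finset.univ (α := ι)), ← Finset.sum_add_distrib]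
  exact Finset.sum_le_sum fun b _ => sum_mul_sq_norm_add_sub_le hw (fun i => G i a b) (hm a b) (M a b)

/-- The contribution of the column `v` to the estimate of a Gram matrix. -/
def outer {p : ℕ} (Fsq : ℝ) (v : Fin p → ℂ) : Matrix (Fin p) (Fin p) ℂ :=
  Matrix.of fun a b => ((Fsq / vecNorm v ^ 2 : ℝ) : ℂ) * (v a * star (v b))

theorem frobNorm_outer_sq_le {p : ℕ} (Fsq : ℝ) (v : Fin p → ℂ) :
    frobNorm (outer Fsq v) ^ 2 ≤ Fsq ^ 2 := by
  have h : frobNorm (outer Fsq v) ^ 2 = (Fsq / vecNorm v ^ 2) ^ 2 * (vecNorm v ^ 2 * vecNorm v ^ 2)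
      := by
    rw [frobNorm_sq]
    simp only [outer, Matrix.of_apply, norm_mul, norm_star, mul_pow, Complex.norm_real,
      Real.norm_eq_abs, sq_abs, ← Finset.mul_sum]
    rw [← vecNorm_sq, ← Finset.sum_mul, ← vecNorm_sq]
  rw [h]
  by_cases h0 : vecNorm v = 0
  · simp [h0, sq_nonneg]
  · apply le_of_eq; field_simp

theorem gram_second_moment {ι : Type*} [Fintype ι] {p : ℕ} (col : ι → Fin p → ℂ) {Fsq : ℝ}
    (hF : ∑ x, vecNorm (col x) ^ 2 = Fsq) (hF0 : Fsq ≠ 0) {mean : Matrix (Fin p) (Fin p) ℂ}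
    (hm : ∀ a b, ∑ x, col x a * star (col x b) = mean a b) (M : Matrix (Fin p) (Fin p) ℂ) :
    ∑ x, vecNorm (col x) ^ 2 / Fsq * frobNorm (M + (outer Fsq (col x) - mean)) ^ 2 ≤
      frobNorm M ^ 2 + Fsq ^ 2 := by
  have hw : ∑ x, vecNorm (col x) ^ 2 / Fsq = 1 := by rw [← Finset.sum_div, hF, div_self hF0]
  have hw0 : ∀ x, 0 ≤ vecNorm (col x) ^ 2 / Fsq := fun x =>
    div_nonneg (sq_nonneg _) (hF ▸ Finset.sum_nonneg fun _ _ => sq_nonneg _)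
  refine (sum_mul_frobNorm_sq_le hw (fun x => outer Fsq (col x)) (fun a b => ?_) M).trans ?_
  · rw [← hm]
    refine Finset.sum_congr rfl fun x _ => ?_
    simp only [outer, Matrix.of_apply]
    rw [← mul_assoc, ← Complex.ofReal_mul]
    by_cases h0 : vecNorm (col x) = 0
    · rw [vecNorm_eq_zero.1 h0]; simp
    · rw [show vecNorm (col x) ^ 2 / Fsq * (Fsq / vecNorm (col x) ^ 2) = 1 by field_simp]
      simp
  · gcongr
    calc _ ≤ ∑ x, vecNorm (col x) ^ 2 / Fsq * Fsq ^ 2 :=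
          Finset.sum_le_sum fun x _ =>
            mul_le_mul_of_nonneg_left (frobNorm_outer_sq_le _ _) (hw0 x)
      _ = Fsq ^ 2 := by rw [← Finset.sum_mul, hw, one_mul]

/-! ### Sure and probable outcomes -/

/-- Every outcome satisfies `S`, and `G` fails with probability at most `δ`. -/
structure Yields (μ : PMF State) (S G : State → Prop) (δ : ℝ≥0∞) : Prop where
  sure : ∀ s ∈ μ.support, S s
  fail : μ.toOuterMeasure {s | ¬ G s} ≤ δ

theorem Yields.bind {μ : PMF State} {S G S' G' : State → Prop} {δ δ' : ℝ≥0∞}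
    (h : Yields μ S G δ) {k : State → PMF State}
    (hk : ∀ s, S s → ∀ s' ∈ (k s).support, S' s')
    (hk' : ∀ s, S s → G s → (k s).toOuterMeasure {s' | ¬ G' s'} ≤ δ') :
    Yields (μ.bind k) S' G' (δ + δ') where
  sure s' hs' := by
    rw [PMF.mem_support_bind_iff] at hs'
    obtain ⟨s, hs, hs'⟩ := hs'
    exact hk s (h.sure s hs) s' hs'
  fail := by
    rw [PMF.toOuterMeasure_bind_apply]
    calc _ ≤ ∑' s, ({s | ¬ G s}.indicator μ s + μ s * δ') := by
          refine ENNReal.tsum_le_tsum fun s => ?_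
          by_cases hs : s ∈ μ.support
          · by_cases hG : G s
            · rw [Set.indicator_of_notMem (by simpa using hG), zero_add]
              gcongr; exact hk' s (h.sure s hs) hG
            · rw [Set.indicator_of_mem (show s ∈ {s | ¬ G s} from hG)]
              refine le_add_right (mul_le_of_le_one_right' ?_)
              rw [PMF.toOuterMeasure_apply]
              calc _ ≤ ∑' x, (k s) x := ENNReal.tsum_le_tsum fun x => Set.indicator_le_self _ _ _
                _ = 1 := PMF.tsum_coe _
          · rw [← PMF.apply_eq_zero_iff] at hs; simp [hs]
      _ = μ.toOuterMeasure {s | ¬ G s} + δ' := by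
          rw [ENNReal.tsum_add, ENNReal.tsum_mul_right, PMF.tsum_coe, one_mul,
            PMF.toOuterMeasure_apply]
      _ ≤ _ := by gcongr; exact h.fail

theorem Yields.of_pure {s : State} {S G : State → Prop} (hS : S s) (hG : G s) :
    Yields (PMF.pure s) S G 0 where
  sure s' hs' := by rw [PMF.mem_support_pure_iff] at hs'; rwa [hs']
  fail := by simp [PMF.toOuterMeasure_pure_apply, hG]

theorem Yields.one_sub_le {μ : PMF State} {S G : State → Prop} {η : ℝ} (hη : 0 ≤ η)
    (h : Yields μ S G (ENNReal.ofReal η)) :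
    ENNReal.ofReal (1 - η) ≤ μ.toOuterMeasure {s | G s} := by
  have h1 : (1 : ℝ≥0∞) ≤ μ.toOuterMeasure {s | G s} + ENNReal.ofReal η := by
    calc (1 : ℝ≥0∞) = μ.toOuterMeasure Set.univ := by
          rw [PMF.toOuterMeasure_apply]; simp [PMF.tsum_coe]
      _ ≤ μ.toOuterMeasure ({s | G s} ∪ {s | ¬ G s}) :=
          MeasureTheory.OuterMeasure.mono _ fun s _ => em (G s)
      _ ≤ _ := (MeasureTheory.measure_union_le _ _).trans (by gcongr; exact h.fail)
  rw [ENNReal.ofReal_sub _ hη, ENNReal.ofReal_one]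
  exact tsub_le_iff_right.2 h1

/-! ### Deterministic execution -/

/-- The value of the cell `(0, 0)` of an array of natural numbers. -/
def NExp.reg (a : ℕ) : NExp := .cell a (.lit 0) (.lit 0)

@[simp] theorem NExp.eval_reg (a : ℕ) (s : State) : (NExp.reg a).eval s = s.nat a 0 0 := rfl

@[simp] theorem NExp.cost_reg (a : ℕ) : (NExp.reg a).cost = 3 := rfl

theorem exec_seq_of_pure {E : Env} {c d : Cmd} {s t : State} (h : c.exec E s = PMF.pure t) :
    (Cmd.seq c d).exec E s = d.exec E t := by
  simp [Cmd.exec, h]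

theorem exec_loop_of_pure {E : Env} {v : ℕ} {e : NExp} {c : Cmd} {I : ℕ → State → Prop} {N : ℕ}
    {s : State} (hN : e.eval s = N)
    (step : ∀ k < N, ∀ t, I k t →
      ∃ t', c.exec E ((t.setNat v 0 0 k).addTime 1) = PMF.pure t' ∧ I (k + 1) t')
    (h0 : I 0 (s.addTime (e.cost + 1))) :
    ∃ t, (Cmd.loop v e c).exec E s = PMF.pure t ∧ I N t := by
  have : ∀ k ≤ N, ∃ t, iterate (fun k s' => c.exec E ((s'.setNat v 0 0 k).addTime 1)) k
      (s.addTime (e.cost + 1)) = PMF.pure t ∧ I k t := by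
    intro k
    induction k with
    | zero => intro _; exact ⟨_, rfl, h0⟩
    | succ k ih =>
      intro hk
      obtain ⟨t, ht, hI⟩ := ih (by omega)
      obtain ⟨t', ht', hI'⟩ := step k hk t hI
      exact ⟨t', by rw [iterate, ht, PMF.pure_bind, ht'], hI'⟩
  simpa [Cmd.exec, hN] using this N le_rfl

/-- `t` differs from `s` at most in the array `a` of complex numbers, and in the arrays of natural
numbers that serve as loop counters (those from `v` on). -/
structure Frame (v a : ℕ) (s t : State) : Prop where
  nat : ∀ x < v, t.nat x = s.nat x
  val : ∀ x, x ≠ a → t.val x = s.val x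
  samples : t.samples = s.samples

theorem Frame.refl (v a : ℕ) (s : State) : Frame v a s s := ⟨fun _ _ => rfl, fun _ _ => rfl, rfl⟩

theorem Frame.trans {v v' a : ℕ} {s t u : State} (h : Frame v a s t) (h' : Frame v' a t u)
    (hv : v ≤ v') : Frame v a s u :=
  ⟨fun x hx => (h'.nat x (hx.trans_le hv)).trans (h.nat x hx),
    fun x hx => (h'.val x hx).trans (h.val x hx), h'.samples.trans h.samples⟩

theorem Frame.addTime {v a : ℕ} {s t : State} (h : Frame v a s t) (k : ℕ) :
    Frame v a s (t.addTime k) := ⟨h.nat, h.val, h.samples⟩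

theorem Frame.setNat {v a : ℕ} {s t : State} (h : Frame v a s t) {x : ℕ} (hx : v ≤ x)
    (i j k : ℕ) : Frame v a s (t.setNat x i j k) where
  nat y hy := by
    rw [← h.nat y hy]
    ext i' j'
    simp [State.setNat, (hy.trans_le hx).ne]
  val := h.val
  samples := h.samples

theorem Frame.setVal {v a : ℕ} {s t : State} (h : Frame v a s t) (i j : ℕ) (z : ℂ) :
    Frame v a s (t.setVal a i j z) where
  nat := h.nat
  val y hy := by
    rw [← h.val y hy]
    ext i' j'
    simp [State.setVal, hy]
  samples := h.samples

theorem setVal_val_self (s : State) (a i j : ℕ) (z : ℂ) (i' j' : ℕ) :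
    (s.setVal a i j z).val a i' j' = if i' = i ∧ j' = j then z else s.val a i' j' := by
  simp [State.setVal]

/-- From `t`, the program writes `w` into the cell `(i, j)` of the array `a`, in time at most `T`,
and changes nothing else but the loop counters from `10` on. -/
def WritesCell (E : Env) (c : Cmd) (a i j : ℕ) (w : ℂ) (T : ℕ) (t : State) : Prop :=
  ∃ t', c.exec E t = PMF.pure t' ∧ Frame 10 a t t' ∧ t'.time ≤ t.time + T ∧
    ∀ i' j', t'.val a i' j' = if i' = i ∧ j' = j then w else t.val a i' j'

/-- Run `c` for all pairs of counters. -/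
def fill (P Q : NExp) (c : Cmd) : Cmd := .loop 8 P (.loop 9 Q c)

theorem exec_fill {E : Env} {P Q : NExp} {c : Cmd} {a p q T : ℕ} {s : State} (w : ℕ → ℕ → ℂ)
    (hP : P.eval s = p) (hQ : ∀ t, Frame 8 a s t → Q.eval t = q)
    (hc : ∀ i < p, ∀ j < q, ∀ t, Frame 8 a s t → t.nat 8 0 0 = i → t.nat 9 0 0 = j →
      WritesCell E c a i j (w i j) T t) :
    ∃ t, (fill P Q c).exec E s = PMF.pure t ∧ Frame 8 a s t ∧
      t.time ≤ s.time + (P.cost + 1 + p * (Q.cost + 2 + q * (T + 1))) ∧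
      ∀ i < p, ∀ j < q, t.val a i j = w i j := by
  obtain ⟨t, ht, hF, hT, hw⟩ := exec_loop_of_pure (E := E) (v := 8) (e := P) (c := .loop 9 Q c)
    (s := s) (N := p) (I := fun k t => Frame 8 a s t ∧
      t.time ≤ s.time + (P.cost + 1 + k * (Q.cost + 2 + q * (T + 1))) ∧
      ∀ i < k, ∀ j < q, t.val a i j = w i j) hP (by
    rintro k hk t ⟨hF, hT, hw⟩
    have hF1 := (hF.setNat (x := 8) le_rfl 0 0 k).addTime 1
    obtain ⟨t', ht', hF', _, hT', hw', hw''⟩ := exec_loop_of_pure (E := E) (v := 9) (e := Q) (c := c)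
      (s := (t.setNat 8 0 0 k).addTime 1) (N := q) (I := fun l t' => Frame 8 a s t' ∧
        t'.nat 8 0 0 = k ∧ t'.time ≤ t.time + (Q.cost + 2 + l * (T + 1)) ∧
        (∀ i < k, ∀ j < q, t'.val a i j = w i j) ∧ ∀ j < l, t'.val a k j = w k j) (hQ _ hF1) (by
      rintro l hl u ⟨hu, hu8, huT, huw, huw'⟩
      obtain ⟨u', hu', hFu, hTu, hwu⟩ := hc k hk l hl ((u.setNat 9 0 0 l).addTime 1)
        ((hu.setNat (x := 9) (by norm_num) 0 0 l).addTime 1)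
        (by simpa [State.setNat, State.addTime] using hu8) (by simp [State.setNat, State.addTime])
      refine ⟨u', hu', ((hu.setNat (x := 9) (by norm_num) 0 0 l).addTime 1).trans hFu (by norm_num),
        ?_, ?_, ?_, ?_⟩
      · rw [hFu.nat 8 (by norm_num)]; simpa [State.setNat, State.addTime] using hu8
      · have : ((u.setNat 9 0 0 l).addTime 1).time = u.time + 1 := rfl
        rw [this] at hTu
        nlinarith
      · intro i hi j hj
        rw [hwu, if_neg (by omega)]
        exact huw i hi j hj
      · intro j hj
        rw [hwu]
        rcases Nat.lt_succ_iff_lt_or_eq.1 hj with h | h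
        · rw [if_neg (by omega)]; exact huw' j h
        · rw [if_pos ⟨rfl, h⟩, h])
      ⟨hF1.addTime _, by simp [State.setNat, State.addTime],
        by simp [State.setNat, State.addTime]; omega, hw, by simp⟩
    refine ⟨t', ht', hF', ?_, ?_⟩
    · nlinarith
    · intro i hi j hj
      rcases Nat.lt_succ_iff_lt_or_eq.1 hi with h | h
      · exact hw' i h j hj
      · rw [h]; exact hw'' j hj)
    ⟨(Frame.refl 8 a s).addTime _, by simp [State.addTime], by simp⟩
  exact ⟨t, ht, hF, hT, hw⟩

/-- The location of the current cell of a fill. -/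
def here (a : ℕ) : Loc := ⟨a, .reg 8, .reg 9⟩

theorem writesCell_entry {E : Env} (D : Src) (a : ℕ) (ei ej : NExp) {i j : ℕ} {t : State}
    (hi : t.nat 8 0 0 = i) (hj : t.nat 9 0 0 = j) :
    WritesCell E (.entry D (here a) ei ej) a i j ((E.get D).entry (ei.eval t) (ej.eval t))
      (7 + ei.cost + ej.cost + (E.get D).opCost) t := by
  refine ⟨_, rfl, ?_, ?_, ?_⟩
  · exact ((Frame.refl 10 a t).setVal _ _ _).addTime _
  · simp [State.addTime, Loc.putVal, State.setVal, here, Loc.cost]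
  · intro i' j'
    simp [State.addTime, Loc.putVal, here, setVal_val_self, hi, hj]

theorem writesCell_rowNorm {E : Env} (D : Src) (a : ℕ) (ei : NExp) {i j : ℕ} {t : State}
    (hi : t.nat 8 0 0 = i) (hj : t.nat 9 0 0 = j) :
    WritesCell E (.rowNorm D (here a) ei) a i j ((E.get D).rowNorm (ei.eval t) : ℂ)
      (7 + ei.cost + (E.get D).rowNormCost) t := by
  refine ⟨_, rfl, ?_, ?_, ?_⟩
  · exact ((Frame.refl 10 a t).setVal _ _ _).addTime _
  · simp [State.addTime, Loc.putVal, State.setVal, here, Loc.cost]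
  · intro i' j'
    simp [State.addTime, Loc.putVal, here, setVal_val_self, hi, hj]

/-- Sum `z` over the counter `10` into the current cell of a fill. -/
def sumInto (a : ℕ) (N : NExp) (z : ZExp) : Cmd :=
  .seq (.setVal (here a) (.lit 0))
    (.loop 10 N (.setVal (here a) (.add (.cell a (.reg 8) (.reg 9)) z)))

theorem writesCell_sumInto {E : Env} {a : ℕ} {N : NExp} {z : ZExp} {i j r : ℕ} {t : State}
    (hi : t.nat 8 0 0 = i) (hj : t.nat 9 0 0 = j) (hN : ∀ u, Frame 10 a t u → N.eval u = r)
    (y : ℕ → ℂ) (hz : ∀ k < r, ∀ u, Frame 10 a t u → u.nat 10 0 0 = k → z.eval E u = y k) :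
    WritesCell E (sumInto a N z) a i j (∑ k ∈ Finset.range r, y k)
      (10 + N.cost + r * (z.cost + 17)) t := by
  have hF0 : Frame 10 a t ((t.setVal a i j 0).addTime 9) :=
    ((Frame.refl 10 a t).setVal _ _ _).addTime _
  have h1 : (Cmd.setVal (here a) (.lit 0)).exec E t =
      PMF.pure ((t.setVal a i j 0).addTime 9) := by
    simp [Cmd.exec, here, Loc.putVal, hi, hj, ZExp.eval, Loc.cost, ZExp.cost]
  obtain ⟨t', ht', hF, hT, hw⟩ := exec_loop_of_pure (E := E) (v := 10) (e := N)
    (c := .setVal (here a) (.add (.cell a (.reg 8) (.reg 9)) z))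
    (s := (t.setVal a i j 0).addTime 9) (N := r)
    (I := fun k u => Frame 10 a t u ∧ u.time ≤ t.time + (10 + N.cost + k * (z.cost + 17)) ∧
      ∀ i' j', u.val a i' j' = if i' = i ∧ j' = j then ∑ k ∈ Finset.range k, y k
        else t.val a i' j') (hN _ hF0) (by
    rintro k hk u ⟨hF, hT, hw⟩
    have hF1 := (hF.setNat (x := 10) le_rfl 0 0 k).addTime 1
    have h8 : ((u.setNat 10 0 0 k).addTime 1).nat 8 0 0 = i := by
      rw [hF1.nat 8 (by norm_num), hi]
    have h9 : ((u.setNat 10 0 0 k).addTime 1).nat 9 0 0 = j := by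
      rw [hF1.nat 9 (by norm_num), hj]
    have hzk := hz k hk _ hF1 (by simp [State.setNat, State.addTime])
    refine ⟨_, rfl, ?_, ?_, ?_⟩
    · exact (hF1.setVal _ _ _).addTime _
    · simp only [State.addTime, Loc.putVal, State.setVal, here, Loc.cost, ZExp.cost,
        NExp.cost_reg, State.setNat]
      nlinarith
    · intro i' j'
      show (Loc.putVal (here a) _ _).val a i' j' = _
      rw [Loc.putVal]
      simp only [here, NExp.eval_reg, h8, h9, setVal_val_self, ZExp.eval, hzk]
      split_ifs with h
      · show u.val a i j + y k = _
        rw [hw, if_pos ⟨rfl, rfl⟩, Finset.sum_range_succ]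
      · show u.val a i' j' = _
        rw [hw, if_neg h])
    ⟨hF0.addTime _, by simp [State.addTime, State.setVal]; omega, fun i' j' => by
      simp [State.addTime, setVal_val_self]⟩
  refine ⟨t', ?_, hF, hT, hw⟩
  rw [sumInto, exec_seq_of_pure h1, ht']

/-! ### Keeping track of the arrays computed so far -/

/-- `t` has the indices of `s` in the arrays before `8`, and holds the tables in `L`
(array, height, width, contents). -/
structure Known (s : State) (L : List (ℕ × ℕ × ℕ × (ℕ → ℕ → ℂ))) (t : State) : Prop where
  nat : ∀ x < 8, t.nat x = s.nat x
  samples : t.samples = s.samples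
  table : ∀ e ∈ L, ∀ i < e.2.1, ∀ j < e.2.2.1, t.val e.1 i j = e.2.2.2 i j

theorem Known.get {s t : State} {L : List (ℕ × ℕ × ℕ × (ℕ → ℕ → ℂ))} (h : Known s L t)
    {a p q : ℕ} {w : ℕ → ℕ → ℂ} (he : (a, p, q, w) ∈ L) {i j : ℕ} (hi : i < p) (hj : j < q) :
    t.val a i j = w i j := h.table _ he i hi j hj

theorem Known.frame {s t u : State} {L : List (ℕ × ℕ × ℕ × (ℕ → ℕ → ℂ))} (h : Known s L t)
    {v a : ℕ} (hv : 8 ≤ v) (ha : ∀ e ∈ L, e.1 ≠ a) (hF : Frame v a t u) : Known s L u where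
  nat x hx := (hF.nat x (hx.trans_le hv)).trans (h.nat x hx)
  samples := hF.samples.trans h.samples
  table e he i hi j hj := by rw [hF.val _ (ha e he)]; exact h.table e he i hi j hj

theorem Known.cons {s t : State} {L : List (ℕ × ℕ × ℕ × (ℕ → ℕ → ℂ))} (h : Known s L t)
    {a p q : ℕ} {w : ℕ → ℕ → ℂ} (hw : ∀ i < p, ∀ j < q, t.val a i j = w i j) :
    Known s ((a, p, q, w) :: L) t where
  nat := h.nat
  samples := h.samples
  table e he := by
    rcases List.mem_cons.1 he with rfl | he
    · exact hw
    · exact h.table e he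

theorem Known.fill {E : Env} {s t : State} {L : List (ℕ × ℕ × ℕ × (ℕ → ℕ → ℂ))}
    (h : Known s L t) {P Q : NExp} {c : Cmd} {a p q T : ℕ} (ha : ∀ e ∈ L, e.1 ≠ a)
    (w : ℕ → ℕ → ℂ) (hP : P.eval t = p) (hQ : ∀ u, Known s L u → Q.eval u = q)
    (hc : ∀ i < p, ∀ j < q, ∀ u, Known s L u → u.nat 8 0 0 = i → u.nat 9 0 0 = j →
      WritesCell E c a i j (w i j) T u) :
    ∃ t', (fill P Q c).exec E t = PMF.pure t' ∧ Known s ((a, p, q, w) :: L) t' ∧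
      t'.time ≤ t.time + (P.cost + 1 + p * (Q.cost + 2 + q * (T + 1))) := by
  obtain ⟨t', h1, h2, h3, h4⟩ := exec_fill (E := E) (s := t) (a := a) (T := T) w hP
    (fun u hu => hQ u (h.frame le_rfl ha hu))
    (fun i hi j hj u hu => hc i hi j hj u (h.frame le_rfl ha hu))
  exact ⟨t', h1, (h.frame le_rfl ha h2).cons h4, h3⟩

theorem fill_time_le {p q T c W : ℕ} (hp : p ≤ c) (hq : q ≤ c) (hc : 0 < c)
    (hT : c ^ 2 * (T + 10) ≤ W) {a b : ℕ} (ha : a ≤ 3) (hb : b ≤ 3) :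
    a + 1 + p * (b + 2 + q * (T + 1)) ≤ W := by
  have h1 : q * (T + 1) ≤ c * (T + 1) := Nat.mul_le_mul_right _ hq
  have h2 : p * (b + 2 + q * (T + 1)) ≤ c * (5 + c * (T + 1)) := Nat.mul_le_mul hp (by omega)
  have h3 : c ≤ c ^ 2 := Nat.le_self_pow (by norm_num) c
  have h4 : c * (5 + c * (T + 1)) = 5 * c + c ^ 2 * (T + 1) := by ring
  have h5 : c ^ 2 * (T + 10) = c ^ 2 * (T + 1) + 9 * c ^ 2 := by ring
  omega

theorem Known.fill_entry {E : Env} {s t : State} {L : List (ℕ × ℕ × ℕ × (ℕ → ℕ → ℂ))}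
    (h : Known s L t) (D : Src) {P Q ei ej : NExp} {a p q c op : ℕ} (ha : ∀ e ∈ L, e.1 ≠ a)
    (w : ℕ → ℕ → ℂ) (hP : P.eval t = p) (hQ : ∀ u, Known s L u → Q.eval u = q)
    (hw : ∀ i < p, ∀ j < q, ∀ u, Known s L u → u.nat 8 0 0 = i → u.nat 9 0 0 = j →
      (E.get D).entry (ei.eval u) (ej.eval u) = w i j)
    (hp : p ≤ c) (hq : q ≤ c) (hc : 0 < c) (hPc : P.cost ≤ 3) (hQc : Q.cost ≤ 3)
    (hei : ei.cost ≤ 5) (hej : ej.cost ≤ 5) (hop : (E.get D).opCost ≤ op) (hop0 : 0 < op) :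
    ∃ t', (SVT.fill P Q (.entry D (here a) ei ej)).exec E t = PMF.pure t' ∧
      Known s ((a, p, q, w) :: L) t' ∧ t'.time ≤ t.time + 200 * (c ^ 3 * op) := by
  obtain ⟨t', h1, h2, h3⟩ := h.fill (E := E) (T := 17 + op) ha w hP hQ
    (c := .entry D (here a) ei ej) (fun i hi j hj u hu hi' hj' => by
      obtain ⟨u', h1, h2, h3, h4⟩ := writesCell_entry (E := E) D a ei ej hi' hj'
      rw [hw i hi j hj u hu hi' hj'] at h4
      exact ⟨u', h1, h2, by omega, h4⟩)
  refine ⟨t', h1, h2, h3.trans (Nat.add_le_add_left (fill_time_le hp hq hc ?_ hPc hQc) _)⟩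
  have : c ^ 2 ≤ c ^ 3 := Nat.pow_le_pow_right hc (by norm_num)
  calc c ^ 2 * (17 + op + 10) ≤ c ^ 3 * (200 * op) := Nat.mul_le_mul this (by omega)
    _ = _ := by ring

theorem Known.fill_rowNorm {E : Env} {s t : State} {L : List (ℕ × ℕ × ℕ × (ℕ → ℕ → ℂ))}
    (h : Known s L t) (D : Src) {P Q ei : NExp} {a p q c op : ℕ} (ha : ∀ e ∈ L, e.1 ≠ a)
    (w : ℕ → ℕ → ℂ) (hP : P.eval t = p) (hQ : ∀ u, Known s L u → Q.eval u = q)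
    (hw : ∀ i < p, ∀ j < q, ∀ u, Known s L u → u.nat 8 0 0 = i → u.nat 9 0 0 = j →
      ((E.get D).rowNorm (ei.eval u) : ℂ) = w i j)
    (hp : p ≤ c) (hq : q ≤ c) (hc : 0 < c) (hPc : P.cost ≤ 3) (hQc : Q.cost ≤ 3)
    (hei : ei.cost ≤ 5) (hop : (E.get D).rowNormCost ≤ op) (hop0 : 0 < op) :
    ∃ t', (SVT.fill P Q (.rowNorm D (here a) ei)).exec E t = PMF.pure t' ∧
      Known s ((a, p, q, w) :: L) t' ∧ t'.time ≤ t.time + 200 * (c ^ 3 * op) := by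
  obtain ⟨t', h1, h2, h3⟩ := h.fill (E := E) (T := 12 + op) ha w hP hQ
    (c := .rowNorm D (here a) ei) (fun i hi j hj u hu hi' hj' => by
      obtain ⟨u', h1, h2, h3, h4⟩ := writesCell_rowNorm (E := E) D a ei hi' hj'
      rw [hw i hi j hj u hu hi' hj'] at h4
      exact ⟨u', h1, h2, by omega, h4⟩)
  refine ⟨t', h1, h2, h3.trans (Nat.add_le_add_left (fill_time_le hp hq hc ?_ hPc hQc) _)⟩
  have : c ^ 2 ≤ c ^ 3 := Nat.pow_le_pow_right hc (by norm_num)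
  calc c ^ 2 * (12 + op + 10) ≤ c ^ 3 * (200 * op) := Nat.mul_le_mul this (by omega)
    _ = _ := by ring

theorem Known.fill_sum {E : Env} {s t : State} {L : List (ℕ × ℕ × ℕ × (ℕ → ℕ → ℂ))}
    (h : Known s L t) {P Q N : NExp} {z : ZExp} {a p q r c op : ℕ} (ha : ∀ e ∈ L, e.1 ≠ a)
    (y : ℕ → ℕ → ℕ → ℂ) {w : ℕ → ℕ → ℂ}
    (hw : ∀ i j, ∑ k ∈ Finset.range r, y i j k = w i j) (hP : P.eval t = p) (hQ : ∀ u, Known s L u → Q.eval u = q)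
    (hN : ∀ u, Known s L u → N.eval u = r)
    (hy : ∀ i < p, ∀ j < q, ∀ k < r, ∀ u, Known s L u → u.nat 8 0 0 = i → u.nat 9 0 0 = j →
      u.nat 10 0 0 = k → z.eval E u = y i j k)
    (hp : p ≤ c) (hq : q ≤ c) (hr : r ≤ c) (hc : 0 < c) (hPc : P.cost ≤ 3) (hQc : Q.cost ≤ 3)
    (hNc : N.cost ≤ 3) (hz : z.cost ≤ 100) (hop0 : 0 < op) :
    ∃ t', (SVT.fill P Q (sumInto a N z)).exec E t = PMF.pure t' ∧
      Known s ((a, p, q, w) :: L) t' ∧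
      t'.time ≤ t.time + 200 * (c ^ 3 * op) := by
  obtain ⟨t', h1, h2, h3⟩ := h.fill (E := E) (T := 13 + c * 117) ha w hP hQ
    (c := sumInto a N z) (fun i hi j hj u hu hi' hj' => by
      obtain ⟨u', h1, h2, h3, h4⟩ := writesCell_sumInto (E := E) (a := a) (N := N) (z := z) hi' hj'
        (fun v hv => hN v (hu.frame (by norm_num) ha hv)) (y i j)
        (fun k hk v hv hk' => hy i hi j hj k hk v (hu.frame (by norm_num) ha hv)
          (by rw [hv.nat 8 (by norm_num), hi']) (by rw [hv.nat 9 (by norm_num), hj']) hk')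
      rw [hw] at h4
      refine ⟨u', h1, h2, h3.trans ?_, h4⟩
      have : r * (z.cost + 17) ≤ c * 117 := Nat.mul_le_mul hr (by omega)
      omega)
  refine ⟨t', h1, h2, h3.trans (Nat.add_le_add_left (fill_time_le hp hq hc ?_ hPc hQc) _)⟩
  calc c ^ 2 * (13 + c * 117 + 10) ≤ c ^ 2 * (c * 200) := Nat.mul_le_mul_left _ (by omega)
    _ = 200 * (c ^ 3 * 1) := by ring
    _ ≤ _ := by gcongr; omega

/-- The matrix in the upper left corner of a table. -/
def corner (p q : ℕ) (w : ℕ → ℕ → ℂ) : Matrix (Fin p) (Fin q) ℂ := Matrix.of fun i j => w i j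

/-- A matrix as a table. -/
def ofMatrix {p q : ℕ} (M : Matrix (Fin p) (Fin q) ℂ) (i j : ℕ) : ℂ :=
  if h : i < p ∧ j < q then M ⟨i, h.1⟩ ⟨j, h.2⟩ else 0

theorem ofMatrix_apply {p q : ℕ} (M : Matrix (Fin p) (Fin q) ℂ) (i : Fin p) (j : Fin q) :
    ofMatrix M i j = M i j := by
  simp [ofMatrix]

/-- The state after a singular value decomposition. -/
def svdState (s : State) (x u d v p q : ℕ) : State :=
  ((s.setBlock u (SVT.svd (s.block x p q)).1).setBlock d
    (Matrix.of fun (i : Fin (min p q)) (_ : Fin 1) =>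
      (singularValue (s.block x p q) i : ℂ))).setBlock v (SVT.svd (s.block x p q)).2

theorem exec_svd {E : Env} {s : State} {x u d v p q : ℕ} {P Q : NExp} (hP : P.eval s = p)
    (hQ : Q.eval s = q) : (Cmd.svd x u d v P Q).exec E s =
      PMF.pure ((svdState s x u d v p q).addTime (P.cost + Q.cost + (p + q) ^ 3 + 1)) := by
  subst hP hQ; rfl

theorem Known.svd {E : Env} {s t : State} {L : List (ℕ × ℕ × ℕ × (ℕ → ℕ → ℂ))}
    (h : Known s L t) {P : NExp} {x u d v c op : ℕ} {w : ℕ → ℕ → ℂ} (hx : (x, c, c, w) ∈ L)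
    (hu : ∀ e ∈ L, e.1 ≠ u) (hd : ∀ e ∈ L, e.1 ≠ d) (hv : ∀ e ∈ L, e.1 ≠ v) (hud : u ≠ d)
    (huv : u ≠ v) (hdv : d ≠ v) (hP : P.eval t = c) (hPc : P.cost ≤ 3) (hc : 0 < c)
    (hop0 : 0 < op) :
    ∃ t', (Cmd.svd x u d v P P).exec E t = PMF.pure t' ∧
      Known s ((d, c, 1, fun k _ => (singularValue (corner c c w) k : ℂ)) ::
        (u, c, c, ofMatrix (SVT.svd (corner c c w)).1) :: L) t' ∧
      t'.time ≤ t.time + 200 * (c ^ 3 * op) := by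
  have hb : t.block x c c = corner c c w := by
    ext i j; exact h.get hx i.2 j.2
  refine ⟨_, exec_svd hP hP, ?_, ?_⟩
  · have h0 : Known s L ((svdState t x u d v c c).addTime (P.cost + P.cost + (c + c) ^ 3 + 1)) := by
      refine ⟨h.nat, h.samples, fun e he i hi j hj => ?_⟩
      simp only [State.addTime, svdState, State.setBlock, hu e he, hd e he, hv e he, false_and,
        dite_false]
      exact h.table e he i hi j hj
    refine (h0.cons fun i hi j hj => ?_).cons fun i hi j hj => ?_
    · simp [State.addTime, svdState, State.setBlock, hud, huv, hi, hj, ofMatrix, hb]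
    · have : j = 0 := by omega
      subst this
      simp [State.addTime, svdState, State.setBlock, hdv, hi, hb]
  · show t.time + _ ≤ _
    have : (c + c) ^ 3 = 8 * c ^ 3 := by ring
    have h1 : 1 ≤ c ^ 3 := Nat.one_le_pow _ _ hc
    have h2 : c ^ 3 * 1 ≤ c ^ 3 * op := Nat.mul_le_mul_left _ hop0
    omega

/-! ### The deterministic part of the algorithm -/

/-- The factor `‖A‖_F / √c`. -/
def sketchScale (Fsq : ℝ) (c : ℕ) : ℂ := (√Fsq : ℂ) * (√c : ℂ)⁻¹

/-- The sketch `R`: the rows of `A` with the indices `I`, rescaled. -/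
def sketch (A : Stored) (Fsq : ℝ) (c : ℕ) (I : ℕ → ℕ) (s j : ℕ) : ℂ :=
  sketchScale Fsq c * (A.entry (I s) j * (A.rowNorm (I s) : ℂ)⁻¹)

/-- The data the deterministic part works on: the number of samples, the squared Frobenius norm,
the stored objects, the function, the index, and the sampled indices. -/
structure Draws where
  c : ℕ
  Fsq : ℝ
  A : Stored
  b : Stored
  f : ℝ≥0 → ℝ≥0
  i : ℕ
  rowIdx : ℕ → ℕ
  colIdx : ℕ → ℕ
  rowIdx' : ℕ → ℕ
  colIdx' : ℕ → ℕ

namespace Draws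

variable (d : Draws)

def scale : ℂ := sketchScale d.Fsq d.c

def R : ℕ → ℕ → ℂ := sketch d.A d.Fsq d.c d.rowIdx

def colSq (j : ℕ) : ℂ := ∑ k ∈ Finset.range d.c, star (d.R k j) * d.R k j

/-- The sketch `C`: sampled and rescaled columns of `R`. -/
def C (s t : ℕ) : ℂ :=
  d.R s (d.colIdx t) * (d.scale * (√(d.colSq (d.colIdx t)).re : ℂ)⁻¹)

def Cmat : Matrix (Fin d.c) (Fin d.c) ℂ := corner d.c d.c d.C

def U (s k : ℕ) : ℂ := ofMatrix (SVT.svd d.Cmat).1 s k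

def sv (k : ℕ) : ℂ := (singularValue d.Cmat k : ℂ)

def coeff (k : ℕ) : ℂ :=
  ∑ s ∈ Finset.range d.c, star (d.R s d.i) * d.U s k

def weight (s : ℕ) : ℂ :=
  ∑ k ∈ Finset.range d.c, d.coeff k *
    (((realExt d.f (d.sv k).re : ℝ) : ℂ) * ((d.sv k)⁻¹ * ((d.sv k)⁻¹ * (d.sv k)⁻¹))) *
      star (d.U s k)

def z (j : ℕ) : ℂ := ∑ s ∈ Finset.range d.c, d.weight s * d.R s j

def term (t : ℕ) : ℂ :=
  (d.Fsq : ℂ) * d.z (d.colIdx' t) * (d.b.entry (d.rowIdx' t) 0 *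
    (d.A.entry (d.rowIdx' t) (d.colIdx' t))⁻¹)

def estimate : ℂ := ∑ t ∈ Finset.range d.c, d.term t * (d.c : ℂ)⁻¹

end Draws

/-- The data found in a state. -/
def drawsOf (E : Env) (Fsq : ℝ) (s : State) : Draws where
  c := s.nat 1 0 0
  Fsq := Fsq
  A := E.A
  b := E.b
  f := E.f
  i := s.nat 0 0 0
  rowIdx t := s.nat 3 t 0
  colIdx t := s.nat 5 t 0
  rowIdx' t := s.nat 6 t 0
  colIdx' t := s.nat 7 t 0

def loadRowNorms : Cmd :=
  fill (.reg 1) (.lit 1) (.rowNorm .A (here 2) (.cell 3 (.reg 8) (.lit 0)))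

def loadSketch : Cmd :=
  fill (.reg 1) (.reg 1)
    (.entry .A (here 3) (.cell 3 (.reg 8) (.lit 0)) (.cell 5 (.reg 9) (.lit 0)))

def loadSketch' : Cmd :=
  fill (.reg 1) (.reg 1)
    (.entry .A (here 4) (.cell 3 (.reg 8) (.lit 0)) (.cell 7 (.reg 9) (.lit 0)))

def loadColumn : Cmd :=
  fill (.reg 1) (.lit 1) (.entry .A (here 5) (.cell 3 (.reg 8) (.lit 0)) (.reg 0))

def loadVector : Cmd :=
  fill (.reg 1) (.lit 1) (.entry .b (here 6) (.cell 6 (.reg 8) (.lit 0)) (.lit 0))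

def loadEntries : Cmd :=
  fill (.reg 1) (.lit 1)
    (.entry .A (here 7) (.cell 6 (.reg 8) (.lit 0)) (.cell 7 (.reg 8) (.lit 0)))

def scaleExp : ZExp := .mul (.sqrt (.cell 1 (.lit 0) (.lit 0))) (.inv (.sqrt (.ofNat (.reg 1))))

def rescaleExp (a : ℕ) : ZExp :=
  .mul scaleExp (.mul (.cell a (.reg 8) (.reg 9)) (.inv (.cell 2 (.reg 8) (.lit 0))))

def rescaleSketch : Cmd := fill (.reg 1) (.reg 1) (sumInto 8 (.lit 1) (rescaleExp 3))

def rescaleSketch' : Cmd := fill (.reg 1) (.reg 1) (sumInto 9 (.lit 1) (rescaleExp 4))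

def rescaleColumn : Cmd := fill (.reg 1) (.lit 1) (sumInto 10 (.lit 1) (rescaleExp 5))

def computeColSq : Cmd :=
  fill (.reg 1) (.lit 1) (sumInto 11 (.reg 1)
    (.mul (.conj (.cell 8 (.reg 10) (.reg 8))) (.cell 8 (.reg 10) (.reg 8))))

def computeC : Cmd :=
  fill (.reg 1) (.reg 1) (sumInto 12 (.lit 1)
    (.mul (.cell 8 (.reg 8) (.reg 9))
      (.mul scaleExp (.inv (.sqrt (.cell 11 (.reg 9) (.lit 0)))))))

def computeSVD : Cmd := .svd 12 13 14 15 (.reg 1) (.reg 1)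

def computeCoeff : Cmd :=
  fill (.reg 1) (.lit 1) (sumInto 16 (.reg 1)
    (.mul (.conj (.cell 10 (.reg 10) (.lit 0))) (.cell 13 (.reg 10) (.reg 8))))

def svExp : ZExp := .cell 14 (.reg 10) (.lit 0)

def computeWeight : Cmd :=
  fill (.reg 1) (.lit 1) (sumInto 17 (.reg 1)
    (.mul (.mul (.cell 16 (.reg 10) (.lit 0))
      (.mul (.app svExp) (.mul (.inv svExp) (.mul (.inv svExp) (.inv svExp)))))
        (.conj (.cell 13 (.reg 8) (.reg 10)))))

def computeZ : Cmd :=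
  fill (.reg 1) (.lit 1) (sumInto 18 (.reg 1)
    (.mul (.cell 17 (.reg 10) (.lit 0)) (.cell 9 (.reg 10) (.reg 8))))

def computeOutput : Cmd :=
  fill (.lit 1) (.lit 1) (sumInto 0 (.reg 1)
    (.mul (.mul (.mul (.cell 1 (.lit 0) (.lit 0)) (.cell 18 (.reg 10) (.lit 0)))
      (.mul (.cell 6 (.reg 10) (.lit 0)) (.inv (.cell 7 (.reg 10) (.lit 0)))))
        (.inv (.ofNat (.reg 1)))))

def postprocess : Cmd :=
  .seq loadRowNorms <| .seq loadSketch <| .seq loadSketch' <| .seq loadColumn <|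
  .seq loadVector <| .seq loadEntries <| .seq rescaleSketch <| .seq rescaleSketch' <|
  .seq rescaleColumn <| .seq computeColSq <| .seq computeC <| .seq computeSVD <|
  .seq computeCoeff <| .seq computeWeight <| .seq computeZ computeOutput

theorem eval_scaleExp {E : Env} {s u : State} {Fsq : ℝ} (h1 : u.nat 1 = s.nat 1)
    (h2 : u.val 1 0 0 = (Fsq : ℂ)) : scaleExp.eval E u = (drawsOf E Fsq s).scale := by
  simp [scaleExp, ZExp.eval, NExp.eval, h1, h2, Draws.scale, sketchScale, drawsOf]

set_option maxHeartbeats 2000000 in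
theorem exec_postprocess {E : Env} {s : State} {Fsq : ℝ} (hF : s.val 1 0 0 = (Fsq : ℂ))
    (hc : 0 < s.nat 1 0 0) {op : ℕ} (hop : 0 < op) (hA : E.A.opCost ≤ op) (hb : E.b.opCost ≤ op)
    (hAr : E.A.rowNormCost ≤ op) :
    ∃ t, postprocess.exec E s = PMF.pure t ∧ t.samples = s.samples ∧
      t.time ≤ s.time + 3200 * (s.nat 1 0 0 ^ 3 * op) ∧
      t.output = (drawsOf E Fsq s).estimate := by
  set d := drawsOf E Fsq s with hd
  have hdc : s.nat 1 0 0 = d.c := rfl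
  have hdi : s.nat 0 0 0 = d.i := rfl
  have hd3 : ∀ t, s.nat 3 t 0 = d.rowIdx t := fun _ => rfl
  have hd5 : ∀ t, s.nat 5 t 0 = d.colIdx t := fun _ => rfl
  have hd6 : ∀ t, s.nat 6 t 0 = d.rowIdx' t := fun _ => rfl
  have hd7 : ∀ t, s.nat 7 t 0 = d.colIdx' t := fun _ => rfl
  rw [hdc] at hc ⊢
  have eA : E.A = d.A := rfl
  have eb : E.b = d.b := rfl
  have k0 : Known s [(1, 1, 1, fun _ _ => (d.Fsq : ℂ))] s := by
    refine ⟨fun _ _ => rfl, rfl, fun e he i hi j hj => ?_⟩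
    rw [List.mem_singleton] at he
    subst he
    have hi : i = 0 := by simpa using hi
    have hj : j = 0 := by simpa using hj
    rw [hi, hj]; exact hF
  have hreg : ∀ L u, Known s L u → (NExp.reg 1).eval u = d.c := fun L u hu => by
    rw [NExp.eval_reg, hu.nat 1 (by norm_num), hdc]
  obtain ⟨t1, h1, k1, l1⟩ := k0.fill_rowNorm (E := E) .A (P := .reg 1) (Q := .lit 1) (a := 2)
    (ei := .cell 3 (.reg 8) (.lit 0)) (by simp) (fun s _ => (d.A.rowNorm (d.rowIdx s) : ℂ))
    (hreg _ _ k0) (fun _ _ => rfl) (fun i hi j hj u hu hi' hj' => by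
      simp [Env.get, NExp.eval, hi', hu.nat, hd3, eA])
    le_rfl hc hc (by simp) (by simp [NExp.cost]) (by simp [NExp.cost]) hAr hop
  obtain ⟨t2, h2, k2, l2⟩ := k1.fill_entry (E := E) .A (P := .reg 1) (Q := .reg 1) (a := 3)
    (ei := .cell 3 (.reg 8) (.lit 0)) (ej := .cell 5 (.reg 9) (.lit 0)) (by simp)
    (fun s t => d.A.entry (d.rowIdx s) (d.colIdx t))
    (hreg _ _ k1) (hreg _) (fun i hi j hj u hu hi' hj' => by
      simp [Env.get, NExp.eval, hi', hj', hu.nat, hd3, hd5, eA])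
    le_rfl le_rfl hc (by simp) (by simp) (by simp [NExp.cost]) (by simp [NExp.cost]) hA hop
  obtain ⟨t3, h3, k3, l3⟩ := k2.fill_entry (E := E) .A (P := .reg 1) (Q := .reg 1) (a := 4)
    (ei := .cell 3 (.reg 8) (.lit 0)) (ej := .cell 7 (.reg 9) (.lit 0)) (by simp)
    (fun s t => d.A.entry (d.rowIdx s) (d.colIdx' t))
    (hreg _ _ k2) (hreg _) (fun i hi j hj u hu hi' hj' => by
      simp [Env.get, NExp.eval, hi', hj', hu.nat, hd3, hd7, eA])
    le_rfl le_rfl hc (by simp) (by simp) (by simp [NExp.cost]) (by simp [NExp.cost]) hA hop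
  obtain ⟨t4, h4, k4, l4⟩ := k3.fill_entry (E := E) .A (P := .reg 1) (Q := .lit 1) (a := 5)
    (ei := .cell 3 (.reg 8) (.lit 0)) (ej := .reg 0) (by simp)
    (fun s _ => d.A.entry (d.rowIdx s) d.i)
    (hreg _ _ k3) (fun _ _ => rfl) (fun i hi j hj u hu hi' hj' => by
      simp [Env.get, NExp.eval, hi', hu.nat, hd3, hdi, eA])
    le_rfl hc hc (by simp) (by simp [NExp.cost]) (by simp [NExp.cost]) (by simp) hA hop
  obtain ⟨t5, h5, k5, l5⟩ := k4.fill_entry (E := E) .b (P := .reg 1) (Q := .lit 1) (a := 6)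
    (ei := .cell 6 (.reg 8) (.lit 0)) (ej := .lit 0) (by simp)
    (fun t _ => d.b.entry (d.rowIdx' t) 0)
    (hreg _ _ k4) (fun _ _ => rfl) (fun i hi j hj u hu hi' hj' => by
      simp [Env.get, NExp.eval, hi', hu.nat, hd6, eb])
    le_rfl hc hc (by simp) (by simp [NExp.cost]) (by simp [NExp.cost]) (by simp [NExp.cost]) hb hop
  obtain ⟨t6, h6, k6, l6⟩ := k5.fill_entry (E := E) .A (P := .reg 1) (Q := .lit 1) (a := 7)
    (ei := .cell 6 (.reg 8) (.lit 0)) (ej := .cell 7 (.reg 8) (.lit 0)) (by simp)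
    (fun t _ => d.A.entry (d.rowIdx' t) (d.colIdx' t))
    (hreg _ _ k5) (fun _ _ => rfl) (fun i hi j hj u hu hi' hj' => by
      simp [Env.get, NExp.eval, hi', hu.nat, hd6, hd7, eA])
    le_rfl hc hc (by simp) (by simp [NExp.cost]) (by simp [NExp.cost]) (by simp [NExp.cost]) hA hop
  have hscale : ∀ L u, Known s L u → (1, 1, 1, fun _ _ => (d.Fsq : ℂ)) ∈ L →
      scaleExp.eval E u = d.scale := fun L u hu hm =>
    eval_scaleExp (hu.nat 1 (by norm_num)) (hu.get hm Nat.one_pos Nat.one_pos)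
  obtain ⟨t7, h7, k7, l7⟩ := k6.fill_sum (E := E) (P := .reg 1) (Q := .reg 1) (N := .lit 1)
    (z := rescaleExp 3) (a := 8) (by simp) (r := 1)
    (fun s t _ => d.R s (d.colIdx t)) (w := fun s t => d.R s (d.colIdx t)) (by simp)
    (hreg _ _ k6) (hreg _) (fun _ _ => rfl) (fun i hi j hj k hk u hu hi' hj' hk' => by
      rw [rescaleExp, ZExp.eval, hscale _ _ hu (by simp)]
      simp [ZExp.eval, NExp.eval, hi', hj', Draws.R, sketch, Draws.scale,
        hu.get (a := 3) (w := fun s t => d.A.entry (d.rowIdx s) (d.colIdx t)) (by simp) hi hj,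
        hu.get (a := 2) (w := fun s _ => (d.A.rowNorm (d.rowIdx s) : ℂ)) (by simp) hi Nat.one_pos])
    le_rfl le_rfl hc hc (by simp) (by simp) (by simp [NExp.cost])
    (by simp [rescaleExp, scaleExp, ZExp.cost, NExp.cost]) hop
  obtain ⟨t8, h8, k8, l8⟩ := k7.fill_sum (E := E) (P := .reg 1) (Q := .reg 1) (N := .lit 1)
    (z := rescaleExp 4) (a := 9) (by simp) (r := 1)
    (fun s t _ => d.R s (d.colIdx' t)) (w := fun s t => d.R s (d.colIdx' t)) (by simp)
    (hreg _ _ k7) (hreg _) (fun _ _ => rfl) (fun i hi j hj k hk u hu hi' hj' hk' => by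
      rw [rescaleExp, ZExp.eval, hscale _ _ hu (by simp)]
      simp [ZExp.eval, NExp.eval, hi', hj', Draws.R, sketch, Draws.scale,
        hu.get (a := 4) (w := fun s t => d.A.entry (d.rowIdx s) (d.colIdx' t)) (by simp) hi hj,
        hu.get (a := 2) (w := fun s _ => (d.A.rowNorm (d.rowIdx s) : ℂ)) (by simp) hi Nat.one_pos])
    le_rfl le_rfl hc hc (by simp) (by simp) (by simp [NExp.cost])
    (by simp [rescaleExp, scaleExp, ZExp.cost, NExp.cost]) hop
  obtain ⟨t9, h9, k9, l9⟩ := k8.fill_sum (E := E) (P := .reg 1) (Q := .lit 1) (N := .lit 1)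
    (z := rescaleExp 5) (a := 10) (by simp) (r := 1)
    (fun s _ _ => d.R s d.i) (w := fun s _ => d.R s d.i) (by simp)
    (hreg _ _ k8) (fun _ _ => rfl) (fun _ _ => rfl) (fun i hi j hj k hk u hu hi' hj' hk' => by
      rw [rescaleExp, ZExp.eval, hscale _ _ hu (by simp)]
      simp [ZExp.eval, NExp.eval, hi', hj', Draws.R, sketch, Draws.scale,
        hu.get (a := 5) (w := fun s _ => d.A.entry (d.rowIdx s) d.i) (by simp) hi hj,
        hu.get (a := 2) (w := fun s _ => (d.A.rowNorm (d.rowIdx s) : ℂ)) (by simp) hi Nat.one_pos])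
    le_rfl hc hc hc (by simp) (by simp [NExp.cost]) (by simp [NExp.cost])
    (by simp [rescaleExp, scaleExp, ZExp.cost, NExp.cost]) hop
  obtain ⟨t10, h10, k10, l10⟩ := k9.fill_sum (E := E) (P := .reg 1) (Q := .lit 1) (N := .reg 1)
    (z := .mul (.conj (.cell 8 (.reg 10) (.reg 8))) (.cell 8 (.reg 10) (.reg 8)))
    (a := 11) (by simp)
    (fun t _ k => star (d.R k (d.colIdx t)) * d.R k (d.colIdx t))
    (w := fun t _ => d.colSq (d.colIdx t)) (fun _ _ => rfl)
    (hreg _ _ k9) (fun _ _ => rfl) (hreg _) (fun i hi j hj k hk u hu hi' hj' hk' => by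
      simp [ZExp.eval, hi', hk',
        hu.get (a := 8) (w := fun s t => d.R s (d.colIdx t)) (by simp) hk hi])
    le_rfl hc le_rfl hc (by simp) (by simp [NExp.cost]) (by simp)
    (by simp [ZExp.cost]) hop
  obtain ⟨t11, h11, k11, l11⟩ := k10.fill_sum (E := E) (P := .reg 1) (Q := .reg 1) (N := .lit 1)
    (z := .mul (.cell 8 (.reg 8) (.reg 9))
      (.mul scaleExp (.inv (.sqrt (.cell 11 (.reg 9) (.lit 0))))))
    (a := 12) (by simp) (r := 1) (fun s t _ => d.C s t) (w := d.C) (by simp)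
    (hreg _ _ k10) (hreg _) (fun _ _ => rfl) (fun i hi j hj k hk u hu hi' hj' hk' => by
      have := hscale _ _ hu (by simp)
      simp [ZExp.eval, NExp.eval, hi', hj', Draws.C, this,
        hu.get (a := 8) (w := fun s t => d.R s (d.colIdx t)) (by simp) hi hj,
        hu.get (a := 11) (w := fun t _ => d.colSq (d.colIdx t)) (by simp) hj Nat.one_pos])
    le_rfl le_rfl hc hc (by simp) (by simp) (by simp [NExp.cost])
    (by simp [scaleExp, ZExp.cost, NExp.cost]) hop
  obtain ⟨t12, h12, k12, l12⟩ := k11.svd (E := E) (P := .reg 1) (x := 12) (u := 13) (d := 14)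
    (v := 15) (c := d.c) (w := d.C) (op := op) (by simp) (by simp) (by simp) (by simp)
    (by norm_num) (by norm_num) (by norm_num) (hreg _ _ k11) (by simp) hc hop
  obtain ⟨t13, h13, k13, l13⟩ := k12.fill_sum (E := E) (P := .reg 1) (Q := .lit 1) (N := .reg 1)
    (z := .mul (.conj (.cell 10 (.reg 10) (.lit 0))) (.cell 13 (.reg 10) (.reg 8)))
    (a := 16) (by simp)
    (fun k _ s => star (d.R s d.i) * d.U s k)
    (w := fun k _ => d.coeff k) (fun _ _ => rfl)
    (hreg _ _ k12) (fun _ _ => rfl) (hreg _) (fun i hi j hj k hk u hu hi' hj' hk' => by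
      simp [ZExp.eval, NExp.eval, hi', hk', Draws.U, Draws.Cmat,
        hu.get (a := 10) (w := fun s _ => d.R s d.i) (by simp) hk Nat.one_pos,
        hu.get (a := 13) (w := ofMatrix (SVT.svd (corner d.c d.c d.C)).1) (by simp) hk hi])
    le_rfl hc le_rfl hc (by simp) (by simp [NExp.cost]) (by simp)
    (by simp [ZExp.cost, NExp.cost]) hop
  obtain ⟨t14, h14, k14, l14⟩ := k13.fill_sum (E := E) (P := .reg 1) (Q := .lit 1) (N := .reg 1)
    (z := .mul (.mul (.cell 16 (.reg 10) (.lit 0))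
      (.mul (.app svExp) (.mul (.inv svExp) (.mul (.inv svExp) (.inv svExp)))))
        (.conj (.cell 13 (.reg 8) (.reg 10))))
    (a := 17) (by simp)
    (fun s _ k => d.coeff k *
      (((realExt d.f (d.sv k).re : ℝ) : ℂ) * ((d.sv k)⁻¹ * ((d.sv k)⁻¹ * (d.sv k)⁻¹))) *
        star (d.U s k))
    (w := fun s _ => d.weight s) (fun _ _ => rfl)
    (hreg _ _ k13) (fun _ _ => rfl) (hreg _) (fun i hi j hj k hk u hu hi' hj' hk' => by
      have hf : E.f = d.f := rfl
      simp only [ZExp.eval, NExp.eval, hi', hk', Draws.U, Draws.Cmat, svExp, Draws.sv,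
        NExp.eval_reg, hf,
        hu.get (a := 16) (w := fun k _ => d.coeff k) (by simp) hk Nat.one_pos,
        hu.get (a := 14) (w := fun k _ => (singularValue (corner d.c d.c d.C) k : ℂ))
          (by simp) hk Nat.one_pos,
        hu.get (a := 13) (w := ofMatrix (SVT.svd (corner d.c d.c d.C)).1) (by simp) hi hk])
    le_rfl hc le_rfl hc (by simp) (by simp [NExp.cost]) (by simp)
    (by simp [ZExp.cost, NExp.cost, svExp]) hop
  obtain ⟨t15, h15, k15, l15⟩ := k14.fill_sum (E := E) (P := .reg 1) (Q := .lit 1) (N := .reg 1)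
    (z := .mul (.cell 17 (.reg 10) (.lit 0)) (.cell 9 (.reg 10) (.reg 8)))
    (a := 18) (by simp)
    (fun t _ s => d.weight s * d.R s (d.colIdx' t))
    (w := fun t _ => d.z (d.colIdx' t)) (fun _ _ => rfl)
    (hreg _ _ k14) (fun _ _ => rfl) (hreg _) (fun i hi j hj k hk u hu hi' hj' hk' => by
      simp [ZExp.eval, NExp.eval, hi', hk',
        hu.get (a := 17) (w := fun s _ => d.weight s) (by simp) hk Nat.one_pos,
        hu.get (a := 9) (w := fun s t => d.R s (d.colIdx' t)) (by simp) hk hi])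
    le_rfl hc le_rfl hc (by simp) (by simp [NExp.cost]) (by simp)
    (by simp [ZExp.cost, NExp.cost]) hop
  obtain ⟨t16, h16, k16, l16⟩ := k15.fill_sum (E := E) (P := .lit 1) (Q := .lit 1) (N := .reg 1)
    (z := .mul (.mul (.mul (.cell 1 (.lit 0) (.lit 0)) (.cell 18 (.reg 10) (.lit 0)))
      (.mul (.cell 6 (.reg 10) (.lit 0)) (.inv (.cell 7 (.reg 10) (.lit 0)))))
        (.inv (.ofNat (.reg 1))))
    (a := 0) (p := 1) (by simp) (fun _ _ t => d.term t * (d.c : ℂ)⁻¹)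
    (w := fun _ _ => d.estimate) (fun _ _ => rfl)
    rfl (fun _ _ => rfl) (hreg _) (fun i hi j hj k hk u hu hi' hj' hk' => by
      simp only [ZExp.eval, NExp.eval, hk', Draws.term, NExp.eval_reg, hu.nat 1 (by norm_num), hdc,
        hu.get (a := 1) (w := fun _ _ => (d.Fsq : ℂ)) (by simp) Nat.one_pos Nat.one_pos,
        hu.get (a := 18) (w := fun t _ => d.z (d.colIdx' t)) (by simp) hk Nat.one_pos,
        hu.get (a := 6) (w := fun t _ => d.b.entry (d.rowIdx' t) 0) (by simp) hk Nat.one_pos,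
        hu.get (a := 7) (w := fun t _ => d.A.entry (d.rowIdx' t) (d.colIdx' t)) (by simp) hk
          Nat.one_pos])
    hc hc le_rfl hc (by simp [NExp.cost]) (by simp [NExp.cost]) (by simp)
    (by simp [ZExp.cost, NExp.cost]) hop
  refine ⟨t16, ?_, k16.samples, by omega, k16.get (a := 0) (p := 1) (q := 1)
    (w := fun _ _ => d.estimate) (by simp) Nat.one_pos Nat.one_pos⟩
  exact (exec_seq_of_pure h1).trans <| (exec_seq_of_pure h2).trans <| (exec_seq_of_pure h3).trans <|
    (exec_seq_of_pure h4).trans <| (exec_seq_of_pure h5).trans <| (exec_seq_of_pure h6).trans <|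
    (exec_seq_of_pure h7).trans <| (exec_seq_of_pure h8).trans <| (exec_seq_of_pure h9).trans <|
    (exec_seq_of_pure h10).trans <| (exec_seq_of_pure h11).trans <| (exec_seq_of_pure h12).trans <|
    (exec_seq_of_pure h13).trans <| (exec_seq_of_pure h14).trans <| (exec_seq_of_pure h15).trans <|
    h16

/-! ### The sampling loops -/

theorem Stored.entry_fin {m n : ℕ} (A : Matrix (Fin m) (Fin n) ℂ) (i : Fin m) (j : Fin n) :
    (Stored.mk m n A).entry i j = A i j := by
  simp [Stored.entry]

theorem Stored.rowNorm_fin {m n : ℕ} (A : Matrix (Fin m) (Fin n) ℂ) (i : Fin m) :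
    (Stored.mk m n A).rowNorm i = vecNorm (A i) := by
  simp [Stored.rowNorm, SVT.rowNorm, vecNorm]

theorem Stored.exists_of_rowNorm_ne_zero {m n : ℕ} {A : Matrix (Fin m) (Fin n) ℂ} {i : ℕ}
    (h : (Stored.mk m n A).rowNorm i ≠ 0) : ∃ x : Fin m, i = x := by
  by_cases hi : i < m
  · exact ⟨⟨i, hi⟩, rfl⟩
  · simp [Stored.rowNorm, hi] at h

theorem vecNorm_rowNorm {m n : ℕ} (A : Matrix (Fin m) (Fin n) ℂ) :
    vecNorm (fun i => (rowNorm A i : ℂ)) = frobNorm A := by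
  rw [← sq_eq_sq₀ (vecNorm_nonneg _) (frobNorm_nonneg _), vecNorm_sq, frobNorm_sq_eq_rows]
  simp

theorem expect_sampleRow {m n : ℕ} {A : Matrix (Fin m) (Fin n) ℂ} (hA : frobNorm A ≠ 0)
    {F : ℕ → ℝ} (hF : ∀ i, 0 ≤ F i) :
    expect (Stored.mk m n A).sampleRow (fun i => ENNReal.ofReal (F i)) =
      ENNReal.ofReal (∑ i : Fin m, vecNorm (A i) ^ 2 / frobNorm A ^ 2 * F i) := by
  have h := expect_l2Sample (v := fun i => (rowNorm A i : ℂ)) (by rwa [vecNorm_rowNorm]) hF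
  rw [vecNorm_rowNorm] at h
  simpa [Stored.sampleRow, SVT.rowNorm, vecNorm] using h

theorem expect_sampleCol {m n : ℕ} {A : Matrix (Fin m) (Fin n) ℂ} {i : Fin m}
    (hA : vecNorm (A i) ≠ 0) {F : ℕ → ℝ} (hF : ∀ i, 0 ≤ F i) :
    expect ((Stored.mk m n A).sampleCol i) (fun i => ENNReal.ofReal (F i)) =
      ENNReal.ofReal (∑ j : Fin n, ‖A i j‖ ^ 2 / vecNorm (A i) ^ 2 * F j) := by
  simpa [Stored.sampleCol] using expect_l2Sample hA hF

theorem rowNorm_ne_zero_of_mem_support {m n : ℕ} {A : Matrix (Fin m) (Fin n) ℂ}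
    (hA : frobNorm A ≠ 0) {x : ℕ} (hx : x ∈ (Stored.mk m n A).sampleRow.support) :
    (Stored.mk m n A).rowNorm x ≠ 0 := by
  obtain ⟨i, rfl, h⟩ := mem_support_l2Sample (by rwa [vecNorm_rowNorm]) hx
  rw [Stored.rowNorm_fin]
  exact_mod_cast h

/-- `t` is obtained from `s` by drawing `k` samples into the arrays `W`, in time at most `T`. -/
structure Drawn (W : List ℕ) (k T : ℕ) (s t : State) : Prop where
  val : t.val = s.val
  nat : ∀ a, a ∉ W → t.nat a = s.nat a
  time : t.time ≤ s.time + T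
  samples : t.samples = s.samples + k

def drawRows : Cmd := .loop 2 (.reg 1) (.sampleRow .A ⟨3, .reg 2, .lit 0⟩)

def drawCols : Cmd :=
  .loop 2 (.reg 1) (.seq (.uniform ⟨4, .lit 0, .lit 0⟩ (.reg 1))
    (.sampleCol .A ⟨5, .reg 2, .lit 0⟩ (.cell 3 (.reg 4) (.lit 0))))

def drawEntries : Cmd :=
  .loop 2 (.reg 1) (.seq (.sampleRow .A ⟨6, .reg 2, .lit 0⟩)
    (.sampleCol .A ⟨7, .reg 2, .lit 0⟩ (.cell 6 (.reg 2) (.lit 0))))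

theorem ofReal_le_of_le_add {x y V : ℝ} (h : x ≤ y + V) (hy : 0 ≤ y) (hV : 0 ≤ V) :
    ENNReal.ofReal x ≤ ENNReal.ofReal y + ENNReal.ofReal V := by
  rw [← ENNReal.ofReal_add hy hV]; exact ENNReal.ofReal_le_ofReal h

theorem exec_drawRows {m n c : ℕ} {A : Matrix (Fin m) (Fin n) ℂ} (hA : frobNorm A ≠ 0) {E : Env}
    (hE : E.A = ⟨m, n, A⟩) {s : State} (hc : s.nat 1 0 0 = c) (hc0 : 0 < c) {δ : ℝ} (hδ : 0 < δ) :
    Yields (drawRows.exec E s)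
      (fun t => Drawn [2, 3] c (4 + c * (30 + 2 * E.A.opCost)) s t ∧
        ∀ k < c, E.A.rowNorm (t.nat 3 k 0) ≠ 0)
      (fun t => frobNorm (∑ k ∈ Finset.range c, (outer (frobNorm A ^ 2)
        (fun j : Fin n => star (E.A.entry (t.nat 3 k 0) j)) - Aᴴ * A)) ^ 2 ≤ c ^ 2 * δ)
      (ENNReal.ofReal ((frobNorm A ^ 2) ^ 2 / (c * δ))) := by
  have he : (NExp.reg 1).eval s = c := hc
  rw [drawRows, Cmd.exec, he]
  obtain ⟨h1, h2⟩ := sampling_loop (fun M : Matrix (Fin n) (Fin n) ℂ => frobNorm M ^ 2)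
    (by simp [frobNorm_sq]) (idx := fun t k => t.nat 3 k 0)
    (G := fun i => outer (frobNorm A ^ 2) (fun j : Fin n => star (E.A.entry i j)))
    (mean := Aᴴ * A) (V := (frobNorm A ^ 2) ^ 2) (δ := δ) (N := c)
    (body := fun k s' => (Cmd.sampleRow .A ⟨3, .reg 2, .lit 0⟩).exec E
      ((s'.setNat 2 0 0 k).addTime 1))
    (Inv := fun k t => Drawn [2, 3] k (4 + k * (30 + 2 * E.A.opCost)) s t ∧
      ∀ k' < k, E.A.rowNorm (t.nat 3 k' 0) ≠ 0) hc0 hδ (by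
    rintro k hk t ⟨hD, hr⟩ t' ht'
    rw [Cmd.exec, PMF.mem_support_map_iff] at ht'
    obtain ⟨x, hx, rfl⟩ := ht'
    have hx' : E.A.rowNorm x ≠ 0 := by
      rw [show E.get .A = E.A from rfl, hE] at hx
      rw [hE]; exact rowNorm_ne_zero_of_mem_support hA hx
    refine ⟨⟨⟨hD.val, fun a ha => ?_, ?_, ?_⟩, fun k' hk' => ?_⟩, fun k' hk' => ?_⟩
    · rw [← hD.nat a ha]
      ext i j
      simp only [List.mem_cons, List.not_mem_nil, or_false, not_or] at ha
      simp [State.addSample, State.addTime, Loc.putNat, State.setNat, ha]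
    · have := hD.time
      simp only [State.addSample, State.addTime, Loc.putNat, State.setNat, Loc.cost, NExp.cost,
        NExp.cost_reg, Env.get]
      nlinarith
    · have := hD.samples
      simp only [State.addSample, State.addTime, Loc.putNat, State.setNat, this]
      ring
    · rcases Nat.lt_succ_iff_lt_or_eq.1 hk' with h | h
      · simpa [State.addSample, State.addTime, Loc.putNat, State.setNat, NExp.eval, h.ne]
          using hr k' h
      · simpa [State.addSample, State.addTime, Loc.putNat, State.setNat, NExp.eval, h] using hx'
    · simp [State.addSample, State.addTime, Loc.putNat, State.setNat, NExp.eval, hk'.ne]) (by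
    rintro k hk t _ M
    rw [Cmd.exec, expect_map]
    simp only [State.addSample, State.addTime, Loc.putNat, State.setNat, NExp.eval, NExp.eval_reg,
      and_self, if_true]
    rw [show E.get .A = E.A from rfl, hE, expect_sampleRow hA (fun i => sq_nonneg _)]
    refine ofReal_le_of_le_add ?_ (sq_nonneg _) (sq_nonneg _)
    have e : ∀ x : Fin m, vecNorm (A x) = vecNorm fun j : Fin n => star (A x j) := fun x => by
      rw [← sq_eq_sq₀ (vecNorm_nonneg _) (vecNorm_nonneg _), vecNorm_sq, vecNorm_sq]; simp
    have := gram_second_moment (fun (x : Fin m) (j : Fin n) => star (A x j))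
      (Fsq := frobNorm A ^ 2) (by
        rw [frobNorm_sq_eq_rows]
        exact Finset.sum_congr rfl fun x _ => by rw [← e]; rfl) (pow_ne_zero 2 hA)
      (mean := Aᴴ * A) (fun a b => by
        simp [Matrix.mul_apply, Matrix.conjTranspose_apply]) M
    simpa only [Stored.entry_fin, e] using this)
    (s := s.addTime ((NExp.reg 1).cost + 1))
    ⟨⟨rfl, fun _ _ => rfl, by simp [State.addTime], by simp [State.addTime]⟩, by simp⟩
  exact ⟨h1, h2⟩

/-- All sampled rows are non-zero. -/
structure RowsValid {m n : ℕ} (A : Matrix (Fin m) (Fin n) ℂ) (c : ℕ) (I : ℕ → ℕ) : Prop where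
  pos : 0 < c
  frob : frobNorm A ≠ 0
  row : ∀ k < c, (Stored.mk m n A).rowNorm (I k) ≠ 0

theorem RowsValid.norm_sketch_sq {m n c : ℕ} {A : Matrix (Fin m) (Fin n) ℂ} {I : ℕ → ℕ}
    (s j : ℕ) :
    ‖sketch ⟨m, n, A⟩ (frobNorm A ^ 2) c I s j‖ ^ 2 = frobNorm A ^ 2 / c *
      (‖(Stored.mk m n A).entry (I s) j‖ ^ 2 / (Stored.mk m n A).rowNorm (I s) ^ 2) := by
  simp only [sketch, sketchScale, norm_mul, norm_inv, Complex.norm_real, mul_pow, inv_pow,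
    Real.norm_eq_abs, sq_abs]
  rw [Real.sqrt_sq (frobNorm_nonneg A), Real.sq_sqrt (Nat.cast_nonneg c)]
  ring

theorem RowsValid.sum_col {m n c : ℕ} {A : Matrix (Fin m) (Fin n) ℂ} {I : ℕ → ℕ}
    (h : RowsValid A c I) :
    ∑ j : Fin n, vecNorm (fun s : Fin c => sketch ⟨m, n, A⟩ (frobNorm A ^ 2) c I s j) ^ 2 =
      frobNorm A ^ 2 := by
  simp only [vecNorm_sq, RowsValid.norm_sketch_sq]
  rw [Finset.sum_comm]
  have hc : (c : ℝ) ≠ 0 := by exact_mod_cast h.pos.ne'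
  calc _ = ∑ _s : Fin c, frobNorm A ^ 2 / c := by
        refine Finset.sum_congr rfl fun s _ => ?_
        obtain ⟨x, hx⟩ := Stored.exists_of_rowNorm_ne_zero (h.row s s.2)
        have h1 := h.row s s.2
        rw [hx, Stored.rowNorm_fin] at *
        simp only [Stored.entry_fin]
        rw [← Finset.mul_sum, ← Finset.sum_div, ← vecNorm_sq]
        field_simp
    _ = _ := by simp; field_simp

theorem exec_drawCols {m n c : ℕ} {A : Matrix (Fin m) (Fin n) ℂ} {E : Env}
    (hE : E.A = ⟨m, n, A⟩) {s : State} (hc : s.nat 1 0 0 = c)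
    (hI : RowsValid A c fun k => s.nat 3 k 0) {δ : ℝ} (hδ : 0 < δ) {R : Matrix (Fin c) (Fin n) ℂ}
    (hR : R = corner c n (sketch E.A (frobNorm A ^ 2) c fun k => s.nat 3 k 0)) :
    Yields (drawCols.exec E s)
      (fun t => Drawn [2, 4, 5] c (4 + c * (30 + 2 * E.A.opCost)) s t ∧ ∀ k < c, t.nat 5 k 0 < n)
      (fun t => frobNorm (∑ k ∈ Finset.range c, (outer (frobNorm A ^ 2)
        (fun l : Fin c => sketch E.A (frobNorm A ^ 2) c (fun k => s.nat 3 k 0) l (t.nat 5 k 0)) -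
          R * Rᴴ)) ^ 2 ≤ c ^ 2 * δ)
      (ENNReal.ofReal ((frobNorm A ^ 2) ^ 2 / (c * δ))) := by
  have he : (NExp.reg 1).eval s = c := hc
  have hc0 := hI.pos
  have hne : (Finset.range c).Nonempty := Finset.nonempty_range_iff.2 hc0.ne'
  rw [drawCols, Cmd.exec, he]
  obtain ⟨h1, h2⟩ := sampling_loop (fun M : Matrix (Fin c) (Fin c) ℂ => frobNorm M ^ 2)
    (by simp [frobNorm_sq]) (idx := fun t k => t.nat 5 k 0)
    (G := fun j => outer (frobNorm A ^ 2)
      (fun l : Fin c => sketch E.A (frobNorm A ^ 2) c (fun k => s.nat 3 k 0) l j))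
    (mean := R * Rᴴ) (V := (frobNorm A ^ 2) ^ 2) (δ := δ) (N := c)
    (body := fun k s' => (Cmd.seq (.uniform ⟨4, .lit 0, .lit 0⟩ (.reg 1))
      (.sampleCol .A ⟨5, .reg 2, .lit 0⟩ (.cell 3 (.reg 4) (.lit 0)))).exec E
      ((s'.setNat 2 0 0 k).addTime 1))
    (Inv := fun k t => Drawn [2, 4, 5] k (4 + k * (30 + 2 * E.A.opCost)) s t ∧
      ∀ k' < k, t.nat 5 k' 0 < n) hc0 hδ (by
    rintro k hk t ⟨hD, hr⟩ t' ht'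
    have hev : (NExp.reg 1).eval ((t.setNat 2 0 0 k).addTime 1) = c := by
      rw [← hc, ← hD.nat 1 (by simp)]; simp [State.addTime, State.setNat]
    have h3 : t.nat 3 = s.nat 3 := hD.nat 3 (by simp)
    rw [Cmd.exec, Cmd.exec, hev, dif_pos hne, PMF.mem_support_bind_iff] at ht'
    obtain ⟨t1, ht1, ht'⟩ := ht'
    rw [PMF.mem_support_map_iff] at ht1
    obtain ⟨x, hx, rfl⟩ := ht1
    rw [PMF.mem_support_uniformOfFinset_iff, Finset.mem_range] at hx
    rw [Cmd.exec, PMF.mem_support_map_iff] at ht'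
    obtain ⟨y, hy, rfl⟩ := ht'
    have hy' : y < n := by
      obtain ⟨r, hr⟩ := Stored.exists_of_rowNorm_ne_zero (hI.row x hx)
      have h4 := hI.row x hx
      simp only [State.addTime, Loc.putNat, State.setNat, NExp.eval, NExp.eval_reg, h3,
        Env.get, hE] at hy
      simp only [Nat.reduceEqDiff, false_and, if_false, and_self, if_true] at hy
      rw [hr, Stored.rowNorm_fin] at h4
      rw [hr] at hy
      simp only [Stored.sampleCol, Fin.is_lt, dif_pos, Fin.eta] at hy
      obtain ⟨j, rfl, _⟩ := mem_support_l2Sample h4 hy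
      exact j.2
    refine ⟨⟨⟨hD.val, fun a ha => ?_, ?_, ?_⟩, fun k' hk' => ?_⟩, fun k' hk' => ?_⟩
    · rw [← hD.nat a ha]
      ext i j
      simp only [List.mem_cons, List.not_mem_nil, or_false, not_or] at ha
      simp [State.addSample, State.addTime, Loc.putNat, State.setNat, ha]
    · have := hD.time
      simp only [State.addSample, State.addTime, Loc.putNat, State.setNat, Loc.cost, NExp.cost,
        NExp.cost_reg, Env.get]
      nlinarith
    · have := hD.samples
      simp only [State.addSample, State.addTime, Loc.putNat, State.setNat, this]
      ring
    · rcases Nat.lt_succ_iff_lt_or_eq.1 hk' with h | h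
      · simpa [State.addSample, State.addTime, Loc.putNat, State.setNat, NExp.eval, h.ne]
          using hr k' h
      · simpa [State.addSample, State.addTime, Loc.putNat, State.setNat, NExp.eval, h] using hy'
    · simp [State.addSample, State.addTime, Loc.putNat, State.setNat, NExp.eval, hk'.ne]) (by
    rintro k hk t ⟨hD, _⟩ M
    have hev : (NExp.reg 1).eval ((t.setNat 2 0 0 k).addTime 1) = c := by
      rw [← hc, ← hD.nat 1 (by simp)]; simp [State.addTime, State.setNat]
    have h3 : t.nat 3 = s.nat 3 := hD.nat 3 (by simp)
    rw [Cmd.exec, Cmd.exec, hev, dif_pos hne, expect_bind, expect_map]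
    simp only [Cmd.exec, expect_map]
    simp only [State.addSample, State.addTime, Loc.putNat, State.setNat, NExp.eval, NExp.eval_reg,
      and_self, if_true, Nat.reduceEqDiff, false_and, if_false, h3, Env.get]
    set Q : ℕ → ℝ := fun y => frobNorm (M + (outer (frobNorm A ^ 2)
      (fun l : Fin c => sketch E.A (frobNorm A ^ 2) c (fun k => s.nat 3 k 0) l y) - R * Rᴴ)) ^ 2
      with hQ
    have hinner : ∀ x ∈ (PMF.uniformOfFinset (Finset.range c) hne).support,
        expect (E.A.sampleCol (s.nat 3 x 0)) (fun y => ENNReal.ofReal (Q y)) ≤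
          ENNReal.ofReal (∑ j : Fin n, ‖E.A.entry (s.nat 3 x 0) j‖ ^ 2 /
            E.A.rowNorm (s.nat 3 x 0) ^ 2 * Q j) := by
      intro x hx
      rw [PMF.mem_support_uniformOfFinset_iff, Finset.mem_range] at hx
      obtain ⟨r, hr⟩ := Stored.exists_of_rowNorm_ne_zero (hI.row x hx)
      have h4 := hI.row x hx
      rw [hr, Stored.rowNorm_fin] at h4
      rw [hE, hr, expect_sampleCol h4 (fun i => sq_nonneg _), Stored.rowNorm_fin]
      simp only [Stored.entry_fin]
      exact le_rfl
    refine (expect_mono _ hinner).trans ?_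
    rw [expect_uniform (F := fun x => ∑ j : Fin n, ‖E.A.entry (s.nat 3 x 0) j‖ ^ 2 /
      E.A.rowNorm (s.nat 3 x 0) ^ 2 * Q j) hne fun i => Finset.sum_nonneg fun j _ =>
        mul_nonneg (by positivity) (sq_nonneg _)]
    refine ofReal_le_of_le_add ?_ (sq_nonneg _) (sq_nonneg _)
    have hg := gram_second_moment (fun (j : Fin n) (l : Fin c) =>
      sketch E.A (frobNorm A ^ 2) c (fun k => s.nat 3 k 0) l j)
      (Fsq := frobNorm A ^ 2) (by rw [hE]; exact hI.sum_col) (pow_ne_zero 2 hI.frob)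
      (mean := R * Rᴴ) (fun a b => by
        simp [Matrix.mul_apply, Matrix.conjTranspose_apply, hR, corner]) M
    refine le_trans (le_of_eq ?_) hg
    simp only [Finset.mul_sum]
    rw [Finset.sum_comm]
    refine Finset.sum_congr rfl fun j _ => ?_
    rw [vecNorm_sq, Finset.sum_div, Finset.sum_mul]
    refine Finset.sum_congr rfl fun l _ => ?_
    rw [hE, RowsValid.norm_sketch_sq, hQ, hE]
    have hF := hI.frob
    field_simp)
    (s := s.addTime ((NExp.reg 1).cost + 1))
    ⟨⟨rfl, fun _ _ => rfl, by simp [State.addTime], by simp [State.addTime]⟩, by simp⟩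
  exact ⟨h1, h2⟩

/-- The contribution of the entry `(k, j)` to the estimate of `∑ z j * (A* b) j`. -/
def entryTerm (Fsq : ℝ) (A b : Stored) (z : ℕ → ℂ) (x : ℕ × ℕ) : ℂ :=
  (Fsq : ℂ) * z x.2 * (b.entry x.1 0 * (A.entry x.1 x.2)⁻¹)

theorem entry_second_moment {m n : ℕ} {A : Matrix (Fin m) (Fin n) ℂ} (hA : frobNorm A ≠ 0)
    (b : Fin m → ℂ) (z : Fin n → ℂ) {mean : ℂ} (hm : mean = z ⬝ᵥ (Aᴴ *ᵥ b)) (v : ℂ) :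
    ∑ k, ∑ j, ‖A k j‖ ^ 2 / frobNorm A ^ 2 *
      ‖v + (((frobNorm A ^ 2 : ℝ) : ℂ) * z j * (b k * (A k j)⁻¹) - mean)‖ ^ 2 ≤
        ‖v‖ ^ 2 + frobNorm A ^ 2 * vecNorm z ^ 2 * vecNorm b ^ 2 := by
  have hF2 : frobNorm A ^ 2 ≠ 0 := pow_ne_zero 2 hA
  have hw : ∑ x : Fin m × Fin n, ‖A x.1 x.2‖ ^ 2 / frobNorm A ^ 2 = 1 := by
    have e : ∑ x : Fin m × Fin n, ‖A x.1 x.2‖ ^ 2 = frobNorm A ^ 2 := by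
      rw [frobNorm_sq]; exact Fintype.sum_prod_type _
    rw [← Finset.sum_div, e, div_self hF2]
  have h1 := sum_mul_sq_norm_add_sub_le hw
    (fun x => ((frobNorm A ^ 2 : ℝ) : ℂ) * z x.2 * (b x.1 * (A x.1 x.2)⁻¹)) (mean := mean) (by
      rw [Fintype.sum_prod_type, Finset.sum_comm, hm, dotProduct]
      refine Finset.sum_congr rfl fun j _ => ?_
      rw [Matrix.mulVec, dotProduct, Finset.mul_sum]
      refine Finset.sum_congr rfl fun k _ => ?_
      by_cases h0 : A k j = 0
      · simp [h0]
      · have h2 : ((‖A k j‖ ^ 2 : ℝ) : ℂ) = A k j * star (A k j) := by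
          rw [RCLike.star_def, Complex.mul_conj, Complex.normSq_eq_norm_sq]
        rw [Matrix.conjTranspose_apply, Complex.ofReal_div, h2]
        have : ((frobNorm A ^ 2 : ℝ) : ℂ) ≠ 0 := by exact_mod_cast hF2
        field_simp) v
  rw [Fintype.sum_prod_type, Fintype.sum_prod_type] at h1
  refine h1.trans (add_le_add le_rfl ?_)
  rw [vecNorm_sq z, vecNorm_sq b, mul_assoc, Finset.sum_mul_sum, Finset.mul_sum, Finset.sum_comm]
  refine Finset.sum_le_sum fun j _ => ?_
  rw [Finset.mul_sum]
  refine Finset.sum_le_sum fun k _ => ?_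
  simp only [norm_mul, norm_inv, Complex.norm_real, Real.norm_eq_abs, mul_pow, sq_abs, inv_pow]
  by_cases h0 : A k j = 0
  · simp only [h0, norm_zero]
    have : 0 ≤ frobNorm A ^ 2 * (‖z j‖ ^ 2 * ‖b k‖ ^ 2) := by positivity
    simpa using this
  · have : ‖A k j‖ ≠ 0 := norm_ne_zero_iff.2 h0
    apply le_of_eq
    field_simp

theorem exec_drawEntries {m n c : ℕ} {A : Matrix (Fin m) (Fin n) ℂ} (hA : frobNorm A ≠ 0) {E : Env}
    (hE : E.A = ⟨m, n, A⟩) {s : State} (hc : s.nat 1 0 0 = c) (hc0 : 0 < c) {δ : ℝ} (hδ : 0 < δ)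
    {b : Fin m → ℂ} (hb : ∀ k : Fin m, E.b.entry k 0 = b k) (z : ℕ → ℂ) {mean : ℂ}
    (hm : mean = (fun j : Fin n => z j) ⬝ᵥ (Aᴴ *ᵥ b)) :
    Yields (drawEntries.exec E s)
      (fun t => Drawn [2, 6, 7] (2 * c) (4 + c * (30 + 2 * E.A.opCost)) s t)
      (fun t => ‖∑ k ∈ Finset.range c, (entryTerm (frobNorm A ^ 2) E.A E.b z
        (t.nat 6 k 0, t.nat 7 k 0) - mean)‖ ^ 2 ≤ c ^ 2 * δ)
      (ENNReal.ofReal (frobNorm A ^ 2 * vecNorm (fun j : Fin n => z j) ^ 2 * vecNorm b ^ 2 /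
        (c * δ))) := by
  have he : (NExp.reg 1).eval s = c := hc
  rw [drawEntries, Cmd.exec, he]
  obtain ⟨h1, h2⟩ := sampling_loop (fun M : ℂ => ‖M‖ ^ 2)
    (by simp) (idx := fun t k => (t.nat 6 k 0, t.nat 7 k 0))
    (G := entryTerm (frobNorm A ^ 2) E.A E.b z)
    (mean := mean) (V := frobNorm A ^ 2 * vecNorm (fun j : Fin n => z j) ^ 2 * vecNorm b ^ 2)
    (δ := δ) (N := c)
    (body := fun k s' => (Cmd.seq (.sampleRow .A ⟨6, .reg 2, .lit 0⟩)
      (.sampleCol .A ⟨7, .reg 2, .lit 0⟩ (.cell 6 (.reg 2) (.lit 0)))).exec E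
      ((s'.setNat 2 0 0 k).addTime 1))
    (Inv := fun k t => Drawn [2, 6, 7] (2 * k) (4 + k * (30 + 2 * E.A.opCost)) s t) hc0 hδ (by
    rintro k hk t hD t' ht'
    rw [Cmd.exec, Cmd.exec, PMF.mem_support_bind_iff] at ht'
    obtain ⟨t1, ht1, ht'⟩ := ht'
    rw [PMF.mem_support_map_iff] at ht1
    obtain ⟨x, hx, rfl⟩ := ht1
    rw [Cmd.exec, PMF.mem_support_map_iff] at ht'
    obtain ⟨y, hy, rfl⟩ := ht'
    refine ⟨⟨hD.val, fun a ha => ?_, ?_, ?_⟩, fun k' hk' => ?_⟩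
    · rw [← hD.nat a ha]
      ext i j
      simp only [List.mem_cons, List.not_mem_nil, or_false, not_or] at ha
      simp [State.addSample, State.addTime, Loc.putNat, State.setNat, ha]
    · have := hD.time
      simp only [State.addSample, State.addTime, Loc.putNat, State.setNat, Loc.cost, NExp.cost,
        NExp.cost_reg, Env.get]
      nlinarith
    · have := hD.samples
      simp only [State.addSample, State.addTime, Loc.putNat, State.setNat, this]
      ring
    · simp [State.addSample, State.addTime, Loc.putNat, State.setNat, NExp.eval, hk'.ne]) (by
    rintro k hk t _ M
    rw [Cmd.exec, Cmd.exec, expect_bind, expect_map]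
    simp only [Cmd.exec, expect_map]
    simp only [State.addSample, State.addTime, Loc.putNat, State.setNat, NExp.eval, NExp.eval_reg,
      and_self, if_true, Nat.reduceEqDiff, false_and, if_false, Env.get]
    set Q : ℕ → ℕ → ℝ := fun x y => ‖M + (entryTerm (frobNorm A ^ 2) E.A E.b z (x, y) - mean)‖ ^ 2
      with hQ
    have hinner : ∀ x ∈ E.A.sampleRow.support,
        expect (E.A.sampleCol x) (fun y => ENNReal.ofReal (Q x y)) ≤
          ENNReal.ofReal (∑ j : Fin n, ‖E.A.entry x j‖ ^ 2 / E.A.rowNorm x ^ 2 * Q x j) := by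
      intro x hx
      rw [hE] at hx
      have h4 := rowNorm_ne_zero_of_mem_support hA hx
      obtain ⟨r, hr⟩ := Stored.exists_of_rowNorm_ne_zero h4
      rw [hr, Stored.rowNorm_fin] at h4
      rw [hE, hr, expect_sampleCol h4 (fun i => sq_nonneg _), Stored.rowNorm_fin]
      simp only [Stored.entry_fin]
      exact le_rfl
    refine (expect_mono _ hinner).trans ?_
    have h5 := expect_sampleRow hA (F := fun x => ∑ j : Fin n, ‖E.A.entry x j‖ ^ 2 /
      E.A.rowNorm x ^ 2 * Q x j) fun i => Finset.sum_nonneg fun j _ =>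
        mul_nonneg (by positivity) (sq_nonneg _)
    rw [← hE] at h5
    rw [h5]
    refine ofReal_le_of_le_add ?_ (sq_nonneg _) (by positivity)
    refine le_trans (le_of_eq ?_) (entry_second_moment hA b (fun j : Fin n => z j) hm M)
    refine Finset.sum_congr rfl fun x _ => ?_
    rw [Finset.mul_sum]
    refine Finset.sum_congr rfl fun j _ => ?_
    simp only [hQ, entryTerm, hb]
    simp only [hE, Stored.entry_fin, Stored.rowNorm_fin]
    by_cases h0 : vecNorm (A x) = 0
    · have : A x j = 0 := by rw [vecNorm_eq_zero.1 h0]; rfl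
      simp [h0, this]
    · field_simp)
    (s := s.addTime ((NExp.reg 1).cost + 1))
    ⟨rfl, fun _ _ => rfl, by simp [State.addTime], by simp [State.addTime]⟩
  exact ⟨h1, h2⟩

/-! ### The sketches as matrices -/

theorem frobNorm_smul {m n : ℕ} (a : ℂ) (M : Matrix (Fin m) (Fin n) ℂ) :
    frobNorm (a • M) = ‖a‖ * frobNorm M := by
  rw [← sq_eq_sq₀ (frobNorm_nonneg _) (mul_nonneg (norm_nonneg _) (frobNorm_nonneg _)), mul_pow,
    frobNorm_sq, frobNorm_sq]
  simp [Finset.mul_sum, mul_pow]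

theorem frobNorm_sub_le_of_average {c p q : ℕ} (hc : 0 < c) (G : ℕ → Matrix (Fin p) (Fin q) ℂ)
    {mean P : Matrix (Fin p) (Fin q) ℂ}
    (hP : ∀ a b, P a b = (c : ℂ)⁻¹ * ∑ k ∈ Finset.range c, G k a b) {θ : ℝ} (hθ : 0 ≤ θ)
    (h : frobNorm (∑ k ∈ Finset.range c, (G k - mean)) ^ 2 ≤ c ^ 2 * θ ^ 2) :
    frobNorm (mean - P) ≤ θ := by
  have hc' : (0 : ℝ) < c := by exact_mod_cast hc
  have hcc : (c : ℂ) ≠ 0 := by exact_mod_cast hc.ne'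
  have e : ∑ k ∈ Finset.range c, (G k - mean) = (c : ℂ) • (P - mean) := by
    ext a b
    rw [Matrix.sum_apply, Matrix.smul_apply, Matrix.sub_apply, hP, smul_eq_mul, mul_sub,
      mul_inv_cancel_left₀ hcc]
    simp [Finset.sum_sub_distrib]
  rw [e, frobNorm_smul, mul_pow, Complex.norm_natCast] at h
  rw [frobNorm_sub_comm]
  exact le_of_sq_le_sq (le_of_mul_le_mul_left h (by positivity)) hθ

theorem sketchScale_mul_star {Fsq : ℝ} (hF : 0 ≤ Fsq) (c : ℕ) :
    sketchScale Fsq c * star (sketchScale Fsq c) = ((Fsq / c : ℝ) : ℂ) := by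
  rw [RCLike.star_def, Complex.mul_conj, Complex.normSq_eq_norm_sq]
  congr 1
  simp only [sketchScale, norm_mul, norm_inv, Complex.norm_real, mul_pow, inv_pow,
    Real.norm_eq_abs, sq_abs]
  rw [Real.sq_sqrt hF, Real.sq_sqrt (Nat.cast_nonneg c), div_eq_mul_inv]

namespace Draws

variable {m n : ℕ} {A : Matrix (Fin m) (Fin n) ℂ} {d : Draws}

/-- The sketch `R` as a matrix. -/
def Rmat (d : Draws) (n : ℕ) : Matrix (Fin d.c) (Fin n) ℂ := corner d.c n d.R

theorem exists_Rmat_eq (hA : d.A = ⟨m, n, A⟩) (hv : RowsValid A d.c d.rowIdx) :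
    ∃ S : Matrix (Fin d.c) (Fin m) ℂ, d.Rmat n = S * A := by
  refine ⟨Matrix.of fun s k => if (k : ℕ) = d.rowIdx s then
    d.scale * (d.A.rowNorm (d.rowIdx s) : ℂ)⁻¹ else 0, ?_⟩
  ext s j
  obtain ⟨x, hx⟩ := Stored.exists_of_rowNorm_ne_zero (hv.row s s.2)
  rw [Matrix.mul_apply, Finset.sum_eq_single x]
  · simp only [Rmat, corner, Matrix.of_apply, R, sketch, hx, if_true, scale]
    rw [hA, Stored.entry_fin]
    ring
  · intro k _ hk
    have : (k : ℕ) ≠ d.rowIdx s := fun h => hk (Fin.ext (h.trans hx))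
    simp [this]
  · simp

theorem exists_Cmat_eq (hJ : ∀ k < d.c, d.colIdx k < n) :
    ∃ T : Matrix (Fin n) (Fin d.c) ℂ, d.Cmat = d.Rmat n * T := by
  refine ⟨Matrix.of fun j t => if (j : ℕ) = d.colIdx t then
    d.scale * (√(d.colSq (d.colIdx t)).re : ℂ)⁻¹ else 0, ?_⟩
  ext s t
  rw [Matrix.mul_apply, Finset.sum_eq_single ⟨d.colIdx t, hJ t t.2⟩]
  · simp [Rmat, Cmat, corner, C]
  · intro k _ hk
    have : (k : ℕ) ≠ d.colIdx t := fun h => hk (Fin.ext h)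
    simp [this]
  · simp

theorem Rmat_gram (hA : d.A = ⟨m, n, A⟩) (hF : d.Fsq = frobNorm A ^ 2)
    (hv : RowsValid A d.c d.rowIdx) (a b : Fin n) :
    ((d.Rmat n)ᴴ * d.Rmat n) a b = (d.c : ℂ)⁻¹ * ∑ k ∈ Finset.range d.c,
      outer (frobNorm A ^ 2) (fun j : Fin n => star (d.A.entry (d.rowIdx k) j)) a b := by
  rw [Matrix.mul_apply, Finset.sum_range, Finset.mul_sum]
  refine Finset.sum_congr rfl fun s _ => ?_
  obtain ⟨x, hx⟩ := Stored.exists_of_rowNorm_ne_zero (hv.row s s.2)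
  have e : vecNorm (fun j : Fin n => star (A x j)) = vecNorm (A x) := by
    rw [← sq_eq_sq₀ (vecNorm_nonneg _) (vecNorm_nonneg _), vecNorm_sq, vecNorm_sq]; simp
  have h1 := sketchScale_mul_star (sq_nonneg (frobNorm A)) d.c
  rw [Matrix.conjTranspose_apply]
  simp only [Rmat, corner, Matrix.of_apply, R, sketch, outer, hx, star_mul', star_star]
  rw [hA, hF]
  simp only [Stored.entry_fin, Stored.rowNorm_fin, e]
  rw [show ∀ u v w r r' : ℂ, star u * (v * r') * (u * (w * r)) = (u * star u) * (v * w) * (r' * r) by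
    intros; ring, h1]
  simp only [star_inv₀, RCLike.star_def, Complex.conj_ofReal]
  push_cast
  ring

theorem Cmat_gram (hF0 : 0 ≤ d.Fsq) (a b : Fin d.c) :
    (d.Cmat * d.Cmatᴴ) a b = (d.c : ℂ)⁻¹ * ∑ k ∈ Finset.range d.c,
      outer d.Fsq (fun l : Fin d.c => d.R l (d.colIdx k)) a b := by
  rw [Matrix.mul_apply, Finset.sum_range, Finset.mul_sum]
  refine Finset.sum_congr rfl fun t _ => ?_
  have h1 := sketchScale_mul_star hF0 d.c
  have h2 : d.colSq (d.colIdx t) =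
      ((vecNorm (fun l : Fin d.c => d.R l (d.colIdx t)) ^ 2 : ℝ) : ℂ) := by
    rw [← star_dotProduct_self, colSq, Finset.sum_range, dotProduct]
    rfl
  rw [Matrix.conjTranspose_apply]
  simp only [Cmat, corner, Matrix.of_apply, C, outer, star_mul', h2, Complex.ofReal_re, scale]
  rw [Real.sqrt_sq (vecNorm_nonneg _)]
  rw [show ∀ u r r' v v' : ℂ, r * (u * v) * (r' * (star u * v')) =
    (u * star u) * (r * r') * (v * v') by intros; ring, h1]
  simp only [star_inv₀, RCLike.star_def, Complex.conj_ofReal]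
  push_cast
  ring

theorem z_eq (i : Fin n) (hi : d.i = i) (j : Fin n) :
    d.z j = ((d.Rmat n)ᴴ * coreFactor (realExt d.f) d.Cmat * d.Rmat n) i j := by
  unfold coreFactor conjDiag
  rw [← Matrix.mul_assoc, ← Matrix.mul_assoc, Matrix.mul_apply, z, Finset.sum_range]
  refine Finset.sum_congr rfl fun s _ => ?_
  congr 1
  rw [Matrix.mul_apply, weight, Finset.sum_range]
  refine Finset.sum_congr rfl fun k _ => ?_
  rw [Matrix.mul_diagonal, Matrix.conjTranspose_apply, Matrix.mul_apply, coeff, Finset.sum_range]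
  congr 1
  · congr 1
    · refine Finset.sum_congr rfl fun l _ => ?_
      rw [Matrix.conjTranspose_apply, U, ofMatrix_apply, hi]
      rfl
    · simp only [sv, Complex.ofReal_re]
      push_cast
      rw [div_eq_mul_inv]
      ring
  · rw [U, ofMatrix_apply]

theorem estimate_eq : d.estimate = (d.c : ℂ)⁻¹ * ∑ k ∈ Finset.range d.c,
    entryTerm d.Fsq d.A d.b d.z (d.rowIdx' k, d.colIdx' k) := by
  rw [estimate, Finset.mul_sum]
  exact Finset.sum_congr rfl fun k _ => mul_comm _ _

end Draws

/-! ### Correctness of the sampled algorithm -/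

theorem vecNorm_row_le {m n : ℕ} (M : Matrix (Fin m) (Fin n) ℂ) (i : Fin m) :
    vecNorm (M i) ≤ specNorm M := by
  have h := vecNorm_mulVec_le Mᴴ (Pi.single i 1)
  rw [vecNorm_single, mul_one, specNorm_conjTranspose] at h
  refine le_trans (le_of_eq ?_) h
  rw [← sq_eq_sq₀ (vecNorm_nonneg _) (vecNorm_nonneg _), vecNorm_sq, vecNorm_sq]
  simp

theorem Drawn.trans {W W' V : List ℕ} {k k' T T' : ℕ} {s t u : State} (h : Drawn W k T s t)
    (h' : Drawn W' k' T' t u) (hW : W ⊆ V) (hW' : W' ⊆ V) : Drawn V (k + k') (T + T') s u where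
  val := h'.val.trans h.val
  nat a ha := (h'.nat a fun h => ha (hW' h)).trans (h.nat a fun h => ha (hW h))
  time := by have := h.time; have := h'.time; omega
  samples := by rw [h'.samples, h.samples]; ring

def estimateEntry : Cmd := .seq drawRows (.seq drawCols (.seq drawEntries postprocess))

theorem norm_average_sub_le {c : ℕ} (hc : 0 < c) (g : ℕ → ℂ) {mean : ℂ} {ρ : ℝ} (hρ : 0 ≤ ρ)
    (h : ‖∑ k ∈ Finset.range c, (g k - mean)‖ ^ 2 ≤ c ^ 2 * ρ ^ 2) :
    ‖(c : ℂ)⁻¹ * ∑ k ∈ Finset.range c, g k - mean‖ ≤ ρ := by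
  have hc' : (0 : ℝ) < c := by exact_mod_cast hc
  have hcc : (c : ℂ) ≠ 0 := by exact_mod_cast hc.ne'
  have e : ∑ k ∈ Finset.range c, (g k - mean) =
      (c : ℂ) * ((c : ℂ)⁻¹ * ∑ k ∈ Finset.range c, g k - mean) := by
    rw [mul_sub, mul_inv_cancel_left₀ hcc]
    simp [Finset.sum_sub_distrib]
  rw [e, norm_mul, mul_pow, Complex.norm_natCast] at h
  exact le_of_sq_le_sq (le_of_mul_le_mul_left h (by positivity)) hρ

/-- The last sampling loop and the evaluation, from a state in which both sketches are drawn. -/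
theorem exec_drawEntries_postprocess {m n c : ℕ} {A : Matrix (Fin m) (Fin n) ℂ}
    (hA : frobNorm A ≠ 0) {E : Env} (hE : E.A = ⟨m, n, A⟩) {b : Fin m → ℂ}
    (hb : ∀ k : Fin m, E.b.entry k 0 = b k) {op : ℕ} (hop : 0 < op) (hAop : E.A.opCost ≤ op)
    (hbop : E.b.opCost ≤ op) (hAr : E.A.rowNormCost ≤ op) {s : State}
    (hF : s.val 1 0 0 = ((frobNorm A ^ 2 : ℝ) : ℂ)) (hc : s.nat 1 0 0 = c) (hc0 : 0 < c)
    {ρ : ℝ} (hρ : 0 < ρ) :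
    Yields ((Cmd.seq drawEntries postprocess).exec E s)
      (fun t => t.samples = s.samples + 2 * c ∧
        t.time ≤ s.time + (4 + c * (30 + 2 * op) + 3200 * (c ^ 3 * op)))
      (fun t => ‖t.output - (fun j : Fin n => (drawsOf E (frobNorm A ^ 2) s).z j) ⬝ᵥ
        (Aᴴ *ᵥ b)‖ ≤ ρ)
      (ENNReal.ofReal (frobNorm A ^ 2 *
        vecNorm (fun j : Fin n => (drawsOf E (frobNorm A ^ 2) s).z j) ^ 2 * vecNorm b ^ 2 /
          (c * ρ ^ 2))) := by
  have h1 := exec_drawEntries hA hE hc hc0 (pow_pos hρ 2) hb (drawsOf E (frobNorm A ^ 2) s).z rfl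
  rw [Cmd.exec]
  have hpost : ∀ t, Drawn [2, 6, 7] (2 * c) (4 + c * (30 + 2 * E.A.opCost)) s t →
      ∃ u, postprocess.exec E t = PMF.pure u ∧ u.samples = t.samples ∧
        u.time ≤ t.time + 3200 * (c ^ 3 * op) ∧
        u.output = (drawsOf E (frobNorm A ^ 2) t).estimate := by
    intro t ht
    have hct : t.nat 1 0 0 = c := by rw [ht.nat 1 (by simp), hc]
    have := exec_postprocess (E := E) (s := t) (Fsq := frobNorm A ^ 2) (by rw [ht.val, hF])
      (by rw [hct]; exact hc0) hop hAop hbop hAr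
    rwa [hct] at this
  have h2 := h1.bind (k := postprocess.exec E) (S' := fun t => t.samples = s.samples + 2 * c ∧
        t.time ≤ s.time + (4 + c * (30 + 2 * op) + 3200 * (c ^ 3 * op)))
      (G' := fun t => ‖t.output - (fun j : Fin n => (drawsOf E (frobNorm A ^ 2) s).z j) ⬝ᵥ
        (Aᴴ *ᵥ b)‖ ≤ ρ) (δ' := 0) (by
    intro t ht u hu
    obtain ⟨u', hu', h2, h3, _⟩ := hpost t ht
    rw [hu', PMF.mem_support_pure_iff] at hu
    subst hu
    refine ⟨h2.trans ht.samples, h3.trans ?_⟩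
    have h4 := ht.time
    have h5 : c * (30 + 2 * E.A.opCost) ≤ c * (30 + 2 * op) := Nat.mul_le_mul_left _ (by omega)
    omega) (by
    intro t ht hG
    obtain ⟨u, hu, _, _, h4⟩ := hpost t ht
    rw [hu, PMF.toOuterMeasure_pure_apply, if_neg]
    rw [Set.mem_ofPred_eq, not_not, h4, Draws.estimate_eq]
    have ez : (drawsOf E (frobNorm A ^ 2) t).z = (drawsOf E (frobNorm A ^ 2) s).z := by
      have : drawsOf E (frobNorm A ^ 2) t =
          { drawsOf E (frobNorm A ^ 2) s with
            rowIdx' := fun k => t.nat 6 k 0, colIdx' := fun k => t.nat 7 k 0 } := by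
        simp [drawsOf, ht.nat 1, ht.nat 0, ht.nat 3, ht.nat 5]
      rw [this]
      rfl
    have ec : (drawsOf E (frobNorm A ^ 2) t).c = c := by
      show t.nat 1 0 0 = c
      rw [ht.nat 1 (by simp), hc]
    rw [ez, ec]
    exact norm_average_sub_le hc0 _ hρ.le hG)
  rwa [add_zero] at h2

/-- The parameters of a run for which the algorithm is accurate. -/
structure Params {m n : ℕ} (f : ℝ≥0 → ℝ≥0) (A : Matrix (Fin m) (Fin n) ℂ) (b : Fin m → ℂ)
    (l u σ Ω φ θ Z ε η : ℝ) (c : ℕ) : Prop where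
  tame : Tame (realExt f) l u Ω φ
  zero : f 0 = 0
  frob : frobNorm A ≠ 0
  gap : ∀ i, singularValue Aᴴ i = 0 ∨ σ ≤ singularValue Aᴴ i
  hσ : σ ^ 2 = 2 * l ^ 2
  lσ : l ≤ σ
  u_nonneg : 0 ≤ u
  hu : specNorm A ^ 2 + l ^ 2 ≤ u ^ 2
  θ_pos : 0 < θ
  hθ : 4 * θ ≤ l ^ 2
  ε_pos : 0 < ε
  η_pos : 0 < η
  hε : 7 / 2 * ((φ + 3 * Ω / l) / (2 * l ^ 2)) * θ * (specNorm A * vecNorm b) ≤ ε / 2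
  hZ : Ω / σ + 7 / 2 * ((φ + 3 * Ω / l) / (2 * l ^ 2)) * θ ≤ Z
  c_pos : 0 < c
  sketch_fail : (frobNorm A ^ 2) ^ 2 / (c * θ ^ 2) ≤ η / 3
  entry_fail : frobNorm A ^ 2 * Z ^ 2 * vecNorm b ^ 2 / (c * (ε / 2) ^ 2) ≤ η / 3

theorem Params.accuracy {m n : ℕ} {f : ℝ≥0 → ℝ≥0} {A : Matrix (Fin m) (Fin n) ℂ}
    {b : Fin m → ℂ} {l u σ Ω φ θ Z ε η : ℝ} {d : Draws} (h : Params f A b l u σ Ω φ θ Z ε η d.c)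
    (hA : d.A = ⟨m, n, A⟩) (hf : d.f = f) (i : Fin n) (hi : d.i = i)
    (hv : RowsValid A d.c d.rowIdx) (hJ : ∀ k < d.c, d.colIdx k < n)
    (h1 : frobNorm (Aᴴ * A - (d.Rmat n)ᴴ * d.Rmat n) ≤ θ)
    (h2 : frobNorm (d.Rmat n * (d.Rmat n)ᴴ - d.Cmat * d.Cmatᴴ) ≤ θ) :
    ‖(svTransform f Aᴴ *ᵥ b) i - (fun j : Fin n => d.z j) ⬝ᵥ (Aᴴ *ᵥ b)‖ ≤ ε / 2 ∧
      vecNorm (fun j : Fin n => d.z j) ≤ Z := by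
  obtain ⟨S, hS⟩ := Draws.exists_Rmat_eq hA hv
  obtain ⟨T, hT⟩ := Draws.exists_Cmat_eq hJ
  have hσ0 : 0 ≤ σ := h.tame.pos.le.trans h.lσ
  have key := specNorm_leftFactor_sub_le h.tame hS hT
    (fun k => (h.gap k).imp_right fun hk => by
      rw [← h.hσ]; exact pow_le_pow_left₀ hσ0 hk 2) h.u_nonneg h.hu h.hθ h1 h2
  have uA : specNorm Aᴴ ≤ u := by
    rw [specNorm_conjTranspose]
    exact le_of_sq_le_sq (by linarith [h.hu, sq_nonneg l]) h.u_nonneg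
  have hH := specNorm_leftFactor_le h.tame h.lσ h.gap uA
  set N := (d.Rmat n)ᴴ * coreFactor (realExt f) d.Cmat * d.Rmat n with hN
  have hz : (fun j : Fin n => d.z j) = N i := by
    ext j; rw [Draws.z_eq i hi j, hf]
  rw [hz]
  constructor
  · rw [svTransform_eq h.zero, ← Matrix.mulVec_mulVec]
    have e : (leftFactor (realExt f) Aᴴ *ᵥ (Aᴴ *ᵥ b)) i - N i ⬝ᵥ (Aᴴ *ᵥ b) =
        ((leftFactor (realExt f) Aᴴ - N) *ᵥ (Aᴴ *ᵥ b)) i := by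
      rw [Matrix.sub_mulVec]; rfl
    rw [e]
    refine (norm_apply_le_vecNorm _ i).trans ((vecNorm_mulVec_le _ _).trans (le_trans ?_ h.hε))
    refine mul_le_mul key ?_ (vecNorm_nonneg _) ((specNorm_nonneg _).trans key)
    have := vecNorm_mulVec_le Aᴴ b
    rwa [specNorm_conjTranspose] at this
  · refine (vecNorm_row_le N i).trans ((specNorm_sub_le N (leftFactor (realExt f) Aᴴ)).trans
      (le_trans ?_ h.hZ))
    rw [specNorm_sub_comm]
    exact add_le_add hH key

theorem exec_estimateEntry {m n c : ℕ} {f : ℝ≥0 → ℝ≥0} {A : Matrix (Fin m) (Fin n) ℂ}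
    {b : Fin m → ℂ} {l u σ Ω φ θ Z ε η : ℝ} (h : Params f A b l u σ Ω φ θ Z ε η c) {E : Env}
    (hE : E.A = ⟨m, n, A⟩) (hf : E.f = f) (hb : ∀ k : Fin m, E.b.entry k 0 = b k) {op : ℕ}
    (hop : 0 < op) (hAop : E.A.opCost ≤ op) (hbop : E.b.opCost ≤ op) (hAr : E.A.rowNormCost ≤ op)
    {s : State} (hF : s.val 1 0 0 = ((frobNorm A ^ 2 : ℝ) : ℂ)) (hc : s.nat 1 0 0 = c)
    {i : Fin n} (hi : s.nat 0 0 0 = i) :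
    Yields (estimateEntry.exec E s)
      (fun t => t.samples = s.samples + 4 * c ∧ t.time ≤ s.time + 3400 * (c ^ 3 * op))
      (fun t => ‖(svTransform f Aᴴ *ᵥ b) i - t.output‖ ≤ ε) (ENNReal.ofReal η) := by
  have hA := h.frob
  have hc0 := h.c_pos
  have hθ2 : 0 < θ ^ 2 := pow_pos h.θ_pos 2
  have hε2 : 0 < ε / 2 := half_pos h.ε_pos
  have Y1 := exec_drawRows hA hE hc hc0 hθ2
  -- facts about the states after the first and the second loop
  have F1 : ∀ s1, (Drawn [2, 3] c (4 + c * (30 + 2 * E.A.opCost)) s s1 ∧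
      ∀ k < c, E.A.rowNorm (s1.nat 3 k 0) ≠ 0) →
      s1.nat 1 0 0 = c ∧ RowsValid A c fun k => s1.nat 3 k 0 := fun s1 h1 =>
    ⟨by rw [h1.1.nat 1 (by simp), hc], ⟨hc0, hA, fun k hk => by rw [← hE]; exact h1.2 k hk⟩⟩
  have Y2 := fun s1 h1 => exec_drawCols hE (F1 s1 h1).1 (F1 s1 h1).2 hθ2 rfl
  have Y3 : ∀ s1, (Drawn [2, 3] c (4 + c * (30 + 2 * E.A.opCost)) s s1 ∧
      ∀ k < c, E.A.rowNorm (s1.nat 3 k 0) ≠ 0) → ∀ s2,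
      (Drawn [2, 4, 5] c (4 + c * (30 + 2 * E.A.opCost)) s1 s2 ∧ ∀ k < c, s2.nat 5 k 0 < n) → _ :=
    fun s1 h1 s2 h2 => exec_drawEntries_postprocess hA hE hb hop hAop hbop hAr (s := s2)
      (by rw [h2.1.val, h1.1.val, hF]) (by rw [h2.1.nat 1 (by simp), (F1 s1 h1).1]) hc0 hε2
  have sure : ∀ s1, (Drawn [2, 3] c (4 + c * (30 + 2 * E.A.opCost)) s s1 ∧
      ∀ k < c, E.A.rowNorm (s1.nat 3 k 0) ≠ 0) → ∀ s2,
      (Drawn [2, 4, 5] c (4 + c * (30 + 2 * E.A.opCost)) s1 s2 ∧ ∀ k < c, s2.nat 5 k 0 < n) →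
      ∀ t ∈ ((Cmd.seq drawEntries postprocess).exec E s2).support,
        t.samples = s.samples + 4 * c ∧ t.time ≤ s.time + 3400 * (c ^ 3 * op) := by
    intro s1 h1 s2 h2 t ht
    obtain ⟨h3, h4⟩ := (Y3 s1 h1 s2 h2).sure t ht
    have h5 := (h1.1.trans h2.1 (List.subset_append_left _ _) (List.subset_append_right _ _))
    refine ⟨by rw [h3, h5.samples]; ring, h4.trans ?_⟩
    have h6 := h5.time
    have h7 : c * (30 + 2 * E.A.opCost) ≤ c * (30 + 2 * op) := Nat.mul_le_mul_left _ (by omega)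
    have h8 : c * (30 + 2 * op) ≤ 32 * (c ^ 3 * op) := by
      calc c * (30 + 2 * op) ≤ c ^ 3 * (32 * op) :=
            Nat.mul_le_mul (Nat.le_self_pow (by norm_num) c) (by omega)
        _ = _ := by ring
    have h9 : 1 ≤ c ^ 3 * op := Nat.mul_pos (pow_pos hc0 3) hop
    omega
  have total := Y1.bind (k := (Cmd.seq drawCols (.seq drawEntries postprocess)).exec E)
    (S' := fun t => t.samples = s.samples + 4 * c ∧ t.time ≤ s.time + 3400 * (c ^ 3 * op))
    (G' := fun t => ‖(svTransform f Aᴴ *ᵥ b) i - t.output‖ ≤ ε)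
    (δ' := ENNReal.ofReal (η / 3) + ENNReal.ofReal (η / 3))
    (fun s1 h1 => ((Y2 s1 h1).bind (G' := fun _ => True) (δ' := 0)
      (k := (Cmd.seq drawEntries postprocess).exec E) (sure s1 h1) (fun _ _ _ => by simp)).sure)
    (by
      intro s1 h1 g1
      have h3 := (Y2 s1 h1).bind (k := (Cmd.seq drawEntries postprocess).exec E)
        (G' := fun t => ‖(svTransform f Aᴴ *ᵥ b) i - t.output‖ ≤ ε)
        (δ' := ENNReal.ofReal (η / 3)) (sure s1 h1) (by
        intro s2 h2 g2
        set d := drawsOf E (frobNorm A ^ 2) s2 with hd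
        have h5 := (h1.1.trans h2.1 (List.subset_append_left _ _) (List.subset_append_right _ _))
        have e3 : s2.nat 3 = s1.nat 3 := h2.1.nat 3 (by simp)
        have ec : d.c = c := by
          show s2.nat 1 0 0 = c
          rw [h5.nat 1 (by simp), hc]
        have eI : d.rowIdx = fun k => s1.nat 3 k 0 := by
          ext k; show s2.nat 3 k 0 = _; rw [e3]
        have eR : d.R = sketch E.A (frobNorm A ^ 2) c fun k => s1.nat 3 k 0 := by
          show sketch d.A d.Fsq d.c d.rowIdx = _
          rw [eI, ec]; rfl
        have hdA : d.A = ⟨m, n, A⟩ := hE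
        have hv : RowsValid A d.c d.rowIdx := by rw [eI, ec]; exact (F1 s1 h1).2
        have hp : Params f A b l u σ Ω φ θ Z ε η d.c := by rw [ec]; exact h
        have hc0' : 0 < d.c := hp.c_pos
        obtain ⟨a1, a2⟩ := hp.accuracy (d := d) hdA hf i
          (by show s2.nat 0 0 0 = i; rw [h5.nat 0 (by simp), hi]) hv
          (by rw [ec]; exact h2.2)
          (frobNorm_sub_le_of_average hc0' _ (Draws.Rmat_gram hdA rfl hv) h.θ_pos.le
            (by rw [ec, eI]; exact g1))
          (frobNorm_sub_le_of_average hc0' _ (Draws.Cmat_gram (sq_nonneg (frobNorm A)))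
            h.θ_pos.le (by
              rw [← ec] at g2
              simp only [← eI] at g2
              exact g2))
        refine le_trans ?_ ((Y3 s1 h1 s2 h2).fail.trans (ENNReal.ofReal_le_ofReal
          (le_trans ?_ h.entry_fail)))
        · refine MeasureTheory.OuterMeasure.mono _ fun t ht => ?_
          rw [Set.mem_ofPred_eq] at ht ⊢
          contrapose! ht
          calc _ = ‖((svTransform f Aᴴ *ᵥ b) i - (fun j : Fin n => d.z j) ⬝ᵥ (Aᴴ *ᵥ b)) -
                (t.output - (fun j : Fin n => d.z j) ⬝ᵥ (Aᴴ *ᵥ b))‖ := by congr 1; ring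
            _ ≤ ε / 2 + ε / 2 := (norm_sub_le _ _).trans (add_le_add a1 ht)
            _ = ε := add_halves ε
        · have hc' : (0 : ℝ) < c := by exact_mod_cast hc0
          have := pow_le_pow_left₀ (vecNorm_nonneg _) a2 2
          gcongr)
      exact h3.fail.trans (add_le_add (ENNReal.ofReal_le_ofReal h.sketch_fail) le_rfl))
  refine ⟨total.sure, total.fail.trans ?_⟩
  have hη := h.η_pos
  calc _ ≤ ENNReal.ofReal (η / 3) + (ENNReal.ofReal (η / 3) + ENNReal.ofReal (η / 3)) :=
        add_le_add (ENNReal.ofReal_le_ofReal h.sketch_fail) le_rfl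
    _ = ENNReal.ofReal η := by
        rw [← ENNReal.ofReal_add (by positivity) (by positivity),
          ← ENNReal.ofReal_add (by positivity) (by positivity)]
        congr 1; ring

/-! ### The standing quantities of the algorithm -/

theorem singularValue_rank_pos {m n : ℕ} {A : Matrix (Fin m) (Fin n) ℂ} (hA : A ≠ 0) :
    0 < singularValue A (A.rank - 1) := by
  refine (singularValue_nonneg A _).lt_of_ne fun h => ?_
  have h1 := (singularValue_eq_zero_iff A).1 h.symm
  have h2 : A.rank = 0 := by omega
  have h3 := (singularValue_eq_zero_iff A (i := 0)).2 h2.le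
  rw [← specNorm_eq_singularValue_zero, specNorm_eq_zero] at h3
  exact hA h3

theorem specNorm_pos {m n : ℕ} {A : Matrix (Fin m) (Fin n) ℂ} (hA : A ≠ 0) : 0 < specNorm A :=
  (specNorm_nonneg A).lt_of_ne fun h => hA (specNorm_eq_zero.1 h.symm)

theorem one_le_condNumber {m n : ℕ} {A : Matrix (Fin m) (Fin n) ℂ} (hA : A ≠ 0) :
    1 ≤ condNumber A := by
  rw [condNumber, one_le_div (singularValue_rank_pos hA)]
  exact singularValue_antitone A (Nat.zero_le _)

theorem singularValue_conjTranspose_ge {m n : ℕ} {A : Matrix (Fin m) (Fin n) ℂ} (hA : A ≠ 0)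
    (i : ℕ) : singularValue Aᴴ i = 0 ∨ specNorm A / condNumber A ≤ singularValue Aᴴ i := by
  have hσ := singularValue_rank_pos hA
  have e : specNorm A / condNumber A = singularValue A (A.rank - 1) := by
    have := specNorm_pos hA
    rw [condNumber, ← specNorm_eq_singularValue_zero]
    field_simp
  rw [e]
  have h := singularValue_conjTranspose_gap (M := A) (τ := singularValue A (A.rank - 1) ^ 2)
    (fun j => by
      rcases le_or_gt A.rank j with hj | hj
      · exact .inl ((singularValue_eq_zero_iff A).2 hj)
      · exact .inr (pow_le_pow_left₀ hσ.le (singularValue_antitone A (by omega)) 2)) i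
  exact h.imp_right fun h => le_of_sq_le_sq h (singularValue_nonneg _ _)

theorem tame_realExt {f : ℝ≥0 → ℝ≥0} (hf : f 0 = 0) {l u : ℝ} (hl : 0 < l)
    (hd : DifferentiableOn ℝ (realExt f) (Set.Icc l u))
    (hb : BddAbove ((fun x => |derivWithin (realExt f) (Set.Icc l u) x|) '' Set.Icc l u)) :
    Tame (realExt f) l u (maxAbs f (Set.Icc l u)) (maxAbsDeriv f (Set.Icc l u)) where
  pos := hl
  zero := by simp [realExt, hf]
  Ω_nonneg := Real.sSup_nonneg (by rintro _ ⟨x, -, rfl⟩; exact abs_nonneg _)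
  φ_nonneg := Real.sSup_nonneg (by rintro _ ⟨x, -, rfl⟩; exact abs_nonneg _)
  bound s h1 h2 := by
    have hc : ContinuousOn (fun x => |realExt f x|) (Set.Icc l u) := hd.continuousOn.abs
    exact le_csSup (isCompact_Icc.bddAbove_image hc) ⟨s, ⟨h1, h2⟩, rfl⟩
  lipschitz s r h1 h2 h3 h4 := by
    have := Convex.norm_image_sub_le_of_norm_derivWithin_le hd
      (fun x hx => le_csSup hb ⟨x, hx, rfl⟩) (convex_Icc l u) ⟨h3, h4⟩ ⟨h1, h2⟩
    simpa [maxAbsDeriv] using this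

theorem frobNorm_column {m : ℕ} (b : EuclideanSpace ℂ (Fin m)) :
    frobNorm (Matrix.of fun (j : Fin m) (_ : Fin 1) => b j) = ‖b‖ := by
  rw [← sq_eq_sq₀ (frobNorm_nonneg _) (norm_nonneg _), frobNorm_sq, EuclideanSpace.norm_sq_eq]
  simp

/-- The hypotheses on the norms `a`, `F` of the matrix and `β` of the vector, the condition
number `κ`, and the bounds `Ω`, `φ` on the function and its derivative, for the accuracy `ε` and
the failure probability `η`. -/
structure Magnitudes (a F β κ Ω φ ε η : ℝ) : Prop where
  a_pos : 0 < a
  a_le : a ≤ F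
  β_pos : 0 < β
  κ_ge : 1 ≤ κ
  Ω_nonneg : 0 ≤ Ω
  φ_nonneg : 0 ≤ φ
  ε_pos : 0 < ε
  ε_lt : ε < a * β * (φ + 3 * √2 * Ω * (κ / a))
  η_pos : 0 < η
  η_lt : η < 1

/-- The sketch size, up to rounding and a constant. -/
def baseSize (a F β κ Ω φ ε η : ℝ) : ℝ :=
  F ^ 4 * κ ^ 4 * β ^ 2 * (φ + 3 * √2 * Ω * (κ / a)) ^ 2 * (a ^ 2 * ε ^ 2 * η)⁻¹

namespace Magnitudes

variable {a F β κ Ω φ ε η : ℝ} (h : Magnitudes a F β κ Ω φ ε η)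
include h

theorem κ_pos : 0 < κ := one_pos.trans_le h.κ_ge

theorem F_pos : 0 < F := h.a_pos.trans_le h.a_le

theorem slope_pos : 0 < φ + 3 * √2 * Ω * (κ / a) :=
  pos_of_mul_pos_right (h.ε_pos.trans h.ε_lt) (mul_pos h.a_pos h.β_pos).le

theorem one_le_baseSize : 1 ≤ baseSize a F β κ Ω φ ε η := by
  have ha := h.a_pos
  have hε := h.ε_pos
  have hη := h.η_pos
  have hκ := h.κ_pos
  set B := φ + 3 * √2 * Ω * (κ / a)
  have h1 : ε ^ 2 ≤ (a * β * B) ^ 2 := pow_le_pow_left₀ hε.le h.ε_lt.le 2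
  have h2 : a ^ 4 ≤ F ^ 4 := pow_le_pow_left₀ ha.le h.a_le 4
  have h3 : 1 ≤ κ ^ 4 := one_le_pow₀ h.κ_ge
  rw [baseSize, ← div_eq_mul_inv, one_le_div (by positivity)]
  calc a ^ 2 * ε ^ 2 * η ≤ a ^ 2 * (a * β * B) ^ 2 * 1 := by gcongr; exact h.η_lt.le
    _ = a ^ 4 * 1 * β ^ 2 * B ^ 2 := by ring
    _ ≤ F ^ 4 * κ ^ 4 * β ^ 2 * B ^ 2 := by gcongr

theorem baseSize_mul_le (hΩ : ε < Ω * β) :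
    baseSize a F β κ Ω φ ε η ≤ F ^ 8 * β ^ 4 * κ ^ 4 / (ε ^ 4 * η) * (κ / a) ^ 6 * Ω ^ 2 *
      (φ + 3 * √2 * Ω * (κ / a)) ^ 2 := by
  have ha := h.a_pos
  have hε := h.ε_pos
  have hη := h.η_pos
  have hκ := h.κ_pos
  have hX : 0 ≤ baseSize a F β κ Ω φ ε η := zero_le_one.trans h.one_le_baseSize
  have h1 : ε ^ 2 ≤ (Ω * β) ^ 2 := pow_le_pow_left₀ hε.le hΩ.le 2
  have h2 : a ^ 4 ≤ F ^ 4 := pow_le_pow_left₀ ha.le h.a_le 4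
  have h3 : 1 ≤ κ ^ 6 := one_le_pow₀ h.κ_ge
  have key : 1 ≤ F ^ 4 * κ ^ 6 * (Ω * β) ^ 2 / (a ^ 4 * ε ^ 2) := by
    rw [one_le_div (by positivity)]
    calc a ^ 4 * ε ^ 2 = a ^ 4 * 1 * ε ^ 2 := by ring
      _ ≤ _ := by gcongr
  refine (le_mul_of_one_le_right hX key).trans (le_of_eq ?_)
  rw [baseSize]
  field_simp

theorem baseSize_pow_le :
    baseSize a F β κ Ω φ ε η ^ 3 ≤ F ^ 12 * β ^ 6 * κ ^ 12 / (a ^ 6 * ε ^ 6 * η ^ 3) *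
      (φ + 7 * √2 * Ω * (κ / a)) ^ 6 := by
  have ha := h.a_pos
  have hF := h.F_pos
  have hβ := h.β_pos
  have hε := h.ε_pos
  have hη := h.η_pos
  have hκ := h.κ_pos
  have hΩ := h.Ω_nonneg
  have hφ := h.φ_nonneg
  have e : baseSize a F β κ Ω φ ε η ^ 3 = F ^ 12 * β ^ 6 * κ ^ 12 / (a ^ 6 * ε ^ 6 * η ^ 3) *
      (φ + 3 * √2 * Ω * (κ / a)) ^ 6 := by
    rw [baseSize]
    generalize φ + 3 * √2 * Ω * (κ / a) = B
    field_simp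
  rw [e]
  gcongr
  norm_num

theorem params {m n : ℕ} {f : ℝ≥0 → ℝ≥0} {A : Matrix (Fin m) (Fin n) ℂ} {b : Fin m → ℂ} {u : ℝ}
    (hT : Tame (realExt f) (a / (√2 * κ)) u Ω φ) (hf : f 0 = 0) (ea : specNorm A = a)
    (eF : frobNorm A = F) (eb : vecNorm b = β)
    (gap : ∀ i, singularValue Aᴴ i = 0 ∨ a / κ ≤ singularValue Aᴴ i) (hu0 : 0 ≤ u)
    (hu : a ^ 2 + (a / (√2 * κ)) ^ 2 ≤ u ^ 2) (hΩ : ε < Ω * β) {c : ℕ}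
    (hc : 192 * baseSize a F β κ Ω φ ε η ≤ c) :
    Params f A b (a / (√2 * κ)) u (a / κ) Ω φ
      (ε * a / (8 * κ ^ 2 * β * (φ + 3 * √2 * Ω * (κ / a)))) (2 * Ω * κ / a) ε η c := by
  have ha := h.a_pos
  have hF := h.F_pos
  have hβ := h.β_pos
  have hε := h.ε_pos
  have hη := h.η_pos
  have hκ := h.κ_pos
  have hB := h.slope_pos
  have hΩ0 := h.Ω_nonneg
  have hφ := h.φ_nonneg
  have hs : √2 ^ 2 = (2 : ℝ) := Real.sq_sqrt zero_le_two
  have hs0 : 0 < √2 := by positivity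
  have el : (a / (√2 * κ)) ^ 2 = a ^ 2 / (2 * κ ^ 2) := by rw [div_pow, mul_pow, hs]
  have eB : φ + 3 * Ω / (a / (√2 * κ)) = φ + 3 * √2 * Ω * (κ / a) := by field_simp
  have hB' : 3 * √2 * Ω * (κ / a) ≤ φ + 3 * √2 * Ω * (κ / a) := by linarith
  have hBε := h.ε_lt
  have hX : 1 ≤ baseSize a F β κ Ω φ ε η := h.one_le_baseSize
  have hc0 : (0 : ℝ) < c := by linarith
  have hX' : 192 * (F ^ 4 * κ ^ 4 * β ^ 2 * (φ + 3 * √2 * Ω * (κ / a)) ^ 2 *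
    (a ^ 2 * ε ^ 2 * η)⁻¹) ≤ c := hc
  have hB2 : 18 * Ω ^ 2 * (κ / a) ^ 2 ≤ (φ + 3 * √2 * Ω * (κ / a)) ^ 2 := by
    have := pow_le_pow_left₀ (by positivity) hB' 2
    calc _ = 9 * √2 ^ 2 * Ω ^ 2 * (κ / a) ^ 2 := by rw [hs]; ring
      _ = (3 * √2 * Ω * (κ / a)) ^ 2 := by ring
      _ ≤ _ := this
  generalize φ + 3 * √2 * Ω * (κ / a) = B at *
  have key : 7 / 2 * ((φ + 3 * Ω / (a / (√2 * κ))) / (2 * (a / (√2 * κ)) ^ 2)) *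
      (ε * a / (8 * κ ^ 2 * β * B)) = 7 / 16 * (ε / (a * β)) := by
    rw [eB, el]
    field_simp
    norm_num
  exact {
    tame := hT
    zero := hf
    frob := by rw [eF]; exact hF.ne'
    gap := gap
    hσ := by rw [el]; field_simp
    lσ := by
      rw [mul_comm, ← div_div]
      exact div_le_self (by positivity) (Real.one_le_sqrt.2 one_le_two)
    u_nonneg := hu0
    hu := by rw [ea]; exact hu
    θ_pos := by positivity
    hθ := by
      rw [el, ← mul_div_assoc, div_le_div_iff₀ (by positivity) (by positivity)]
      calc 4 * (ε * a) * (2 * κ ^ 2) = ε * (8 * a * κ ^ 2) := by ring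
        _ ≤ (a * β * B) * (8 * a * κ ^ 2) := by gcongr
        _ = _ := by ring
    ε_pos := hε
    η_pos := hη
    hε := by
      rw [key, ea, eb]
      field_simp
      norm_num
    hZ := by
      rw [key]
      have h1 : ε / (a * β) ≤ Ω * κ / a := by
        rw [div_le_div_iff₀ (by positivity) ha]
        calc ε * a ≤ (Ω * β) * a := by gcongr
          _ = Ω * 1 * (a * β) := by ring
          _ ≤ Ω * κ * (a * β) := by gcongr; exact h.κ_ge
      have h2 : Ω / (a / κ) = Ω * κ / a := by field_simp
      have h3 : 0 ≤ Ω * κ / a := by positivity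
      have h4 : 2 * Ω * κ / a = 2 * (Ω * κ / a) := by ring
      rw [h2, h4]
      linarith
    c_pos := by exact_mod_cast hc0
    sketch_fail := by
      rw [eF, div_le_iff₀ (by positivity)]
      calc (F ^ 2) ^ 2 = η / 3 * ((192 * (F ^ 4 * κ ^ 4 * β ^ 2 * B ^ 2 *
            (a ^ 2 * ε ^ 2 * η)⁻¹)) * (ε * a / (8 * κ ^ 2 * β * B)) ^ 2) := by
              field_simp; norm_num
        _ ≤ _ := by gcongr
    entry_fail := by
      rw [eF, eb, div_le_iff₀ (by positivity)]
      have h2 : a ^ 2 ≤ F ^ 2 := pow_le_pow_left₀ ha.le h.a_le 2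
      have h3 : 1 ≤ κ ^ 4 := one_le_pow₀ h.κ_ge
      calc F ^ 2 * (2 * Ω * κ / a) ^ 2 * β ^ 2 = 4 * (F ^ 2 * Ω ^ 2 * κ ^ 2 * β ^ 2 / a ^ 2) := by
            field_simp; ring
        _ ≤ 288 * (F ^ 2 * Ω ^ 2 * κ ^ 2 * β ^ 2 / a ^ 2) := by gcongr; norm_num
        _ = η / 3 * ((192 * (F ^ 2 * a ^ 2 * 1 * β ^ 2 * (18 * Ω ^ 2 * (κ / a) ^ 2) *
            (a ^ 2 * ε ^ 2 * η)⁻¹)) * (ε / 2) ^ 2) := by field_simp; ring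
        _ ≤ η / 3 * ((192 * (F ^ 2 * F ^ 2 * κ ^ 4 * β ^ 2 * B ^ 2 *
            (a ^ 2 * ε ^ 2 * η)⁻¹)) * (ε / 2) ^ 2) := by gcongr
        _ = η / 3 * ((192 * (F ^ 4 * κ ^ 4 * β ^ 2 * B ^ 2 *
            (a ^ 2 * ε ^ 2 * η)⁻¹)) * (ε / 2) ^ 2) := by ring
        _ ≤ _ := by gcongr }

end Magnitudes

theorem clog_add_one_sq_le {N : ℕ} (hN : 1 ≤ N) :
    (((Nat.clog 2 N + 1) ^ 2 : ℕ) : ℝ) ≤ 4 * (1 + Real.log N) ^ 2 := by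
  have hlog : 0 ≤ Real.log N := Real.log_natCast_nonneg N
  have h1 : (Nat.clog 2 N : ℝ) ≤ Real.logb 2 N + 1 := by
    have h := Nat.ceil_lt_add_one (Real.logb_nonneg one_lt_two (by exact_mod_cast hN : (1 : ℝ) ≤ N))
    have e := Real.natCeil_logb_natCast 2 N
    norm_num at e
    rw [e] at h
    exact h.le
  have h2 : Real.logb 2 N ≤ 3 / 2 * Real.log N := by
    rw [Real.logb, div_le_iff₀ (Real.log_pos one_lt_two)]
    have := Real.log_two_gt_d9
    nlinarith
  push_cast
  calc ((Nat.clog 2 N : ℝ) + 1) ^ 2 ≤ (2 * (1 + Real.log N)) ^ 2 := by gcongr; linarith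
    _ = _ := by ring

/-! ### The program -/

/-- The `k`-th real input. -/
def realInput (k : ℕ) : ZExp := .cell 0 (.lit k) (.lit 0)

/-- The squared norm that was read from the data structure. -/
def normSq (k : ℕ) : ZExp := .cell 1 (.lit k) (.lit 0)

/-- `φ + 3 √2 Ω κ / ‖A‖` -/
def slopeExp : ZExp :=
  .add (realInput 5) (.mul (.mul (.mul (.lit 3) (.sqrt (.lit 2))) (realInput 4))
    (.mul (realInput 3) (.inv (realInput 2))))

def ZExp.sq (z : ZExp) : ZExp := .mul z z

/-- The number of rows and columns to draw, before rounding. -/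
def sizeExp : ZExp :=
  .mul (.mul (.mul (.mul (.mul (.lit 192) (.sq (normSq 0))) (.sq (.sq (realInput 3)))) (normSq 1))
    (.sq slopeExp)) (.inv (.mul (.mul (.sq (realInput 2)) (.sq (realInput 0))) (realInput 1)))

theorem sizeExp_eval {E : Env} {s : State} {a F β κ Ω φ ε η : ℝ}
    (h0 : s.val 0 0 0 = (ε : ℂ)) (h1 : s.val 0 1 0 = (η : ℂ)) (h2 : s.val 0 2 0 = (a : ℂ))
    (h3 : s.val 0 3 0 = (κ : ℂ)) (h4 : s.val 0 4 0 = (Ω : ℂ)) (h5 : s.val 0 5 0 = (φ : ℂ))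
    (hF : s.val 1 0 0 = ((F ^ 2 : ℝ) : ℂ)) (hβ : s.val 1 1 0 = ((β ^ 2 : ℝ) : ℂ)) :
    sizeExp.eval E s = ((192 * baseSize a F β κ Ω φ ε η : ℝ) : ℂ) := by
  have e : sizeExp.eval E s = ((192 * (F ^ 2 * F ^ 2) * (κ * κ * (κ * κ)) * β ^ 2 *
      ((φ + 3 * √2 * Ω * (κ * a⁻¹)) * (φ + 3 * √2 * Ω * (κ * a⁻¹))) *
      (a * a * (ε * ε) * η)⁻¹ : ℝ) : ℂ) := by
    simp [sizeExp, ZExp.sq, slopeExp, normSq, realInput, ZExp.eval, NExp.eval, h0, h1, h2, h3, h4,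
      h5, hF, hβ]
  rw [e, baseSize]
  congr 1
  ring

/-- Output `0` if `Ω ‖b‖ ≤ ε`; otherwise sample. -/
def transformEntry : Cmd :=
  .seq (.frobSq .A ⟨1, .lit 0, .lit 0⟩) (.seq (.frobSq .b ⟨1, .lit 1, .lit 0⟩)
    (.ite (.reLe (.mul (realInput 4) (.sqrt (normSq 1))) (realInput 0))
      (.setVal ⟨0, .lit 0, .lit 0⟩ (.lit 0))
      (.seq (.ceil ⟨1, .lit 0, .lit 0⟩ sizeExp) estimateEntry)))

theorem exec_transformEntry {m n : ℕ} {f : ℝ≥0 → ℝ≥0} {A : Matrix (Fin m) (Fin n) ℂ}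
    {b : EuclideanSpace ℂ (Fin m)} {a F β κ Ω φ ε η u : ℝ} (h : Magnitudes a F β κ Ω φ ε η)
    (ea : specNorm A = a) (eF : frobNorm A = F) (eb : ‖b‖ = β)
    (gap : ∀ i, singularValue Aᴴ i = 0 ∨ a / κ ≤ singularValue Aᴴ i)
    (hT : Tame (realExt f) (a / (√2 * κ)) u Ω φ) (hf : f 0 = 0)
    (hu0 : 0 ≤ u) (hu : a ^ 2 + (a / (√2 * κ)) ^ 2 ≤ u ^ 2) (i : Fin n) {op : ℕ}
    (hop : op = (Nat.clog 2 (m * n) + 1) ^ 2) :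
    Yields (transformEntry.exec ⟨f, ⟨m, n, A⟩, ⟨m, 1, Matrix.of fun j _ => b j⟩⟩
        (initial [i, m, n] [ε, η, a, κ, Ω, φ]))
      (fun t => (t.samples : ℝ) ≤ (if ε < Ω * β then 8 * (192 * baseSize a F β κ Ω φ ε η) else 0) ∧
        (t.time : ℝ) ≤ 3600 * ((2 * (192 * baseSize a F β κ Ω φ ε η)) ^ 3 * op))
      (fun t => ‖(svTransform f Aᴴ *ᵥ b.ofLp) i - t.output‖ ≤ ε) (ENNReal.ofReal η) := by
  set E : Env := ⟨f, ⟨m, n, A⟩, ⟨m, 1, Matrix.of fun j _ => b j⟩⟩ with hE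
  set s := initial [i, m, n] [ε, η, a, κ, Ω, φ] with hs
  have eb' : vecNorm b.ofLp = β := eb
  have eEA : frobNorm E.A.mat = F := eF
  have eEb : frobNorm E.b.mat = β := (frobNorm_column b).trans eb
  have hm : 1 ≤ m := by
    rcases Nat.eq_zero_or_pos m with rfl | h0
    · have := h.a_pos
      rw [← ea, specNorm_eq_zero.2 (by ext j; exact j.elim0)] at this
      exact absurd this (lt_irrefl _)
    · exact h0
  have hn : 1 ≤ n := i.pos
  have hop1 : 1 ≤ op := by rw [hop]; exact Nat.one_le_pow _ _ (Nat.succ_pos _)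
  have hop1' : (1 : ℝ) ≤ op := by exact_mod_cast hop1
  have hX := h.one_le_baseSize
  set X := baseSize a F β κ Ω φ ε η
  set s1 := (Loc.putVal ⟨1, .lit 1, .lit 0⟩ ((Loc.putVal ⟨1, .lit 0, .lit 0⟩ s
    ((F ^ 2 : ℝ) : ℂ)).addTime 4) ((β ^ 2 : ℝ) : ℂ)).addTime 4 with hs1
  have run : transformEntry.exec E s = (Cmd.ite (.reLe (.mul (realInput 4) (.sqrt (normSq 1)))
      (realInput 0)) (.setVal ⟨0, .lit 0, .lit 0⟩ (.lit 0))
      (.seq (.ceil ⟨1, .lit 0, .lit 0⟩ sizeExp) estimateEntry)).exec E s1 := by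
    rw [transformEntry, exec_seq_of_pure (t := (Loc.putVal ⟨1, .lit 0, .lit 0⟩ s
      ((F ^ 2 : ℝ) : ℂ)).addTime 4), exec_seq_of_pure (t := s1)]
    · simp only [Cmd.exec, Env.get, eEb]; rfl
    · simp only [Cmd.exec, Env.get, eEA]; rfl
  have htest : (Test.reLe (.mul (realInput 4) (.sqrt (normSq 1))) (realInput 0)).holds E s1 ↔
      Ω * β ≤ ε := by
    have hβ := h.β_pos.le
    have hsq : ((β : ℂ) ^ 2).re = β ^ 2 := by rw [← Complex.ofReal_pow, Complex.ofReal_re]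
    simp [Test.holds, realInput, normSq, ZExp.eval, NExp.eval, s1, State.addTime, Loc.putVal,
      State.setVal, s, initial, Complex.mul_re]
    rw [hsq, Real.sqrt_sq hβ]
  rw [run, Cmd.exec]
  by_cases hΩ : Ω * β ≤ ε
  · rw [if_pos (htest.2 hΩ), Cmd.exec]
    have hbase : (0 : ℝ≥0∞) ≤ ENNReal.ofReal η := zero_le
    refine (fun y : Yields _ _ _ 0 => ⟨y.sure, y.fail.trans hbase⟩) (Yields.of_pure ⟨?samples, ?time⟩ ?error)
    case samples =>
      rw [if_neg (not_lt.2 hΩ)]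
      simp [s1, State.addTime, Loc.putVal, State.setVal, s, initial]
    case time =>
      have ht : (1 : ℝ) ≤ X ^ 3 * op :=
        one_le_mul_of_one_le_of_one_le (one_le_pow₀ hX) hop1'
      refine le_trans (b := (3600 : ℝ)) ?_ (by nlinarith)
      norm_num [s1, State.addTime, Loc.putVal, State.setVal, s, initial, Loc.cost, NExp.cost,
        ZExp.cost, Test.cost, realInput, normSq]
    case error =>
      have e0 : State.output (((Loc.putVal ⟨0, .lit 0, .lit 0⟩ (s1.addTime
          ((Test.reLe (.mul (realInput 4) (.sqrt (normSq 1))) (realInput 0)).cost + 1))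
          ((ZExp.lit 0).eval E (s1.addTime
          ((Test.reLe (.mul (realInput 4) (.sqrt (normSq 1))) (realInput 0)).cost + 1))))).addTime
          (Loc.cost ⟨0, .lit 0, .lit 0⟩ + (ZExp.lit 0).cost + 1)) = 0 := by
        simp [State.output, Loc.putVal, State.addTime, State.setVal, NExp.eval, ZExp.eval]
      rw [e0, sub_zero]
      have hl : a / (√2 * κ) ≤ a / κ := by
        have := h.κ_pos
        have := h.a_pos
        rw [mul_comm, ← div_div]
        exact div_le_self (by positivity) (Real.one_le_sqrt.2 one_le_two)
      have h1 := specNorm_svTransform_le hT hf (M := Aᴴ)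
        (fun j => (gap j).imp_right hl.trans) (by
          rw [specNorm_conjTranspose, ea]
          exact le_of_sq_le_sq (by nlinarith [sq_nonneg (a / (√2 * κ))]) hu0)
      calc _ ≤ vecNorm (svTransform f Aᴴ *ᵥ b.ofLp) := norm_apply_le_vecNorm _ i
        _ ≤ specNorm (svTransform f Aᴴ) * vecNorm b.ofLp := vecNorm_mulVec_le _ _
        _ ≤ Ω * β := by rw [eb']; gcongr; exact h.β_pos.le
        _ ≤ ε := hΩ
  · rw [if_neg (fun h => hΩ (htest.1 h))]
    have hΩ' := not_le.1 hΩ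
    rw [if_pos hΩ']
    set s2 := s1.addTime
      ((Test.reLe (.mul (realInput 4) (.sqrt (normSq 1))) (realInput 0)).cost + 1) with hs2
    have hsize : sizeExp.eval E s2 = ((192 * X : ℝ) : ℂ) := by
      apply sizeExp_eval <;>
      simp [s2, s1, State.addTime, Loc.putVal, State.setVal, NExp.eval, s, initial]
    set c := ⌈192 * X⌉₊ with hc
    have hcX : 192 * X ≤ c := Nat.le_ceil _
    have hcX' : (c : ℝ) ≤ 2 * (192 * X) := by
      have := Nat.ceil_lt_add_one (show 0 ≤ 192 * X by linarith)
      linarith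
    have hc1 : 1 ≤ c := by
      rw [Nat.one_le_iff_ne_zero]; rintro h0; rw [h0] at hcX; norm_num at hcX; linarith
    set s3 := (Loc.putNat ⟨1, .lit 0, .lit 0⟩ s2 c).addTime (3 + sizeExp.cost + c + 1) with hs3
    rw [exec_seq_of_pure (t := s3) (by simp only [Cmd.exec, hsize, Complex.ofReal_re]; rfl)]
    have main := exec_estimateEntry (s := s3) (c := c) (E := E) (op := op) (i := i)
      (h.params hT hf ea eF eb' gap hu0 hu hΩ' hcX) rfl rfl
      (fun k => (dif_pos ⟨k.2, one_pos⟩).trans rfl) hop1 (by rw [hop]; rfl)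
      (by
        rw [hop]
        refine Nat.pow_le_pow_left (Nat.succ_le_succ (Nat.clog_mono_right 2 ?_)) 2
        exact Nat.mul_le_mul_left m hn)
      (by
        rw [hop]
        refine Nat.pow_le_pow_left (Nat.succ_le_succ (Nat.clog_mono_right 2 ?_)) 2
        exact Nat.le_mul_of_pos_right m hn)
      (by simp [s3, s2, s1, State.addTime, Loc.putVal, Loc.putNat, State.setNat, State.setVal,
        NExp.eval, eF])
      (by simp [s3, State.addTime, Loc.putNat, State.setNat, NExp.eval])
      (by simp [s3, s2, s1, State.addTime, Loc.putVal, Loc.putNat, State.setNat, State.setVal,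
        NExp.eval, s, initial])
    have hsm : s3.samples = 0 := rfl
    have htm : s3.time ≤ 120 + c := by
      simp [s3, s2, s1, State.addTime, Loc.putVal, Loc.putNat, State.setNat, State.setVal, s,
        initial, sizeExp, slopeExp, ZExp.sq, realInput, normSq, ZExp.cost, NExp.cost, Test.cost]
      omega
    refine ⟨fun t ht => ?_, main.fail⟩
    obtain ⟨h1, h2⟩ := main.sure t ht
    constructor
    · rw [h1, hsm]; push_cast; linarith
    · have hc3 : c ≤ c ^ 3 * op :=
        (Nat.le_self_pow (by norm_num) c).trans (Nat.le_mul_of_pos_right _ hop1)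
      have h3 : t.time ≤ 3600 * (c ^ 3 * op) := by omega
      have h4 : (t.time : ℝ) ≤ 3600 * ((c : ℝ) ^ 3 * op) := by exact_mod_cast h3
      exact h4.trans (by gcongr)

end SVT

end

open SVT in
theorem theorem1 :
    ∃ (P : Cmd) (C : ℝ) (k : ℕ),
      ∀ (f : ℝ≥0 → ℝ≥0), f 0 = 0 →
      ∀ (η : ℝ), 0 < η → η < 1 →
      ∀ (m n : ℕ) (A : Matrix (Fin m) (Fin n) ℂ) (b : EuclideanSpace ℂ (Fin m)) (i : Fin n),
        A ≠ 0 → b ≠ 0 →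
        DifferentiableOn ℝ (realExt f) (intervalL A) →
        BddAbove ((fun x => |derivWithin (realExt f) (intervalL A) x|) '' intervalL A) →
      ∀ (Ω φ κ : ℝ), Ω = maxAbs f (intervalL A) → φ = maxAbsDeriv f (intervalL A) →
        κ = condNumber A →
      ∀ (ε₁ : ℝ), 0 < ε₁ →
        ε₁ < specNorm A * ‖b‖ * (φ + 3 * √2 * Ω * (κ / specNorm A)) →
        ENNReal.ofReal (1 - η) ≤ (run P f A b ε₁ η i).toOuterMeasure
          {s | ‖(svTransform f Aᴴ *ᵥ b.ofLp) i - s.output‖ ≤ ε₁} ∧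
        ∀ s ∈ (run P f A b ε₁ η i).support,
          (s.samples : ℝ) ≤
            C * (frobNorm A ^ 8 * ‖b‖ ^ 4 * κ ^ 4 / (ε₁ ^ 4 * η) * (κ / specNorm A) ^ 6 * Ω ^ 2 *
              (φ + 3 * √2 * Ω * (κ / specNorm A)) ^ 2 * (1 + Real.log (m * n / η)) ^ k) ∧
          (s.time : ℝ) ≤
            C * (frobNorm A ^ 12 * ‖b‖ ^ 6 * κ ^ 12 / (specNorm A ^ 6 * ε₁ ^ 6 * η ^ 3) *
              (φ + 7 * √2 * Ω * (κ / specNorm A)) ^ 6 * (1 + Real.log (m * n)) ^ k) := by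
  refine ⟨transformEntry, 10 ^ 12, 2, ?_⟩
  intro f hf η hη hη1 m n A b i hA hb hd hbd Ω φ κ eΩ eφ eκ ε hε hεB
  have ha := specNorm_pos hA
  have hκ : 1 ≤ κ := eκ ▸ one_le_condNumber hA
  have hκ0 : 0 < κ := one_pos.trans_le hκ
  have eL : intervalL A = Set.Icc (specNorm A / (√2 * κ))
      (specNorm A / (√2 * κ) * √(2 * κ ^ 2 + 1)) := by rw [eκ]; rfl
  have hl : 0 < specNorm A / (√2 * κ) := by positivity
  have hs : √2 ^ 2 = (2 : ℝ) := Real.sq_sqrt zero_le_two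
  have hT := tame_realExt hf hl (eL ▸ hd) (eL ▸ hbd)
  rw [← eL, ← eΩ, ← eφ] at hT
  have h : Magnitudes (specNorm A) (frobNorm A) ‖b‖ κ Ω φ ε η :=
    { a_pos := ha, a_le := specNorm_le_frobNorm A, β_pos := norm_pos_iff.2 hb, κ_ge := hκ,
      Ω_nonneg := hT.Ω_nonneg, φ_nonneg := hT.φ_nonneg, ε_pos := hε, ε_lt := hεB, η_pos := hη,
      η_lt := hη1 }
  have Y := exec_transformEntry h rfl rfl rfl
    (by rw [eκ]; exact singularValue_conjTranspose_ge hA) hT hf (by positivity)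
    (le_of_eq (by
      rw [mul_pow, Real.sq_sqrt (by positivity), div_pow, mul_pow, hs]
      field_simp)) i rfl
  have erun : run transformEntry f A b ε η i =
      transformEntry.exec ⟨f, ⟨m, n, A⟩, ⟨m, 1, Matrix.of fun j _ => b j⟩⟩
        (initial [i, m, n] [ε, η, specNorm A, κ, Ω, φ]) := by
    rw [run, eΩ, eφ, eκ]
  rw [erun]
  have hm : 1 ≤ m := by
    rcases Nat.eq_zero_or_pos m with rfl | h0
    · exact absurd (by ext j; exact j.elim0) hA
    · exact h0
  have hmn : 1 ≤ m * n := Nat.mul_pos hm i.pos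
  have hmn' : (1 : ℝ) ≤ m * n := by exact_mod_cast hmn
  refine ⟨Y.one_sub_le hη.le, fun s hs' => ?_⟩
  obtain ⟨h1, h2⟩ := Y.sure s hs'
  have hβ := h.β_pos
  have hF := h.F_pos
  have hΩ0 := h.Ω_nonneg
  have hφ0 := h.φ_nonneg
  constructor
  · refine h1.trans ?_
    have hlog : 0 ≤ Real.log (m * n / η) :=
      Real.log_nonneg ((one_le_div hη).2 (hη1.le.trans hmn'))
    have hL : 1 ≤ (1 + Real.log (m * n / η)) ^ 2 := one_le_pow₀ (by linarith)
    split_ifs with hΩ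
    · have h3 := h.baseSize_mul_le hΩ
      refine le_trans ?_ (mul_le_mul_of_nonneg_left
        (le_mul_of_one_le_right ((zero_le_one.trans h.one_le_baseSize).trans h3) hL)
        (by norm_num))
      have := h.one_le_baseSize
      linarith
    · positivity
  · refine h2.trans ?_
    have h3 := h.baseSize_pow_le
    have h4 := clog_add_one_sq_le hmn
    push_cast at h4 ⊢
    have hX := zero_le_one.trans h.one_le_baseSize
    generalize baseSize (specNorm A) (frobNorm A) ‖b‖ κ Ω φ ε η = X at *
    calc 3600 * ((2 * (192 * X)) ^ 3 * ((Nat.clog 2 (m * n) : ℝ) + 1) ^ 2)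
        ≤ 3600 * ((2 * (192 * X)) ^ 3 * (4 * (1 + Real.log (m * n)) ^ 2)) := by gcongr
      _ = 815372697600 * (X ^ 3 * (1 + Real.log (m * n)) ^ 2) := by ring
      _ ≤ 10 ^ 12 * (_ * (1 + Real.log (m * n)) ^ 2) :=
        mul_le_mul (by norm_num) (mul_le_mul_of_nonneg_right h3 (by positivity))
          (by positivity) (by norm_num)
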